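/- Let $N\ge 1$, let $X\neq\{0\}$ be a finite-dimensional complex Banach space, let $p\in\{0\}\cup[1,\infty]$, and let $\mathbf X=l^p(\mathbb Z^N,X)$ (where $l^0(\mathbb Z^N,X)$ denotes the closure in $l^\infty(\mathbb Z^N,X)$ of the finitely supported sequences). Let $\mathcal P=(P_n)_{n\in\mathbb N}$, where $P_n$ is multiplication by the characteristic function of $\{-n,\dots,n\}^N$. Notation. For a complex Banach space $\mathbf Y$ with a sequence $\mathcal R=(R_n)$ of bounded projections, $\mathcal K(\mathbf Y)$ is the ideal of compact operators in the algebra $\mathcal L(\mathbf Y)$ of bounded operators; $\mathcal K(\mathbf Y,\mathcal R)$ is the set of all $K\in\mathcal L(\mathbf Y)$ with $\|(I-R_n)K\|+\|K(I-R_n)\|\to0$; and $\mathcal L(\mathbf Y,\mathcal R)$ is the algebra of all $A\in\mathcal L(\mathbf Y)$ such that $AK,KA\in\mathcal K(\mathbf Y,\mathcal R)$ for all $K\in\mathcal K(\mathbf Y,\mathcal R)$, in which $\mathcal K(\mathbf Y,\mathcal R)$ is a two-sided ideal. The lower norm of an operator $A$ is $\nu(A)=\inf\{\|Ax\|:\|x\|=1\}$,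 and $$\nu_{\mathrm{ess}}^{c}(A)=\sup\{\nu(A+K):K\in\mathcal K(\mathbf Y)\},\qquad \nu_{\mathrm{ess}}(A)=\sup\{\nu(A+K):K\in\mathcal K(\mathbf Y,\mathcal R)\},$$ $$\tilde\mu(A)=\lim_{m\to\infty}\nu\bigl(A|_{\operatorname{im}(I-R_m)}\bigr),\qquad \mu(A)=\min\{\tilde\mu(A),\tilde\mu(A^*)\}.$$ Here $A^*$ is the Banach space adjoint of $A$ on the dual space $\mathbf Y^*$, $A\oplus A^*$ acts on $\mathbf Y\oplus\mathbf Y^*$ with norm $\|(x,f)\|=\max\{\|x\|,\|f\|\}$, and $\nu_{\mathrm{ess}}$ and $\tilde\mu$ are taken with respect to $\mathcal P$ for operators on $\mathbf X$, $\mathcal P^*=(P_n^*)$ for operators on $\mathbf X^*$, and $\mathcal P\oplus\mathcal P^*=(P_n\oplus P_n^*)$ for operators on $\mathbf X\oplus\mathbf X^*$. Cosets $A+\mathcal K(\mathbf X,\mathcal P)$ and $A+\mathcal K(\mathbf X)$ are taken in the quotient algebras $\mathcal L(\mathbf X,\mathcal P)/\mathcal K(\mathbf X,\mathcal P)$ and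 $\mathcal L(\mathbf X)/\mathcal K(\mathbf X)$ with the quotient norms, and $\|b^{-1}\|^{-1}:=0$ if $b$ is not invertible. Theorem. Let $A\in\mathcal L(\mathbf X,\mathcal P)$. Then $$\nu_{\mathrm{ess}}^{c}(A\oplus A^*)=\nu_{\mathrm{ess}}(A\oplus A^*)=\mu(A)=\|(A+\mathcal K(\mathbf X,\mathcal P))^{-1}\|^{-1}=\|(A+\mathcal K(\mathbf X))^{-1}\|^{-1}.$$ Moreover, if $A$ is Fredholm of index zero, then $$\nu_{\mathrm{ess}}^{c}(A)=\nu_{\mathrm{ess}}^{c}(A^*)=\nu_{\mathrm{ess}}(A)=\nu_{\mathrm{ess}}(A^*)=\mu(A)=\tilde\mu(A)=\tilde\mu(A^*)>0.$$ Conversely, if $\nu_{\mathrm{ess}}^{c}(A)>0$ and $\nu_{\mathrm{ess}}^{c}(A^*)>0$, then $A$ is Fredholm of index zero. -/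

import Mathlib

open Filter Topology
open scoped ENNReal

noncomputable section

namespace EssLowerNorm

/-! ### Lower norm, dual operator, direct sum -/

section Banach

variable {Y Z : Type*} [NormedAddCommGroup Y] [NormedSpace ℂ Y]
  [NormedAddCommGroup Z] [NormedSpace ℂ Z]

/-- The lower norm `ν(A) = inf {‖A x‖ : ‖x‖ = 1}`. -/
def lowerNorm (A : Y →L[ℂ] Z) : ℝ :=
  sInf {r : ℝ | ∃ x : Y, ‖x‖ = 1 ∧ ‖A x‖ = r}

/-- The Banach space adjoint `A* : Y* → Y*`, `f ↦ f ∘ A`. -/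
def dualOp (A : Y →L[ℂ] Y) : StrongDual ℂ Y →L[ℂ] StrongDual ℂ Y :=
  ContinuousLinearMap.precomp ℂ A

@[simp] theorem dualOp_apply (A : Y →L[ℂ] Y) (f : StrongDual ℂ Y) (x : Y) :
    dualOp A f x = f (A x) := rfl

variable (Y) in
/-- The space `Y ⊕ Y*` with the norm `‖(x, f)‖ = max {‖x‖, ‖f‖}`. -/
abbrev SymmSpace : Type _ := Y × StrongDual ℂ Y

/-- `A ⊕ A*` on `Y ⊕ Y*`. -/
def symmOp (A : Y →L[ℂ] Y) : SymmSpace Y →L[ℂ] SymmSpace Y :=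
  A.prodMap (dualOp A)

/-- The sequence `P* = (Pₙ*)` on `Y*`. -/
def dualProj (P : ℕ → Y →L[ℂ] Y) : ℕ → StrongDual ℂ Y →L[ℂ] StrongDual ℂ Y :=
  fun n => dualOp (P n)

/-- The sequence `P ⊕ P* = (Pₙ ⊕ Pₙ*)` on `Y ⊕ Y*`. -/
def symmProj (P : ℕ → Y →L[ℂ] Y) :
    ℕ → SymmSpace Y →L[ℂ] SymmSpace Y :=
  fun n => symmOp (P n)

/-- The index `dim ker A - dim coker A` (meaningful when `A` is Fredholm). -/
def fredholmIndex (A : Y →L[ℂ] Y) : ℤ :=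
  (Module.finrank ℂ A.ker : ℤ) - (Module.finrank ℂ (Y ⧸ A.range) : ℤ)

/-! ### Operators that are compact with respect to a sequence of projections -/

/-- `K` is `P`-compact: `‖(I - Pₙ) K‖ + ‖K (I - Pₙ)‖ → 0`. -/
def IsPCompact (P : ℕ → Y →L[ℂ] Y) (K : Y →L[ℂ] Y) : Prop :=
  Tendsto (fun n => ‖(1 - P n) * K‖ + ‖K * (1 - P n)‖) atTop (𝓝 0)

theorem isPCompact_iff {P : ℕ → Y →L[ℂ] Y} {K : Y →L[ℂ] Y} :
    IsPCompact P K ↔ Tendsto (fun n => (1 - P n) * K) atTop (𝓝 0) ∧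
      Tendsto (fun n => K * (1 - P n)) atTop (𝓝 0) := by
  constructor
  · intro h
    exact ⟨squeeze_zero_norm (fun n => le_add_of_nonneg_right (norm_nonneg _)) h,
      squeeze_zero_norm (fun n => le_add_of_nonneg_left (norm_nonneg _)) h⟩
  · rintro ⟨h₁, h₂⟩
    simpa [IsPCompact] using h₁.norm.add h₂.norm

theorem IsPCompact.zero (P : ℕ → Y →L[ℂ] Y) : IsPCompact P 0 := by
  simp [IsPCompact]

theorem IsPCompact.add {P : ℕ → Y →L[ℂ] Y} {K L : Y →L[ℂ] Y}
    (hK : IsPCompact P K) (hL : IsPCompact P L) : IsPCompact P (K + L) := by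
  rw [isPCompact_iff] at *
  exact ⟨by simpa [mul_add] using hK.1.add hL.1, by simpa [add_mul] using hK.2.add hL.2⟩

theorem IsPCompact.smul {P : ℕ → Y →L[ℂ] Y} {K : Y →L[ℂ] Y} (c : ℂ)
    (hK : IsPCompact P K) : IsPCompact P (c • K) := by
  rw [isPCompact_iff] at *
  exact ⟨by simpa using hK.1.const_smul c, by simpa using hK.2.const_smul c⟩

theorem IsPCompact.mul {P : ℕ → Y →L[ℂ] Y} {K L : Y →L[ℂ] Y}
    (hK : IsPCompact P K) (hL : IsPCompact P L) : IsPCompact P (K * L) := by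
  rw [isPCompact_iff] at *
  exact ⟨by simpa [mul_assoc] using hK.1.mul_const L,
    by simpa [mul_assoc] using hL.2.const_mul K⟩

/-- The algebra `L(Y, P)` of all `A ∈ L(Y)` such that `A K` and `K A` are `P`-compact for every
`P`-compact `K`. -/
def pAlgebra (P : ℕ → Y →L[ℂ] Y) : Subalgebra ℂ (Y →L[ℂ] Y) where
  carrier := {A | ∀ K, IsPCompact P K → IsPCompact P (A * K) ∧ IsPCompact P (K * A)}
  mul_mem' {A B} hA hB K hK :=
    ⟨by simpa [mul_assoc] using (hA _ (hB K hK).1).1,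
      by simpa [mul_assoc] using (hB _ (hA K hK).2).2⟩
  add_mem' {A B} hA hB K hK :=
    ⟨by simpa [add_mul] using (hA K hK).1.add (hB K hK).1,
      by simpa [mul_add] using (hA K hK).2.add (hB K hK).2⟩
  algebraMap_mem' c K hK := by
    simpa [Algebra.algebraMap_eq_smul_one] using hK.smul c

/-- The ideal `K(Y, P)` of all `P`-compact operators in `L(Y, P)`. -/
def pCompactIdeal (P : ℕ → Y →L[ℂ] Y) : Ideal (pAlgebra P) where
  carrier := {K | IsPCompact P (K : Y →L[ℂ] Y)}
  add_mem' hK hL := hK.add hL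
  zero_mem' := IsPCompact.zero P
  smul_mem' A _ hK := (A.2 _ hK).1

instance (P : ℕ → Y →L[ℂ] Y) : (pCompactIdeal P).IsTwoSided :=
  ⟨fun {K} A (hK : IsPCompact P (K : Y →L[ℂ] Y)) => (A.2 _ hK).2⟩

/-- Every `P`-compact operator belongs to `L(Y, P)`. -/
theorem IsPCompact.mem_pAlgebra {P : ℕ → Y →L[ℂ] Y} {K : Y →L[ℂ] Y}
    (hK : IsPCompact P K) : K ∈ pAlgebra P :=
  fun _ hL => ⟨hK.mul hL, hL.mul hK⟩

variable (Y) in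
/-- The ideal `K(Y)` of all compact operators in `L(Y)`. -/
def compactIdeal : Ideal (Y →L[ℂ] Y) where
  carrier := {K | IsCompactOperator K}
  add_mem' hK hL := hK.add hL
  zero_mem' := isCompactOperator_zero
  smul_mem' A _ hK := hK.clm_comp A

instance : (compactIdeal Y).IsTwoSided :=
  ⟨fun {K} A (hK : IsCompactOperator K) => hK.comp_clm A⟩

/-- `‖(a + I)⁻¹‖⁻¹` in the quotient algebra `R / I` with the quotient norm; it is `0` if `a + I`
is not invertible, since then `Ring.inverse` is `0`. -/
def cosetInvNormInv {R : Type*} [NormedRing R] (I : Ideal R) [I.IsTwoSided] (a : R) : ℝ :=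
  ‖(Ring.inverse (Ideal.Quotient.mk I a) : R ⧸ I)‖⁻¹

/-- `‖(A + K(Y, P))⁻¹‖⁻¹`, the coset being taken in `L(Y, P) / K(Y, P)`. -/
def pEssInvNormInv (P : ℕ → Y →L[ℂ] Y) (A : pAlgebra P) : ℝ :=
  cosetInvNormInv (R := pAlgebra P) (pCompactIdeal P) A

/-- `‖(A + K(Y))⁻¹‖⁻¹`, the coset being taken in `L(Y) / K(Y)`. -/
def essInvNormInv (A : Y →L[ℂ] Y) : ℝ :=
  cosetInvNormInv (compactIdeal Y) A

/-! ### Asymptotic and essential lower norms -/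

/-- The restriction `A|_{im Qₘ} : im Qₘ → Y`, where `Qₘ = I - Pₘ`. -/
def restrictTail (P : ℕ → Y →L[ℂ] Y) (A : Y →L[ℂ] Y) (m : ℕ) :
    (1 - P m : Y →L[ℂ] Y).range →L[ℂ] Y :=
  A ∘L (1 - P m : Y →L[ℂ] Y).range.subtypeL

/-- `μ̃(A) = lim ν(A|_{im Qₘ})` as `m → ∞`. -/
def muTilde (P : ℕ → Y →L[ℂ] Y) (A : Y →L[ℂ] Y) : ℝ :=
  limUnder atTop fun m => lowerNorm (restrictTail P A m)

/-- `μ(A) = min {μ̃(A), μ̃(A*)}`, where `μ̃(A*)` is taken with respect to `P*`. -/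
def mu (P : ℕ → Y →L[ℂ] Y) (A : Y →L[ℂ] Y) : ℝ :=
  min (muTilde P A) (muTilde (dualProj P) (dualOp A))

/-- The limit that defines `μ̃(A)` exists if the ranges of `Qₘ` are nonzero and decreasing. -/
theorem tendsto_muTilde (P : ℕ → Y →L[ℂ] Y) (A : Y →L[ℂ] Y)
    (hne : ∀ m, (1 - P m : Y →L[ℂ] Y) ≠ 0)
    (hP : ∀ m, (1 - P m) * (1 - P (m + 1)) = 1 - P (m + 1)) :
    Tendsto (fun m => lowerNorm (restrictTail P A m)) atTop (𝓝 (muTilde P A)) := by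
  set S : ℕ → Set ℝ :=
    fun m => {r : ℝ | ∃ x : (1 - P m : Y →L[ℂ] Y).range, ‖x‖ = 1 ∧ ‖restrictTail P A m x‖ = r}
    with hS
  have hunit : ∀ m, ∃ x : (1 - P m : Y →L[ℂ] Y).range, ‖x‖ = 1 := by
    intro m
    obtain ⟨y, hy⟩ : ∃ y, (1 - P m : Y →L[ℂ] Y) y ≠ 0 := by
      by_contra! h
      exact hne m (ContinuousLinearMap.ext h)
    have : Nontrivial (1 - P m : Y →L[ℂ] Y).range :=
      ⟨⟨⟨_, y, rfl⟩, 0, fun h => hy (congrArg Subtype.val h)⟩⟩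
    exact exists_norm_eq _ zero_le_one
  have hbdd : ∀ m, BddBelow (S m) := by
    rintro m
    exact ⟨0, by rintro r ⟨x, -, rfl⟩; exact norm_nonneg _⟩
  have hmono : Monotone fun m => lowerNorm (restrictTail P A m) := by
    refine monotone_nat_of_le_succ fun m => ?_
    obtain ⟨x₀, hx₀⟩ := hunit (m + 1)
    refine csInf_le_csInf (hbdd m) ⟨_, x₀, hx₀, rfl⟩ ?_
    rintro r ⟨⟨x, y, hy⟩, hx, rfl⟩
    refine ⟨⟨x, x, ?_⟩, hx, rfl⟩
    subst hy
    exact congrArg (fun T : Y →L[ℂ] Y => T y) (hP m)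
  have hbd : BddAbove (Set.range fun m => lowerNorm (restrictTail P A m)) := by
    refine ⟨‖A‖, ?_⟩
    rintro _ ⟨m, rfl⟩
    obtain ⟨x, hx⟩ := hunit m
    refine (csInf_le (hbdd m) ⟨x, hx, rfl⟩).trans ?_
    have := A.le_opNorm (x : Y)
    rw [Submodule.coe_norm] at hx
    rwa [hx, mul_one] at this
  exact tendsto_nhds_limUnder ⟨_, tendsto_atTop_ciSup hmono hbd⟩

/-- The `P`-essential lower norm `sup {ν(A + K) : K ∈ K(Y, P)}`. -/
def pEssLowerNorm (P : ℕ → Y →L[ℂ] Y) (A : Y →L[ℂ] Y) : ℝ :=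
  sSup {r : ℝ | ∃ K : Y →L[ℂ] Y, IsPCompact P K ∧ lowerNorm (A + K) = r}

/-- The classical essential lower norm `sup {ν(A + K) : K ∈ K(Y)}`. -/
def essLowerNorm (A : Y →L[ℂ] Y) : ℝ :=
  sSup {r : ℝ | ∃ K : Y →L[ℂ] Y, IsCompactOperator K ∧ lowerNorm (A + K) = r}

end Banach

/-! ### The sequence spaces `l^p(ℤ^N, X)` with `p ∈ {0} ∪ [1, ∞]` -/

/-- The exponents `p ∈ {0} ∪ [1, ∞]`. -/
inductive SeqExponent : Type
  | zero : SeqExponent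
  | ofENNReal (p : ℝ≥0∞) (hp : 1 ≤ p) : SeqExponent

/-- The exponent whose norm is used: `∞` for `p = 0`, and `p` otherwise. -/
def SeqExponent.ambient : SeqExponent → ℝ≥0∞
  | .zero => ∞
  | .ofENNReal p _ => p

instance (p : SeqExponent) : Fact (1 ≤ p.ambient) :=
  ⟨match p with
    | .zero => le_top
    | .ofENNReal _ hp => hp⟩

section SequenceSpaces

variable (N : ℕ) (p : SeqExponent) (X : Type*) [NormedAddCommGroup X] [NormedSpace ℂ X]

/-- The space `l^q(ℤ^N, X)` with `q = p` for `p ∈ [1, ∞]` and `q = ∞` for `p = 0`. -/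
abbrev AmbientSpace : Type _ := lp (fun _ : Fin N → ℤ => X) p.ambient

/-- The sequences with finite support. -/
def finSupported : Submodule ℂ (AmbientSpace N p X) where
  carrier := {x | {i | x i ≠ 0}.Finite}
  add_mem' {x y} hx hy := (hx.union hy).subset fun i hi => by
    by_contra h
    simp only [Set.mem_union, Set.mem_ofPred_eq, not_or, not_not] at h
    exact hi (by simp [h.1, h.2])
  zero_mem' := by simp
  smul_mem' c x hx := hx.subset fun i hi h => hi (by simp [h])

/-- `l^p(ℤ^N, X)` inside the ambient space: everything if `p ∈ [1, ∞]`, and the closure of the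
finitely supported sequences in `l^∞(ℤ^N, X)` if `p = 0`. -/
def seqSubspace : (p : SeqExponent) → Submodule ℂ (AmbientSpace N p X)
  | .zero => (finSupported N .zero X).topologicalClosure
  | .ofENNReal _ _ => ⊤

/-- The Banach space `l^p(ℤ^N, X)`, `p ∈ {0} ∪ [1, ∞]`. -/
abbrev SeqSpace : Type _ := seqSubspace N X p

/-- The cube `{-n, …, n}^N`. -/
def box (n : ℕ) : Set (Fin N → ℤ) := Set.Icc (fun _ => -(n : ℤ)) (fun _ => (n : ℤ))

variable {N p X} in
/-- Multiplication of a sequence by the characteristic function of `S`. -/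
def cutoff (S : Set (Fin N → ℤ)) (x : AmbientSpace N p X) : AmbientSpace N p X :=
  ⟨S.indicator x, (lp.memℓp x).mono' fun i => norm_indicator_le_norm_self x i⟩

theorem finSupported_le : finSupported N p X ≤ seqSubspace N X p := by
  cases p with
  | zero => exact Submodule.le_topologicalClosure _
  | ofENNReal p hp => exact le_top

theorem cutoff_box_mem (n : ℕ) (x : AmbientSpace N p X) :
    cutoff (box N n) x ∈ seqSubspace N X p :=
  finSupported_le N p X <| (Set.finite_Icc _ _ : (box N n).Finite).subset fun _ hi =>
    Set.mem_of_indicator_ne_zero hi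

/-- The canonical projection `Pₙ`: multiplication by the characteristic function of
`{-n, …, n}^N`. -/
def boxProj (n : ℕ) : SeqSpace N p X →L[ℂ] SeqSpace N p X :=
  LinearMap.mkContinuous
    { toFun := fun x => ⟨cutoff (box N n) (x : AmbientSpace N p X), cutoff_box_mem N p X n x⟩
      map_add' := fun x y => Subtype.ext <| lp.ext <|
        Set.indicator_add (box N n) (x : AmbientSpace N p X) (y : AmbientSpace N p X)
      map_smul' := fun c x => Subtype.ext <| lp.ext <|
        Set.indicator_const_smul (box N n) c (x : AmbientSpace N p X) }
    1 fun x => by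
      rw [one_mul]
      exact lp.norm_mono (zero_lt_one.trans_le (Fact.out : 1 ≤ p.ambient)).ne'
        fun i => norm_indicator_le_norm_self (x : AmbientSpace N p X) i

end SequenceSpaces

end EssLowerNorm

end

open EssLowerNorm

noncomputable section

namespace EssLowerNorm

section LowerNorm

variable {Y Z : Type*} [NormedAddCommGroup Y] [NormedSpace ℂ Y]
  [NormedAddCommGroup Z] [NormedSpace ℂ Z]

theorem lowerNorm_nonneg (A : Y →L[ℂ] Z) : 0 ≤ lowerNorm A :=
  Real.sInf_nonneg (by rintro _ ⟨x, -, rfl⟩; exact norm_nonneg _)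

theorem lowerNorm_mul_norm_le (A : Y →L[ℂ] Z) (x : Y) : lowerNorm A * ‖x‖ ≤ ‖A x‖ := by
  rcases eq_or_ne x 0 with rfl | hx
  · simp
  have hx' : 0 < ‖x‖ := norm_pos_iff.2 hx
  have h : lowerNorm A ≤ ‖A ((‖x‖⁻¹ : ℂ) • x)‖ :=
    csInf_le ⟨0, by rintro _ ⟨x, -, rfl⟩; exact norm_nonneg _⟩
      ⟨_, by simp [norm_smul, hx'.ne'], rfl⟩
  rw [map_smul, norm_smul, norm_inv, Complex.norm_real, norm_norm] at h
  rwa [← le_div_iff₀ hx', div_eq_inv_mul]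

theorem le_lowerNorm [Nontrivial Y] {A : Y →L[ℂ] Z} {c : ℝ} (h : ∀ x, c * ‖x‖ ≤ ‖A x‖) :
    c ≤ lowerNorm A := by
  obtain ⟨x, hx⟩ := NormedSpace.exists_lt_norm ℂ Y 0
  have : ∃ x : Y, ‖x‖ = 1 := exists_norm_eq Y zero_le_one
  obtain ⟨x, hx⟩ := this
  refine le_csInf ⟨_, x, hx, rfl⟩ ?_
  rintro _ ⟨y, hy, rfl⟩
  simpa [hy] using h y

theorem inv_norm_le_lowerNorm [Nontrivial Y] {C T : Y →L[ℂ] Y} (h : T * C = 1) :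
    ‖T‖⁻¹ ≤ lowerNorm C := by
  have hT : 0 < ‖T‖ := by
    rw [norm_pos_iff]
    rintro rfl
    simp at h
  refine le_lowerNorm fun x => ?_
  rw [inv_mul_le_iff₀ hT]
  have : x = T (C x) := (congrArg (fun S : Y →L[ℂ] Y => S x) h).symm
  conv_lhs => rw [this]
  exact T.le_opNorm _

theorem norm_mul_lowerNorm_le_one {C T : Y →L[ℂ] Y} (h : C * T = 1) (hC : 0 < lowerNorm C) :
    ‖T‖ ≤ (lowerNorm C)⁻¹ := by
  refine T.opNorm_le_bound (inv_nonneg.2 hC.le) fun x => ?_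
  rw [← div_eq_inv_mul, le_div_iff₀ hC, mul_comm]
  have : C (T x) = x := congrArg (fun S : Y →L[ℂ] Y => S x) h
  simpa [this] using lowerNorm_mul_norm_le C (T x)

theorem injective_of_lowerNorm_pos {C : Y →L[ℂ] Z} (hC : 0 < lowerNorm C) :
    Function.Injective C := by
  refine (injective_iff_map_eq_zero C).2 fun x hx => ?_
  have := lowerNorm_mul_norm_le C x
  rw [hx, norm_zero] at this
  exact norm_le_zero_iff.1 (nonpos_of_mul_nonpos_right this hC)

end LowerNorm

section Dual

variable {Y : Type*} [NormedAddCommGroup Y] [NormedSpace ℂ Y]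

@[simp] theorem dualOp_one : dualOp (1 : Y →L[ℂ] Y) = 1 := rfl

theorem dualOp_mul (A B : Y →L[ℂ] Y) : dualOp (A * B) = dualOp B * dualOp A := rfl

theorem dualOp_sub (A B : Y →L[ℂ] Y) : dualOp (A - B) = dualOp A - dualOp B := by
  ext f x; simp

theorem norm_dualOp (A : Y →L[ℂ] Y) : ‖dualOp A‖ = ‖A‖ := by
  apply le_antisymm
  · refine (dualOp A).opNorm_le_bound (norm_nonneg _) fun f => ?_
    rw [mul_comm]
    exact f.opNorm_comp_le A
  · refine A.opNorm_le_bound (norm_nonneg (dualOp A)) fun x => ?_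
    obtain ⟨g, hg, hgx⟩ := exists_dual_vector'' ℂ (A x)
    calc ‖A x‖ = ‖dualOp A g x‖ := by rw [dualOp_apply, hgx]; simp
      _ ≤ ‖dualOp A g‖ * ‖x‖ := (dualOp A g).le_opNorm x
      _ ≤ ‖dualOp A‖ * ‖x‖ := by
        gcongr
        exact ((dualOp A).le_opNorm g).trans (mul_le_of_le_one_right (norm_nonneg _) hg)

theorem one_sub_dualProj (P : ℕ → Y →L[ℂ] Y) (n : ℕ) :
    1 - dualProj P n = dualOp (1 - P n) := by
  rw [dualOp_sub, dualOp_one, dualProj]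

theorem one_sub_symmProj (P : ℕ → Y →L[ℂ] Y) (n : ℕ) :
    1 - symmProj P n = symmOp (1 - P n) := by
  ext z <;> simp [symmOp, symmProj]

theorem norm_prodMap_le (A : Y →L[ℂ] Y) (D : StrongDual ℂ Y →L[ℂ] StrongDual ℂ Y) {c : ℝ}
    (hA : ‖A‖ ≤ c) (hD : ‖D‖ ≤ c) : ‖A.prodMap D‖ ≤ c := by
  refine ContinuousLinearMap.opNorm_le_bound _ ((norm_nonneg _).trans hA) fun z => ?_
  rw [Prod.norm_def]
  refine max_le ?_ ?_
  · exact (A.le_opNorm z.1).trans (mul_le_mul hA (norm_fst_le z) (norm_nonneg _)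
      ((norm_nonneg _).trans hA))
  · exact (D.le_opNorm z.2).trans (mul_le_mul hD (norm_snd_le z) (norm_nonneg _)
      ((norm_nonneg _).trans hA))

theorem norm_symmOp_le (A : Y →L[ℂ] Y) : ‖symmOp A‖ ≤ ‖A‖ :=
  norm_prodMap_le _ _ le_rfl (norm_dualOp A).le

end Dual

section Fredholm

variable {Y Z : Type*} [NormedAddCommGroup Y] [NormedSpace ℂ Y]
  [NormedAddCommGroup Z] [NormedSpace ℂ Z]

theorem isUnit_of_injective_add_compact [CompleteSpace Y] {C K : Y →L[ℂ] Y} (hC : IsUnit C)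
    (hK : IsCompactOperator K) (hinj : Function.Injective (C + K)) : IsUnit (C + K) := by
  obtain ⟨u, rfl⟩ := hC
  set L : Y →L[ℂ] Y := (↑u⁻¹ : Y →L[ℂ] Y) * K with hL
  have hLc : IsCompactOperator L := hK.clm_comp _
  have hfac : (u : Y →L[ℂ] Y) + K = u * (1 + L) := by simp [hL, mul_add]
  have hev : ¬ Module.End.HasEigenvalue (L : Module.End ℂ Y) (-1) := by
    intro h
    obtain ⟨v, hv⟩ := h.exists_hasEigenvector
    have h1 : L v = -v := by simpa using hv.apply_eq_smul
    refine hv.2 (hinj ?_)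
    rw [hfac]
    simp [h1]
  have hres := (hLc.hasEigenvalue_or_mem_resolventSet (μ := -1) (by simp)).resolve_left hev
  rw [spectrum.mem_resolventSet_iff, ← IsUnit.neg_iff] at hres
  rw [hfac]
  refine u.isUnit.mul ?_
  convert hres using 1
  simp [add_comm]

variable [CompleteSpace Y]

theorem finiteDimensional_ker_of_compact {W : Type*} [NormedAddCommGroup W] [NormedSpace ℂ W]
    {A : Y →L[ℂ] Z} {K : Y →L[ℂ] W}
    (hK : IsCompactOperator K) {c : ℝ} (hc : 0 < c) (h : ∀ x, c * ‖x‖ ≤ ‖A x‖ + ‖K x‖) :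
    FiniteDimensional ℂ A.ker := by
  set ι := A.ker.subtypeL
  have hcomplete : CompleteSpace A.ker := A.isClosed_ker.completeSpace_coe
  have hanti : ∃ C > 0, ∀ x : A.ker, C * ‖x‖ ≤ ‖(K ∘L ι) x‖ := by
    refine ⟨c, hc, fun x => ?_⟩
    have h0 : A (x : Y) = 0 := x.2
    simpa [h0] using! h x
  obtain ⟨C, hC⟩ := antilipschitzWith_iff_exists_mul_le_norm.2 hanti
  have hemb := hC.isClosedEmbedding (K ∘L ι).uniformContinuous
  obtain ⟨S, hS, hS0⟩ := hK.comp_clm ι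
  exact FiniteDimensional.of_isCompactOperator_id (𝕜 := ℂ)
    ⟨_, hemb.isCompact_preimage hS, hS0⟩

theorem isClosed_range_of_compact {W : Type*} [NormedAddCommGroup W] [NormedSpace ℂ W]
    {A : Y →L[ℂ] Z} {K : Y →L[ℂ] W}
    (hK : IsCompactOperator K) {c : ℝ} (hc : 0 < c) (h : ∀ x, c * ‖x‖ ≤ ‖A x‖ + ‖K x‖) :
    IsClosed (A.range : Set Z) := by
  have hfin := finiteDimensional_ker_of_compact hK hc h
  obtain ⟨M, hM⟩ := (Submodule.ClosedComplemented.of_finiteDimensional A.ker).exists_isTopCompl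
  have hMc : IsClosed (M : Set Y) := hM.isClosed'
  have hcomplete : CompleteSpace M := hMc.completeSpace_coe
  have hrange : (A ∘L M.subtypeL).range = A.range := by
    apply le_antisymm
    · rintro _ ⟨x, rfl⟩
      exact ⟨x, rfl⟩
    · rintro _ ⟨x, rfl⟩
      obtain ⟨y, hy, z, hz, rfl⟩ := Submodule.mem_sup.1
        (hM.isCompl.sup_eq_top ▸ Submodule.mem_top : x ∈ A.ker ⊔ M)
      refine ⟨⟨z, hz⟩, ?_⟩
      have : A y = 0 := hy
      simp [this]
  have key : ∃ C > 0, ∀ x : M, C * ‖x‖ ≤ ‖(A ∘L M.subtypeL) x‖ := by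
    by_contra! hcon
    have : ∀ n : ℕ, ∃ x : M, ‖x‖ = 1 ∧ ‖A x‖ ≤ 1 / ((n : ℝ) + 1) := by
      intro n
      obtain ⟨x, hx⟩ := hcon (1 / ((n : ℝ) + 1)) (by positivity)
      have hx0 : 0 < ‖x‖ := by
        rw [norm_pos_iff]
        rintro rfl
        simp at hx
      refine ⟨(‖x‖⁻¹ : ℂ) • x, ?_, ?_⟩
      · rw [norm_smul, norm_inv, Complex.norm_real, norm_norm, inv_mul_cancel₀ hx0.ne']
      rw [Submodule.coe_smul, map_smul, norm_smul, norm_inv, Complex.norm_real, norm_norm,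
        inv_mul_le_iff₀ hx0, mul_comm]
      exact hx.le
    choose x hx1 hxA using this
    obtain ⟨S, hS, hSK⟩ := hK.image_closedBall_subset_compact (𝕜₁ := ℂ) (f := (K : Y →ₗ[ℂ] W)) 1
    obtain ⟨w, -, ψ, hψ, hψw⟩ := hS.tendsto_subseq (x := fun n => K (x n))
      fun n => hSK ⟨x n, by simpa using! (hx1 n).le, rfl⟩
    have hA0 : Tendsto (fun n => A (x n)) atTop (𝓝 0) :=
      squeeze_zero_norm hxA tendsto_one_div_add_atTop_nhds_zero_nat
    have hcau : CauchySeq fun n => x (ψ n) := by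
      have h1 := (hA0.comp hψ.tendsto_atTop).cauchySeq
      have h2 := hψw.cauchySeq
      rw [Metric.cauchySeq_iff] at h1 h2 ⊢
      intro ε hε
      obtain ⟨N₁, hN₁⟩ := h1 (c * ε / 2) (by positivity)
      obtain ⟨N₂, hN₂⟩ := h2 (c * ε / 2) (by positivity)
      refine ⟨max N₁ N₂, fun m hm n hn => ?_⟩
      have e1 := hN₁ m (le_of_max_le_left hm) n (le_of_max_le_left hn)
      have e2 := hN₂ m (le_of_max_le_right hm) n (le_of_max_le_right hn)
      simp only [Function.comp_apply, dist_eq_norm, ← map_sub] at e1 e2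
      rw [dist_eq_norm]
      have e3 := h ((x (ψ m) : Y) - x (ψ n))
      have e4 : ‖x (ψ m) - x (ψ n)‖ = ‖(x (ψ m) : Y) - x (ψ n)‖ := rfl
      rw [e4]
      nlinarith
    obtain ⟨z, hz⟩ := cauchySeq_tendsto_of_complete hcau
    have hz1 : ‖z‖ = 1 := tendsto_nhds_unique hz.norm (by simp [hx1])
    have hzA : (A ∘L M.subtypeL) z = 0 :=
      tendsto_nhds_unique (((A ∘L M.subtypeL).continuous.tendsto z).comp hz)
        (hA0.comp hψ.tendsto_atTop)
    have : (z : Y) ∈ A.ker ⊓ M := ⟨hzA, z.2⟩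
    rw [hM.isCompl.inf_eq_bot, Submodule.mem_bot] at this
    rw [Submodule.coe_norm, this, norm_zero] at hz1
    exact zero_ne_one hz1
  obtain ⟨C, hC⟩ := antilipschitzWith_iff_exists_mul_le_norm.2 key
  rw [← hrange]
  simpa [LinearMap.coe_range] using! hC.isClosed_range (A ∘L M.subtypeL).uniformContinuous

end Fredholm

section FiniteRank

variable {Y : Type*} [NormedAddCommGroup Y] [NormedSpace ℂ Y]

/-- The finite rank operator `∑ᵢ φᵢ(·) yᵢ`. -/
def finRankOp {ι : Type*} [Fintype ι] (φ : ι → StrongDual ℂ Y) (y : ι → Y) : Y →L[ℂ] Y :=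
  ∑ i, (φ i).smulRight (y i)

@[simp] theorem finRankOp_apply {ι : Type*} [Fintype ι] (φ : ι → StrongDual ℂ Y) (y : ι → Y)
    (x : Y) : finRankOp φ y x = ∑ i, φ i x • y i := by
  simp [finRankOp]

theorem isCompactOperator_sum {Z : Type*} [NormedAddCommGroup Z] [NormedSpace ℂ Z]
    {ι : Type*} (s : Finset ι) {T : ι → Y →L[ℂ] Z}
    (h : ∀ i ∈ s, IsCompactOperator (T i)) : IsCompactOperator (⇑(∑ i ∈ s, T i)) :=
  (compactOperator (RingHom.id ℂ) Y Z).sum_mem h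

theorem isCompactOperator_smulRight {Z : Type*} [NormedAddCommGroup Z] [NormedSpace ℂ Z]
    (φ : StrongDual ℂ Y) (z : Z) : IsCompactOperator (φ.smulRight z) :=
  (isCompactOperator_of_locallyCompactSpace_dom φ).clm_comp
    (ContinuousLinearMap.toSpanSingleton ℂ z)

theorem isCompactOperator_finRankOp {ι : Type*} [Fintype ι] (φ : ι → StrongDual ℂ Y)
    (y : ι → Y) : IsCompactOperator (finRankOp φ y) :=
  isCompactOperator_sum _ fun _ _ => isCompactOperator_smulRight _ _

theorem dualOp_finRankOp {ι : Type*} [Fintype ι] (φ : ι → StrongDual ℂ Y) (y : ι → Y) :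
    dualOp (finRankOp φ y) =
      finRankOp (fun i => NormedSpace.inclusionInDoubleDual ℂ Y (y i)) φ := by
  ext f x
  simp [mul_comm]

end FiniteRank

section Cokernel

variable {Y : Type*} [NormedAddCommGroup Y] [NormedSpace ℂ Y]

theorem finiteDimensional_of_strongDual {Z : Type*} [NormedAddCommGroup Z] [NormedSpace ℂ Z]
    [FiniteDimensional ℂ (StrongDual ℂ Z)] : FiniteDimensional ℂ Z := by
  refine FiniteDimensional.of_injective (V₂ := StrongDual ℂ (StrongDual ℂ Z))
    (NormedSpace.inclusionInDoubleDual ℂ Z).toLinearMap ?_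
  exact (NormedSpace.inclusionInDoubleDualLi (E := Z) ℂ).injective

theorem finiteDimensional_coker_of_ker_dualOp {A : Y →L[ℂ] Y} (hr : IsClosed (A.range : Set Y))
    [FiniteDimensional ℂ (dualOp A).ker] : FiniteDimensional ℂ (Y ⧸ A.range) := by
  let mk : Y →L[ℂ] Y ⧸ A.range := A.range.mkQL
  let g : StrongDual ℂ (Y ⧸ A.range) →ₗ[ℂ] (dualOp A).ker :=
    { toFun := fun φ => ⟨φ ∘L mk, by
        rw [LinearMap.mem_ker]
        ext x
        have : mk (A x) = 0 := (Submodule.Quotient.mk_eq_zero _).2 ⟨x, rfl⟩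
        simp [this]⟩
      map_add' := fun _ _ => rfl
      map_smul' := fun _ _ => rfl }
  have hg : Function.Injective g := by
    intro φ ψ h
    ext q
    obtain ⟨x, rfl⟩ := A.range.mkQ_surjective q
    exact congrArg (fun T : (dualOp A).ker => (T : StrongDual ℂ Y) x) h
  have := FiniteDimensional.of_injective (V₂ := (dualOp A).ker) g hg
  exact finiteDimensional_of_strongDual

theorem isFredholm_of_finiteDimensional [CompleteSpace Y] {A : Y →L[ℂ] Y}
    (hk : FiniteDimensional ℂ A.ker) (hr : IsClosed (A.range : Set Y))
    (hc : FiniteDimensional ℂ (Y ⧸ A.range)) : A.IsFredholm where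
  isStrictMap := by
    have hcomp : CompleteSpace A.range := hr.completeSpace_coe
    let A' : Y →L[ℂ] A.range := A.codRestrict A.range fun x => ⟨x, rfl⟩
    have hs : Function.Surjective A' := by
      rintro ⟨_, x, rfl⟩
      exact ⟨x, rfl⟩
    have := (LinearMap.isStrictMap_iff_isOpenQuotientMap_rangeRestrict (f := (A : Y →ₗ[ℂ] Y))).2
      ⟨hs, A'.continuous, A'.isOpenMap hs⟩
    exact this
  isClosed_range := hr
  finite_ker := hk
  finite_coker := hc
  closedComplemented_ker := Submodule.ClosedComplemented.of_finiteDimensional _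

theorem finiteDimensional_coker_one_add_compact [CompleteSpace Y] {K : Y →L[ℂ] Y}
    (hK : IsCompactOperator K) : FiniteDimensional ℂ (Y ⧸ (1 + K : Y →L[ℂ] Y).range) := by
  set S : Y →L[ℂ] Y := 1 + K with hS
  have hbd : ∀ x, 1 * ‖x‖ ≤ ‖S x‖ + ‖K x‖ := fun x => by
    have : x = S x - K x := by simp [hS]
    conv_lhs => rw [this, one_mul]
    exact norm_sub_le _ _
  have hker := finiteDimensional_ker_of_compact hK one_pos hbd
  by_contra hinf
  have hrank : (Module.finrank ℂ S.ker : Cardinal) ≤ Module.rank ℂ (Y ⧸ S.range) := by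
    refine (Cardinal.natCast_le_aleph0).trans ?_
    rw [← not_lt, Module.rank_lt_aleph0_iff]
    exact hinf
  obtain ⟨v, hv⟩ := Module.le_rank_iff.1 hrank
  choose w hw using fun i => S.range.mkQ_surjective (v i)
  obtain ⟨π, hπ⟩ := Submodule.ClosedComplemented.of_finiteDimensional S.ker
  let e := Module.finBasis ℂ S.ker
  let φ : Fin (Module.finrank ℂ S.ker) → StrongDual ℂ Y := fun i =>
    (LinearMap.toContinuousLinearMap (e.coord i)) ∘L π
  have hinj : Function.Injective (1 + (K + finRankOp φ w) : Y →L[ℂ] Y) := by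
    rw [← add_assoc, ← hS]
    refine (injective_iff_map_eq_zero _).2 fun x hx => ?_
    have h1 : ∑ i, φ i x • v i = 0 := by
      have := congrArg S.range.mkQ hx
      have hSx : S.range.mkQ (S x) = 0 := (Submodule.Quotient.mk_eq_zero _).2 ⟨x, rfl⟩
      rw [add_apply, map_add, hSx, zero_add, finRankOp_apply, map_sum,
        map_zero] at this
      simpa only [map_smul, hw] using this
    have h2 : ∀ i, φ i x = 0 := Fintype.linearIndependent_iff.1 hv _ h1
    have h3 : π x = 0 := e.ext_elem fun i => by simpa [φ] using h2 i
    have h4 : S x = 0 := by simpa [h2] using hx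
    have h5 := hπ ⟨x, h4⟩
    rw [h3] at h5
    exact (congrArg Subtype.val h5).symm
  have hunit := isUnit_of_injective_add_compact isUnit_one
    (hK.add (isCompactOperator_finRankOp φ w)) hinj
  have hsurj := (ContinuousLinearMap.isUnit_iff_bijective.1 hunit).2
  refine hinf (Module.Finite.of_surjective (Fintype.linearCombination ℂ v) fun q => ?_)
  obtain ⟨y, rfl⟩ := S.range.mkQ_surjective q
  obtain ⟨x, rfl⟩ := hsurj y
  refine ⟨fun i => φ i x, ?_⟩
  have hSx : S.range.mkQ (S x) = 0 := (Submodule.Quotient.mk_eq_zero _).2 ⟨x, rfl⟩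
  have : (1 + (K + finRankOp φ w)) x = S x + ∑ i, φ i x • w i := by simp [hS, add_assoc]
  change _ = S.range.mkQ ((1 + (K + finRankOp φ w)) x)
  rw [this, map_add, hSx, zero_add, map_sum]
  simp [Fintype.linearCombination_apply, hw]

theorem isFredholm_of_parametrix [CompleteSpace Y] {A R K L : Y →L[ℂ] Y}
    (hK : IsCompactOperator K) (hL : IsCompactOperator L) (hRA : R * A = 1 + K)
    (hAR : A * R = 1 + L) : A.IsFredholm := by
  have hbd : ∀ x, (1 + ‖R‖)⁻¹ * ‖x‖ ≤ ‖A x‖ + ‖K x‖ := fun x => by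
    have h1 : x = R (A x) - K x := by
      have : R (A x) = x + K x := congrArg (fun T : Y →L[ℂ] Y => T x) hRA
      simp [this]
    have h2 : ‖x‖ ≤ ‖R‖ * ‖A x‖ + ‖K x‖ := by
      conv_lhs => rw [h1]
      exact (norm_sub_le _ _).trans (add_le_add_left (R.le_opNorm _) _)
    rw [inv_mul_le_iff₀ (by positivity)]
    nlinarith [norm_nonneg (A x), norm_nonneg (K x), norm_nonneg R]
  have hpos : 0 < (1 + ‖R‖)⁻¹ := by positivity
  refine isFredholm_of_finiteDimensional (finiteDimensional_ker_of_compact hK hpos hbd)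
    (isClosed_range_of_compact hK hpos hbd) ?_
  have := finiteDimensional_coker_one_add_compact hL
  have hle : (1 + L : Y →L[ℂ] Y).range ≤ A.range := by
    rw [← hAR]
    rintro _ ⟨x, rfl⟩
    exact ⟨R x, rfl⟩
  exact Module.Finite.of_surjective (Submodule.factor hle) (Submodule.factor_surjective hle)

end Cokernel

section Coset

variable {R : Type*} [NormedRing R] (I : Ideal R) [I.IsTwoSided]

theorem cosetInvNormInv_nonneg (a : R) : 0 ≤ cosetInvNormInv I a :=
  inv_nonneg.2 (norm_nonneg _)

theorem inv_norm_le_cosetInvNormInv {δ : ℝ} (hδ : 0 < δ) (hI : ∀ i ∈ I, δ ≤ ‖1 + i‖) {a r : R}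
    (har : a * r - 1 ∈ I) (hra : r * a - 1 ∈ I) : ‖r‖⁻¹ ≤ cosetInvNormInv I a := by
  have h1 : Ideal.Quotient.mk I a * Ideal.Quotient.mk I r = 1 := by
    rw [← map_mul, ← map_one (Ideal.Quotient.mk I)]
    exact (Ideal.Quotient.mk_eq_mk_iff_sub_mem _ _).2 har
  have h2 : Ideal.Quotient.mk I r * Ideal.Quotient.mk I a = 1 := by
    rw [← map_mul, ← map_one (Ideal.Quotient.mk I)]
    exact (Ideal.Quotient.mk_eq_mk_iff_sub_mem _ _).2 hra
  have hinv : Ring.inverse (Ideal.Quotient.mk I a) = Ideal.Quotient.mk I r :=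
    Ring.inverse_unit ⟨_, _, h1, h2⟩
  rw [cosetInvNormInv, hinv]
  have hpos : 0 < ‖(Ideal.Quotient.mk I r : R ⧸ I)‖ := by
    by_contra hcon
    have ha : 0 < ‖a‖ + 1 := by positivity
    obtain ⟨s, hs, hlt⟩ := Submodule.Quotient.norm_mk_lt (S := I)
      (Ideal.Quotient.mk I r) (ε := δ / (‖a‖ + 1)) (by positivity)
    have hs' : Ideal.Quotient.mk I s = Ideal.Quotient.mk I r := hs
    have hmem : a * s - 1 ∈ I := by
      rw [← Ideal.Quotient.mk_eq_mk_iff_sub_mem, map_mul, hs', h1, map_one]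
    have h3 := hI _ hmem
    rw [add_sub_cancel] at h3
    have h4 : ‖s‖ < δ / (‖a‖ + 1) := by linarith
    rw [lt_div_iff₀ ha] at h4
    nlinarith [norm_mul_le a s, norm_nonneg s]
  exact inv_anti₀ hpos (Submodule.Quotient.norm_mk_le (S := I) r)

theorem exists_of_lt_cosetInvNormInv {a : R} {c : ℝ} (hc : 0 < c) (h : c < cosetInvNormInv I a) :
    ∃ r : R, a * r - 1 ∈ I ∧ r * a - 1 ∈ I ∧ ‖r‖ < c⁻¹ := by
  rw [cosetInvNormInv] at h
  by_cases hu : IsUnit (Ideal.Quotient.mk I a)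
  · have hpos := inv_pos.1 (hc.trans h)
    have hlt := (lt_inv_comm₀ hc hpos).1 h
    obtain ⟨r, hr, hrlt⟩ := Submodule.Quotient.norm_mk_lt (S := I)
      (Ring.inverse (Ideal.Quotient.mk I a)) (sub_pos.2 hlt)
    have hr' : Ideal.Quotient.mk I r = Ring.inverse (Ideal.Quotient.mk I a) := hr
    refine ⟨r, ?_, ?_, by linarith⟩
    · rw [← Ideal.Quotient.mk_eq_mk_iff_sub_mem, map_mul, hr', map_one]
      exact Ring.mul_inverse_cancel _ hu
    · rw [← Ideal.Quotient.mk_eq_mk_iff_sub_mem, map_mul, hr', map_one]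
      exact Ring.inverse_mul_cancel _ hu
  · have h0 : ‖(Ring.inverse (Ideal.Quotient.mk I a) : R ⧸ I)‖⁻¹ = 0 := by
      rw [Ring.inverse_non_unit _ hu]
      exact inv_eq_zero.2 norm_zero
    linarith

end Coset

/-- A parametrix of `A` together with dual bases for its kernel and its cokernel. -/
structure FredholmData {Y : Type*} [NormedAddCommGroup Y] [NormedSpace ℂ Y] (A : Y →L[ℂ] Y)
    (a b : ℕ) where
  /-- a basis of the kernel -/
  x : Fin a → Y
  /-- functionals that are dual to the basis of the kernel -/
  φ : Fin a → StrongDual ℂ Y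
  /-- a basis of a complement of the range -/
  y : Fin b → Y
  /-- functionals that vanish on the range and are dual to the basis of the complement -/
  f : Fin b → StrongDual ℂ Y
  /-- the parametrix -/
  R : Y →L[ℂ] Y
  map_x : ∀ i, A (x i) = 0
  f_map : ∀ j u, f j (A u) = 0
  φ_x : ∀ i j, φ i (x j) = if i = j then 1 else 0
  f_y : ∀ i j, f i (y j) = if i = j then 1 else 0
  R_map : ∀ u, R (A u) = u - ∑ i, φ i u • x i
  map_R : ∀ u, A (R u) = u - ∑ j, f j u • y j
  R_y : ∀ j, R (y j) = 0
  φ_R : ∀ i u, φ i (R u) = 0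

namespace FredholmData

variable {Y : Type*} [NormedAddCommGroup Y] [NormedSpace ℂ Y] {A : Y →L[ℂ] Y} {a b : ℕ}

/-- The data of the adjoint operator. -/
def dual (D : FredholmData A a b) : FredholmData (dualOp A) b a where
  x := D.f
  φ := fun j => NormedSpace.inclusionInDoubleDual ℂ Y (D.y j)
  y := D.φ
  f := fun i => NormedSpace.inclusionInDoubleDual ℂ Y (D.x i)
  R := dualOp D.R
  map_x := fun j => by ext u; simp [D.f_map]
  f_map := fun i g => by simp [D.map_x]
  φ_x := fun i j => by simp [D.f_y, eq_comm]
  f_y := fun i j => by simp [D.φ_x, eq_comm]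
  R_map := fun g => by
    ext u
    simp [D.map_R, mul_comm]
  map_R := fun g => by
    ext u
    simp [D.R_map, mul_comm]
  R_y := fun i => by ext u; simp [D.φ_R]
  φ_R := fun j g => by simp [D.R_y]

theorem le_of_injective_add_compact [CompleteSpace Y] (D : FredholmData A a b) {K : Y →L[ℂ] Y}
    (hK : IsCompactOperator K) (hinj : Function.Injective (A + K)) : a ≤ b := by
  by_contra! hlt
  let e : Fin b → Fin a := Fin.castLE hlt.le
  have he : Function.Injective e := Fin.castLE_injective hlt.le
  set K₀ : Y →L[ℂ] Y := finRankOp (fun j => D.φ (e j)) D.y with hK₀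
  set R' : Y →L[ℂ] Y := D.R + finRankOp D.f (fun j => D.x (e j)) with hR'
  have hCR : (A + K₀) * R' = 1 := by
    ext u
    simp [hK₀, hR', D.map_R, D.φ_R, D.φ_x, D.map_x, he.eq_iff]
  have hCRu : ∀ u, (A + K₀) (R' u) = u := fun u => congrArg (fun T : Y →L[ℂ] Y => T u) hCR
  have hR'inj : Function.Injective R' := fun u v huv => by
    rw [← hCRu u, ← hCRu v, huv]
  have hfac : (A + K) * R' = 1 + (K - K₀) * R' := by
    rw [← hCR]
    noncomm_ring
  have hcomp : IsCompactOperator ((K - K₀) * R' : Y →L[ℂ] Y) :=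
    (hK.sub (isCompactOperator_finRankOp _ _)).comp_clm R'
  have hunit : IsUnit (1 + (K - K₀) * R') := by
    refine isUnit_of_injective_add_compact isUnit_one hcomp ?_
    rw [← hfac]
    exact hinj.comp hR'inj
  rw [← hfac] at hunit
  have hsurj := (ContinuousLinearMap.isUnit_iff_bijective.1 hunit).2
  let i₀ : Fin a := ⟨b, hlt⟩
  have hi₀ : ∀ j, e j ≠ i₀ := fun j h => by
    have := congrArg Fin.val h
    simp [e, i₀] at this
    omega
  obtain ⟨v, hv⟩ := hsurj ((A + K) (D.x i₀))
  have hv' : R' v = D.x i₀ := hinj hv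
  have h0 : (A + K₀) (D.x i₀) = 0 := by
    simp [hK₀, D.map_x, D.φ_x, hi₀]
  have hv0 : v = 0 := by rw [← hCRu v, hv', h0]
  have h1 := D.φ_x i₀ i₀
  rw [← hv', hv0] at h1
  simp at h1

end FredholmData

section Existence

variable {Y : Type*} [NormedAddCommGroup Y] [NormedSpace ℂ Y]

theorem exists_dual_family_ker {A : Y →L[ℂ] Y} [FiniteDimensional ℂ A.ker]
    (V : Submodule ℂ (StrongDual ℂ Y)) (hV : ∀ x, A x = 0 → (∀ φ ∈ V, φ x = 0) → x = 0)
    {ι : Type*} [Fintype ι] [DecidableEq ι] (e : Module.Basis ι ℂ A.ker) :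
    ∃ φ : ι → StrongDual ℂ Y, (∀ i, φ i ∈ V) ∧ ∀ i (u : A.ker), φ i u = e.coord i u := by
  let ρ : V →ₗ[ℂ] Module.Dual ℂ A.ker :=
    { toFun := fun φ => (φ : Y →ₗ[ℂ] ℂ) ∘ₗ A.ker.subtype
      map_add' := fun _ _ => rfl
      map_smul' := fun _ _ => rfl }
  have hρ : LinearMap.range ρ = ⊤ := by
    have h0 : (LinearMap.range ρ).dualCoannihilator = ⊥ := by
      rw [eq_bot_iff]
      intro u hu
      rw [Submodule.mem_dualCoannihilator] at hu
      rw [Submodule.mem_bot]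
      refine Subtype.ext (hV u u.2 fun φ hφ => ?_)
      exact hu (ρ ⟨φ, hφ⟩) ⟨_, rfl⟩
    rw [← Subspace.dualCoannihilator_dualAnnihilator_eq (W := LinearMap.range ρ), h0,
      Submodule.dualAnnihilator_bot]
  have : ∀ i, ∃ φ : V, ρ φ = e.coord i := fun i => by
    have : e.coord i ∈ LinearMap.range ρ := hρ ▸ Submodule.mem_top
    exact this
  choose φ hφ using this
  exact ⟨fun i => φ i, fun i => (φ i).2, fun i u => LinearMap.congr_fun (hφ i) u⟩

theorem exists_lift_coker {A : Y →L[ℂ] Y} (hr : IsClosed (A.range : Set Y))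
    [FiniteDimensional ℂ (Y ⧸ A.range)] (W : Submodule ℂ Y)
    (hW : ∀ f : StrongDual ℂ Y, (∀ x, f (A x) = 0) → (∀ w ∈ W, f w = 0) → f = 0)
    (q : Y ⧸ A.range) : ∃ y ∈ W, A.range.mkQ y = q := by
  have htop : W.map A.range.mkQ = ⊤ := by
    by_contra hne
    obtain ⟨g, hg0, hg⟩ := Submodule.exists_le_ker_of_lt_top _ (lt_top_iff_ne_top.2 hne)
    let f : StrongDual ℂ Y := (LinearMap.toContinuousLinearMap g) ∘L A.range.mkQL
    have hf : f = 0 := by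
      refine hW f (fun x => ?_) fun w hw => ?_
      · have : A.range.mkQ (A x) = 0 := (Submodule.Quotient.mk_eq_zero _).2 ⟨x, rfl⟩
        change g (A.range.mkQ (A x)) = 0
        rw [this, map_zero]
      · exact hg ⟨w, hw, rfl⟩
    refine hg0 (LinearMap.ext fun q => ?_)
    obtain ⟨u, rfl⟩ := A.range.mkQ_surjective q
    exact congrArg (fun T : StrongDual ℂ Y => T u) hf
  have : q ∈ W.map A.range.mkQ := htop ▸ Submodule.mem_top
  obtain ⟨y, hy, rfl⟩ := this
  exact ⟨y, hy, rfl⟩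

theorem exists_fredholmData [CompleteSpace Y] {A : Y →L[ℂ] Y} (hA : A.IsFredholm)
    (V : Submodule ℂ (StrongDual ℂ Y)) (hV : ∀ x, A x = 0 → (∀ φ ∈ V, φ x = 0) → x = 0)
    (W : Submodule ℂ Y)
    (hW : ∀ f : StrongDual ℂ Y, (∀ x, f (A x) = 0) → (∀ w ∈ W, f w = 0) → f = 0) :
    ∃ D : FredholmData A (Module.finrank ℂ A.ker) (Module.finrank ℂ (Y ⧸ A.range)),
      (∀ i, D.φ i ∈ V) ∧ ∀ j, D.y j ∈ W := by
  have := hA.finite_ker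
  have : FiniteDimensional ℂ (Y ⧸ A.range) := hA.finite_coker
  have hr := hA.isClosed_range
  let e := Module.finBasis ℂ A.ker
  let q := Module.finBasis ℂ (Y ⧸ A.range)
  obtain ⟨φ, hφV, hφ⟩ := exists_dual_family_ker V hV e
  choose y hyW hy using fun j => exists_lift_coker hr W hW (q j)
  let f : Fin (Module.finrank ℂ (Y ⧸ A.range)) → StrongDual ℂ Y := fun j =>
    (LinearMap.toContinuousLinearMap (q.coord j)) ∘L A.range.mkQL
  have hf : ∀ j u, f j u = q.coord j (A.range.mkQ u) := fun _ _ => rfl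
  have map_x : ∀ i, A (e i : Y) = 0 := fun i => (e i).2
  have hmk : ∀ u, A.range.mkQ (A u) = 0 := fun u => (Submodule.Quotient.mk_eq_zero _).2 ⟨u, rfl⟩
  have f_map : ∀ j u, f j (A u) = 0 := fun j u => by rw [hf, hmk, map_zero]
  have φ_x : ∀ i j, φ i (e j : Y) = if i = j then 1 else 0 := fun i j => by
    rw [hφ]
    simp [Finsupp.single_apply, eq_comm]
  have f_y : ∀ i j, f i (y j) = if i = j then 1 else 0 := fun i j => by
    rw [hf, hy]
    simp [Finsupp.single_apply, eq_comm]
  have hker : ∀ u, A u = 0 → u = ∑ i, φ i u • (e i : Y) := fun u hu => by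
    have h := e.sum_repr ⟨u, hu⟩
    have h' := congrArg (Subtype.val) h
    rw [Submodule.coe_sum] at h'
    conv_lhs => rw [← show _ = u from h']
    exact Finset.sum_congr rfl fun i _ => by rw [hφ i ⟨u, hu⟩]; rfl
  let T : (Y × (Fin (Module.finrank ℂ (Y ⧸ A.range)) → ℂ)) →L[ℂ]
      (Y × (Fin (Module.finrank ℂ A.ker) → ℂ)) :=
    (A ∘L .fst ℂ _ _ + ∑ j, ((ContinuousLinearMap.proj j) ∘L .snd ℂ _ _).smulRight (y j)).prod
      ((ContinuousLinearMap.pi φ) ∘L .fst ℂ _ _)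
  have hT : ∀ u c, T (u, c) = (A u + ∑ j, c j • y j, fun i => φ i u) := fun u c => by
    ext <;> simp [T]
  have hTinj : Function.Injective T := by
    refine (injective_iff_map_eq_zero T).2 ?_
    rintro ⟨u, c⟩ h
    rw [hT, Prod.mk_eq_zero] at h
    obtain ⟨h1, h2⟩ := h
    have hc : c = 0 := by
      ext j
      have := congrArg (f j) h1
      simpa [f_map, f_y] using this
    have hu : A u = 0 := by simpa [hc] using h1
    have hu0 : u = 0 := by
      rw [hker u hu]
      exact Finset.sum_eq_zero fun i _ => by rw [congrFun h2 i]; simp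
    rw [hu0, hc]
    rfl
  have hTsurj : Function.Surjective T := by
    rintro ⟨v, d⟩
    have hv : v - ∑ j, f j v • y j ∈ A.range := by
      refine (Submodule.Quotient.mk_eq_zero _).1 ?_
      change A.range.mkQ _ = 0
      rw [map_sub, map_sum, sub_eq_zero]
      conv_lhs => rw [← q.sum_repr (A.range.mkQ v)]
      exact Finset.sum_congr rfl fun j _ => by rw [map_smul, hy, hf]; rfl
    obtain ⟨u₀, hu₀⟩ := hv
    have hu₀' : A u₀ = v - ∑ j, f j v • y j := hu₀
    refine ⟨(u₀ + ∑ i, (d i - φ i u₀) • (e i : Y), fun j => f j v), ?_⟩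
    rw [hT]
    ext i
    · simp [hu₀', map_x]
    · simp [φ_x]
  let E := ContinuousLinearEquiv.ofBijective T (LinearMap.ker_eq_bot.2 hTinj)
    (LinearMap.range_eq_top.2 hTsurj)
  have hE : ∀ z, E z = T z := fun _ => rfl
  let R : Y →L[ℂ] Y := .fst ℂ _ _ ∘L E.symm.toContinuousLinearMap ∘L .inl ℂ _ _
  have hR : ∀ v u c, T (u, c) = (v, 0) → R v = u := fun v u c h => by
    have : E.symm (v, 0) = (u, c) := by
      rw [ContinuousLinearEquiv.symm_apply_eq, hE, h]
    simp [R, this]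
  have hR' : ∀ v, ∃ c : Fin (Module.finrank ℂ (Y ⧸ A.range)) → ℂ,
      A (R v) + ∑ j, c j • y j = v ∧ ∀ i, φ i (R v) = 0 := fun v => by
    have h := E.apply_symm_apply (v, (0 : Fin (Module.finrank ℂ A.ker) → ℂ))
    rw [hE, ← Prod.mk.eta (p := E.symm _), hT, Prod.mk_inj] at h
    exact ⟨_, h.1, fun i => congrFun h.2 i⟩
  refine ⟨⟨fun i => e i, φ, y, f, R, map_x, f_map, φ_x, f_y, fun u => ?_, fun v => ?_,
    fun j => ?_, fun i v => ?_⟩, hφV, hyW⟩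
  · refine hR _ _ 0 ?_
    rw [hT]
    ext i
    · simp [map_x]
    · simp [φ_x]
  · obtain ⟨c, hc, -⟩ := hR' v
    have : ∀ j, f j v = c j := fun j => by
      rw [← hc]
      simp [f_map, f_y]
    rw [eq_sub_iff_add_eq]
    simpa [this] using hc
  · refine hR _ _ (Pi.single j 1) ?_
    rw [hT]
    ext i
    · simp [Pi.single_apply]
    · simp
  · obtain ⟨c, -, hc⟩ := hR' v
    exact hc i

end Existence

section ProjectionSequences

variable {Y : Type*} [NormedAddCommGroup Y] [NormedSpace ℂ Y]

/-- A sequence of nested compact projections that, like their complements, are contractions. -/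
structure NestedProj (P : ℕ → Y →L[ℂ] Y) : Prop where
  mul : ∀ m n, P m * P n = P (min m n)
  norm_le : ∀ n, ‖P n‖ ≤ 1
  norm_compl_le : ∀ n, ‖1 - P n‖ ≤ 1
  compact : ∀ n, IsCompactOperator (P n)
  compl_ne : ∀ n, 1 - P n ≠ 0

/-- The norm of `u + v`, where `u` lives on a cube and `v` outside of it, is a monotone function
of `‖u‖` and `‖v‖`, which does not depend on the cube. -/
def MonotoneNorm (P : ℕ → Y →L[ℂ] Y) : Prop :=
  ∀ m n (u v x y : Y), P m u = u → P m v = 0 → P n x = x → P n y = 0 →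
    ‖u‖ ≤ ‖x‖ → ‖v‖ ≤ ‖y‖ → ‖u + v‖ ≤ ‖x + y‖

/-- `A` commutes up to a small error with smooth versions of the projections `Pₘ`. -/
def QuasiCommutes (P : ℕ → Y →L[ℂ] Y) (A : Y →L[ℂ] Y) : Prop :=
  ∀ m, ∀ ε > (0 : ℝ), ∃ (F : Y →L[ℂ] Y) (n : ℕ), P m * F = P m ∧ F * P m = P m ∧
    P n * F = F ∧ F * P n = F ∧ ‖A * F - F * A‖ ≤ ε

namespace NestedProj

variable {P : ℕ → Y →L[ℂ] Y}

theorem mul_of_le (hP : NestedProj P)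
    {m n : ℕ} (h : m ≤ n) : P m * P n = P m := by rw [hP.mul, min_eq_left h]

theorem mul_of_ge (hP : NestedProj P)
    {m n : ℕ} (h : m ≤ n) : P n * P m = P m := by rw [hP.mul, min_eq_right h]

theorem mul_compl (hP : NestedProj P) {m n : ℕ} (h : m ≤ n) : P m * (1 - P n) = 0 := by
  rw [mul_sub, mul_one, hP.mul_of_le h, sub_self]

theorem compl_mul (hP : NestedProj P) {m n : ℕ} (h : m ≤ n) : (1 - P n) * P m = 0 := by
  rw [sub_mul, one_mul, hP.mul_of_ge h, sub_self]

theorem compl_mul_compl (hP : NestedProj P)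
    {m n : ℕ} (h : m ≤ n) : (1 - P m) * (1 - P n) = 1 - P n := by
  rw [sub_mul, one_mul, hP.mul_compl h, sub_zero]

theorem apply_of_le (hP : NestedProj P) {m n : ℕ} (h : m ≤ n) (x : Y) : P m (P n x) = P m x :=
  congrArg (fun T : Y →L[ℂ] Y => T x) (hP.mul_of_le h)

theorem apply_of_ge (hP : NestedProj P) {m n : ℕ} (h : m ≤ n) (x : Y) : P n (P m x) = P m x :=
  congrArg (fun T : Y →L[ℂ] Y => T x) (hP.mul_of_ge h)

theorem compl_apply_compl (hP : NestedProj P) {m n : ℕ} (h : m ≤ n) (x : Y) :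
    (1 - P m) ((1 - P n) x) = (1 - P n) x :=
  congrArg (fun T : Y →L[ℂ] Y => T x) (hP.compl_mul_compl h)

theorem norm_apply_le (hP : NestedProj P) (n : ℕ) (x : Y) : ‖P n x‖ ≤ ‖x‖ :=
  ((P n).le_of_opNorm_le (hP.norm_le n) x).trans_eq (one_mul _)

theorem norm_compl_apply_le (hP : NestedProj P) (n : ℕ) (x : Y) : ‖(1 - P n) x‖ ≤ ‖x‖ :=
  ((1 - P n).le_of_opNorm_le (hP.norm_compl_le n) x).trans_eq (one_mul _)

theorem one_le_norm_compl (hP : NestedProj P) (n : ℕ) : 1 ≤ ‖1 - P n‖ := by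
  have hpos : 0 < ‖1 - P n‖ := norm_pos_iff.2 (hP.compl_ne n)
  have h := norm_mul_le (1 - P n) (1 - P n)
  rw [hP.compl_mul_compl le_rfl] at h
  nlinarith

theorem isPCompact_of_mul (hP : NestedProj P)
    {k : ℕ} {K : Y →L[ℂ] Y} (h1 : P k * K = K) (h2 : K * P k = K) :
    IsPCompact P K := by
  rw [isPCompact_iff]
  constructor
  · refine tendsto_const_nhds.congr' ?_
    filter_upwards [eventually_ge_atTop k] with n hn
    rw [← h1, ← mul_assoc, hP.compl_mul hn, zero_mul]
  · refine tendsto_const_nhds.congr' ?_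
    filter_upwards [eventually_ge_atTop k] with n hn
    rw [← h2, mul_assoc, hP.mul_compl hn, mul_zero]

theorem isPCompact (hP : NestedProj P) (k : ℕ) : IsPCompact P (P k) :=
  hP.isPCompact_of_mul (hP.mul_of_le le_rfl) (hP.mul_of_le le_rfl)

theorem isCompactOperator_of_isPCompact (hP : NestedProj P) [CompleteSpace Y] {K : Y →L[ℂ] Y}
    (hK : IsPCompact P K) : IsCompactOperator K := by
  have h : Tendsto (fun n => P n * K) atTop (𝓝 K) := by
    have := (tendsto_const_nhds (x := K)).sub (isPCompact_iff.1 hK).1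
    simpa [sub_mul] using this
  exact isCompactOperator_of_tendsto h (Eventually.of_forall fun n => (hP.compact n).comp_clm K)

theorem mem_pAlgebra_iff (hP : NestedProj P) {A : Y →L[ℂ] Y} : A ∈ pAlgebra P ↔
    ∀ k, Tendsto (fun n => P k * A * (1 - P n)) atTop (𝓝 0) ∧
      Tendsto (fun n => (1 - P n) * A * P k) atTop (𝓝 0) := by
  constructor
  · intro hA k
    obtain ⟨h1, h2⟩ := hA _ (hP.isPCompact k)
    rw [isPCompact_iff] at h1 h2
    exact ⟨by simpa only [mul_assoc] using h2.2, by simpa only [mul_assoc] using h1.1⟩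
  · intro h K hK
    obtain ⟨hK1, hK2⟩ := isPCompact_iff.1 hK
    rw [isPCompact_iff, isPCompact_iff]
    have small : ∀ {u : ℕ → Y →L[ℂ] Y}, (∀ ε > 0, ∀ᶠ n in atTop, ‖u n‖ ≤ ε) →
        Tendsto u atTop (𝓝 0) := fun {u} hu => by
      rw [tendsto_zero_iff_norm_tendsto_zero, Metric.tendsto_nhds]
      intro ε hε
      filter_upwards [hu (ε / 2) (by positivity)] with n hn
      rw [Real.dist_0_eq_abs, abs_of_nonneg (norm_nonneg _)]
      linarith
    have ev : ∀ {u : ℕ → Y →L[ℂ] Y}, Tendsto u atTop (𝓝 0) → ∀ ε > 0, ∀ᶠ n in atTop, ‖u n‖ ≤ ε :=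
      fun {u} hu ε hε => by
        have := (tendsto_zero_iff_norm_tendsto_zero.1 hu).eventually_lt_const hε
        filter_upwards [this] with n hn using hn.le
    refine ⟨⟨small fun ε hε => ?_, ?_⟩, ?_, small fun ε hε => ?_⟩
    · have hd : 0 < ε / (2 * (1 + ‖A‖)) := by positivity
      obtain ⟨k, hk⟩ := (ev hK1 _ hd).exists
      have hd' : 0 < ε / (2 * (1 + ‖K‖)) := by positivity
      filter_upwards [ev (h k).2 _ hd'] with n hn
      have hsplit : (1 - P n) * (A * K) =
          (1 - P n) * A * P k * K + (1 - P n) * (A * ((1 - P k) * K)) := by noncomm_ring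
      rw [hsplit]
      have e1 : ‖(1 - P n) * A * P k * K‖ ≤ ε / (2 * (1 + ‖K‖)) * ‖K‖ :=
        (norm_mul_le _ _).trans (by gcongr)
      have e2 : ‖(1 - P n) * (A * ((1 - P k) * K))‖ ≤ ‖A‖ * (ε / (2 * (1 + ‖A‖))) :=
        (norm_mul_le _ _).trans ((mul_le_of_le_one_left (norm_nonneg _)
          (hP.norm_compl_le n)).trans ((norm_mul_le _ _).trans (by gcongr)))
      have e3 : ε / (2 * (1 + ‖K‖)) * ‖K‖ ≤ ε / 2 := by
        rw [div_mul_eq_mul_div, div_le_div_iff₀ (by positivity) two_pos]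
        nlinarith [norm_nonneg K]
      have e4 : ‖A‖ * (ε / (2 * (1 + ‖A‖))) ≤ ε / 2 := by
        rw [mul_div_assoc', div_le_div_iff₀ (by positivity) two_pos]
        nlinarith [norm_nonneg A]
      linarith [norm_add_le ((1 - P n) * A * P k * K) ((1 - P n) * (A * ((1 - P k) * K)))]
    · simpa [mul_assoc] using hK2.const_mul A
    · simpa [mul_assoc] using hK1.mul_const A
    · have hd : 0 < ε / (2 * (1 + ‖A‖)) := by positivity
      obtain ⟨k, hk⟩ := (ev hK2 _ hd).exists
      have hd' : 0 < ε / (2 * (1 + ‖K‖)) := by positivity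
      filter_upwards [ev (h k).1 _ hd'] with n hn
      have hsplit : K * A * (1 - P n) =
          K * (P k * A * (1 - P n)) + K * (1 - P k) * A * (1 - P n) := by noncomm_ring
      rw [hsplit]
      have e1 : ‖K * (P k * A * (1 - P n))‖ ≤ ‖K‖ * (ε / (2 * (1 + ‖K‖))) :=
        (norm_mul_le _ _).trans (by gcongr)
      have e2 : ‖K * (1 - P k) * A * (1 - P n)‖ ≤ ε / (2 * (1 + ‖A‖)) * ‖A‖ :=
        (norm_mul_le _ _).trans ((mul_le_of_le_one_right (norm_nonneg _)
          (hP.norm_compl_le n)).trans ((norm_mul_le _ _).trans (by gcongr)))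
      have e3 : ‖K‖ * (ε / (2 * (1 + ‖K‖))) ≤ ε / 2 := by
        rw [mul_div_assoc', div_le_div_iff₀ (by positivity) two_pos]
        nlinarith [norm_nonneg K]
      have e4 : ε / (2 * (1 + ‖A‖)) * ‖A‖ ≤ ε / 2 := by
        rw [div_mul_eq_mul_div, div_le_div_iff₀ (by positivity) two_pos]
        nlinarith [norm_nonneg A]
      linarith [norm_add_le (K * (P k * A * (1 - P n))) (K * (1 - P k) * A * (1 - P n))]

theorem eventually_norm_mul_compl_le (hP : NestedProj P)
    {A : Y →L[ℂ] Y} (hA : A ∈ pAlgebra P) (k : ℕ) {ε : ℝ}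
    (hε : 0 < ε) : ∀ᶠ n in atTop, ‖P k * A * (1 - P n)‖ ≤ ε := by
  have := (tendsto_zero_iff_norm_tendsto_zero.1 (hP.mem_pAlgebra_iff.1 hA k).1).eventually_lt_const hε
  filter_upwards [this] with n hn using hn.le

theorem eventually_norm_compl_mul_le (hP : NestedProj P)
    {A : Y →L[ℂ] Y} (hA : A ∈ pAlgebra P) (k : ℕ) {ε : ℝ}
    (hε : 0 < ε) : ∀ᶠ n in atTop, ‖(1 - P n) * A * P k‖ ≤ ε := by
  have := (tendsto_zero_iff_norm_tendsto_zero.1 (hP.mem_pAlgebra_iff.1 hA k).2).eventually_lt_const hε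
  filter_upwards [this] with n hn using hn.le

/-- The diagonal blocks of `A` form an operator of norm at most `‖A‖`. -/
theorem norm_sum_blocks_le (hP : NestedProj P) (hM : MonotoneNorm P) (A : Y →L[ℂ] Y) {s t : ℕ → ℕ}
    (hs : Monotone s) (ht : Monotone t) (k : ℕ) :
    ‖∑ j ∈ Finset.range k, (P (t (j + 1)) - P (t j)) * A * (P (s (j + 1)) - P (s j))‖ ≤ ‖A‖ := by
  have key : ∀ (k : ℕ) (x : Y),
      ‖(∑ j ∈ Finset.range k, (P (t (j + 1)) - P (t j)) * A * (P (s (j + 1)) - P (s j))) x‖ ≤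
        ‖A‖ * ‖(P (s k) - P (s 0)) x‖ ∧
      P (t k) ((∑ j ∈ Finset.range k,
        (P (t (j + 1)) - P (t j)) * A * (P (s (j + 1)) - P (s j))) x) =
      (∑ j ∈ Finset.range k, (P (t (j + 1)) - P (t j)) * A * (P (s (j + 1)) - P (s j))) x := by
    intro k x
    induction k with
    | zero => simp
    | succ k ih =>
      rw [Finset.sum_range_succ, add_apply]
      set u := (∑ j ∈ Finset.range k,
        (P (t (j + 1)) - P (t j)) * A * (P (s (j + 1)) - P (s j))) x with hu
      set z := (P (s (k + 1)) - P (s k)) x with hz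
      have hv : ((P (t (k + 1)) - P (t k)) * A * (P (s (k + 1)) - P (s k))) x =
          (P (t (k + 1)) - P (t k)) (A z) := rfl
      rw [hv]
      have htk := ht k.le_succ
      have hsk := hs k.le_succ
      have hP1 : ∀ y, P (t k) ((P (t (k + 1)) - P (t k)) y) = 0 := fun y => by
        rw [sub_apply, map_sub, hP.apply_of_le htk, hP.apply_of_le le_rfl, sub_self]
      have hP2 : ∀ y, ‖(P (t (k + 1)) - P (t k)) y‖ ≤ ‖y‖ := fun y => by
        have : (P (t (k + 1)) - P (t k)) y = P (t (k + 1)) ((1 - P (t k)) y) := by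
          rw [sub_apply, sub_apply, map_sub, hP.apply_of_ge htk]
          rfl
        rw [this]
        exact (hP.norm_apply_le _ _).trans (hP.norm_compl_apply_le _ _)
      constructor
      · have hx : (P (s (k + 1)) - P (s 0)) x = (P (s k) - P (s 0)) x + z := by
          simp [hz]
        have hmain := hM (t k) (s k) u ((P (t (k + 1)) - P (t k)) (A z))
          ((‖A‖ : ℂ) • (P (s k) - P (s 0)) x) ((‖A‖ : ℂ) • z) ih.2 (hP1 _) ?_ ?_ ?_ ?_
        · rw [hx]
          refine hmain.trans_eq ?_
          rw [← smul_add, norm_smul, Complex.norm_real, norm_norm]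
        · rw [map_smul, sub_apply, map_sub, hP.apply_of_le le_rfl,
            hP.apply_of_ge (hs (Nat.zero_le k))]
        · rw [map_smul, hz, sub_apply, map_sub, hP.apply_of_le hsk, hP.apply_of_le le_rfl,
            sub_self, smul_zero]
        · rw [norm_smul, Complex.norm_real, norm_norm]
          exact ih.1
        · rw [norm_smul, Complex.norm_real, norm_norm]
          exact (hP2 _).trans (A.le_opNorm z)
      · rw [map_add, ← ih.2, hP.apply_of_ge htk, ih.2, sub_apply, map_sub,
          hP.apply_of_le le_rfl, hP.apply_of_ge htk]
  refine ContinuousLinearMap.opNorm_le_bound _ (norm_nonneg A) fun x => (key k x).1.trans ?_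
  gcongr
  have hs0 := hs (Nat.zero_le k)
  have : (P (s k) - P (s 0)) x = P (s k) ((1 - P (s 0)) x) := by
    rw [sub_apply, sub_apply, map_sub, hP.apply_of_ge hs0]
    rfl
  rw [this]
  exact (hP.norm_apply_le _ _).trans (hP.norm_compl_apply_le _ _)

theorem norm_commutator_sub_blocks_le (hP : NestedProj P)
    {A : Y →L[ℂ] Y} {n₀ n₁ n₂ : ℕ} (h₁ : n₁ ≤ n₂)
    {δ : ℝ} (a1 : ‖P n₀ * A * (1 - P n₁)‖ ≤ δ) (a2 : ‖(1 - P n₁) * A * P n₀‖ ≤ δ)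
    (b1 : ‖P n₁ * A * (1 - P n₂)‖ ≤ δ) (b2 : ‖(1 - P n₂) * A * P n₁‖ ≤ δ) :
    ‖A * P n₁ - P n₁ * A - ((P n₂ - P n₁) * A * (P n₁ - P n₀)
      - (P n₁ - P n₀) * A * (P n₂ - P n₁))‖ ≤ 4 * δ := by
  have e : A * P n₁ - P n₁ * A - ((P n₂ - P n₁) * A * (P n₁ - P n₀)
      - (P n₁ - P n₀) * A * (P n₂ - P n₁)) =
      (1 - P n₂) * A * P n₁ + P n₂ * ((1 - P n₁) * A * P n₀)
        - (P n₁ * A * (1 - P n₂) + P n₀ * A * (1 - P n₁) * P n₂) := by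
    have q1 : P n₂ * P n₁ = P n₁ := hP.mul_of_ge h₁
    have q2 : P n₁ * P n₂ = P n₁ := hP.mul_of_le h₁
    simp only [mul_sub, sub_mul, mul_one, one_mul, mul_assoc, q2]
    simp only [← mul_assoc, q1]
    abel
  rw [e]
  have c1 : ‖P n₂ * ((1 - P n₁) * A * P n₀)‖ ≤ δ :=
    (norm_mul_le _ _).trans ((mul_le_of_le_one_left (norm_nonneg _) (hP.norm_le _)).trans a2)
  have c2 : ‖P n₀ * A * (1 - P n₁) * P n₂‖ ≤ δ :=
    (norm_mul_le _ _).trans ((mul_le_of_le_one_right (norm_nonneg _) (hP.norm_le _)).trans a1)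
  refine (norm_sub_le _ _).trans ?_
  linarith [norm_add_le ((1 - P n₂) * A * P n₁) (P n₂ * ((1 - P n₁) * A * P n₀)),
    norm_add_le (P n₁ * A * (1 - P n₂)) (P n₀ * A * (1 - P n₁) * P n₂)]

theorem quasiCommutes (hP : NestedProj P)
    (hM : MonotoneNorm P) {A : Y →L[ℂ] Y} (hA : A ∈ pAlgebra P) :
    QuasiCommutes P A := by
  intro m ε hε
  have hδ : 0 < ε / 8 := by positivity
  have hg : ∀ n, ∃ g, n ≤ g ∧ ‖P n * A * (1 - P g)‖ ≤ ε / 8 ∧ ‖(1 - P g) * A * P n‖ ≤ ε / 8 := by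
    intro n
    exact ((eventually_ge_atTop n).and ((hP.eventually_norm_mul_compl_le hA n hδ).and
      (hP.eventually_norm_compl_mul_le hA n hδ))).exists
  choose g hg1 hg2 hg3 using hg
  let s : ℕ → ℕ := fun j => g^[j] m
  have hsucc : ∀ j, s (j + 1) = g (s j) := fun j => Function.iterate_succ_apply' g j m
  have hs : Monotone s := monotone_nat_of_le_succ fun j => by rw [hsucc]; exact hg1 _
  have hs' : Monotone fun j => s (j + 1) := fun i j hij => hs (by omega)
  have hm : ∀ j, m ≤ s j := fun j => hs (Nat.zero_le j)
  obtain ⟨k, hk⟩ := exists_nat_gt (4 * ‖A‖ / ε)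
  have hkpos : (0 : ℝ) < k := lt_of_le_of_lt (by positivity) hk
  have hk0 : (k : ℂ) ≠ 0 := by exact_mod_cast hkpos.ne'
  set G : Y →L[ℂ] Y := ∑ j ∈ Finset.range k, P (s (j + 1)) with hG
  have smul_eq : ∀ T : Y →L[ℂ] Y, (k : ℂ)⁻¹ • ∑ _j ∈ Finset.range k, T = T := fun T => by
    rw [Finset.sum_const, Finset.card_range, ← Nat.cast_smul_eq_nsmul ℂ, smul_smul,
      inv_mul_cancel₀ hk0, one_smul]
  refine ⟨(k : ℂ)⁻¹ • G, s k, ?_, ?_, ?_, ?_, ?_⟩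
  · rw [mul_smul_comm, hG, Finset.mul_sum, ← smul_eq (P m)]
    congr 1
    exact Finset.sum_congr rfl fun j _ => by rw [smul_eq, hP.mul_of_le (hm _)]
  · rw [smul_mul_assoc, hG, Finset.sum_mul, ← smul_eq (P m)]
    congr 1
    exact Finset.sum_congr rfl fun j _ => by rw [smul_eq, hP.mul_of_ge (hm _)]
  · rw [mul_smul_comm, hG, Finset.mul_sum]
    congr 1
    exact Finset.sum_congr rfl fun j hj => hP.mul_of_ge (hs (Finset.mem_range.1 hj))
  · rw [smul_mul_assoc, hG, Finset.sum_mul]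
    congr 1
    exact Finset.sum_congr rfl fun j hj => hP.mul_of_le (hs (Finset.mem_range.1 hj))
  · rw [mul_smul_comm, smul_mul_assoc, ← smul_sub, norm_smul, norm_inv, Complex.norm_natCast,
      inv_mul_le_iff₀ hkpos]
    set B₁ := ∑ j ∈ Finset.range k, (P (s (j + 1 + 1)) - P (s (j + 1))) * A *
      (P (s (j + 1)) - P (s j)) with hB₁
    set B₂ := ∑ j ∈ Finset.range k, (P (s (j + 1)) - P (s j)) * A *
      (P (s (j + 1 + 1)) - P (s (j + 1))) with hB₂
    have n1 : ‖B₁‖ ≤ ‖A‖ := hP.norm_sum_blocks_le hM A hs hs' k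
    have n2 : ‖B₂‖ ≤ ‖A‖ := hP.norm_sum_blocks_le hM A hs' hs k
    have n3 : ‖A * G - G * A - (B₁ - B₂)‖ ≤ k * (4 * (ε / 8)) := by
      rw [hG, hB₁, hB₂, Finset.mul_sum, Finset.sum_mul, ← Finset.sum_sub_distrib,
        ← Finset.sum_sub_distrib, ← Finset.sum_sub_distrib]
      refine (norm_sum_le_of_le (f := fun j => A * P (s (j + 1)) - P (s (j + 1)) * A -
        ((P (s (j + 1 + 1)) - P (s (j + 1))) * A * (P (s (j + 1)) - P (s j)) -
          (P (s (j + 1)) - P (s j)) * A * (P (s (j + 1 + 1)) - P (s (j + 1))))) _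
        (n := fun _ => 4 * (ε / 8)) fun j _ => ?_).trans_eq (by simp)
      have h1 := hsucc j
      have h2 := hsucc (j + 1)
      refine hP.norm_commutator_sub_blocks_le (hs (j + 1).le_succ) ?_ ?_ ?_ ?_
      · rw [h1]; exact hg2 _
      · rw [h1]; exact hg3 _
      · rw [h2]; exact hg2 _
      · rw [h2]; exact hg3 _
    have n4 : ‖A * G - G * A‖ ≤ ‖A * G - G * A - (B₁ - B₂)‖ + (‖B₁‖ + ‖B₂‖) := by
      have := norm_add_le (A * G - G * A - (B₁ - B₂)) (B₁ - B₂)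
      rw [sub_add_cancel] at this
      linarith [norm_sub_le B₁ B₂]
    rw [div_lt_iff₀ hε] at hk
    nlinarith

theorem quasiCommutes_add (hP : NestedProj P)
    {A K : Y →L[ℂ] Y} (hA : QuasiCommutes P A) {k : ℕ} (h1 : P k * K = K)
    (h2 : K * P k = K) : QuasiCommutes P (A + K) := by
  intro m ε hε
  obtain ⟨F, n, e1, e2, e3, e4, e5⟩ := hA (max m k) ε hε
  have hm : P m * P (max m k) = P m := hP.mul_of_le (le_max_left _ _)
  have hm' : P (max m k) * P m = P m := hP.mul_of_ge (le_max_left _ _)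
  have hk : P k * P (max m k) = P k := hP.mul_of_le (le_max_right _ _)
  have hk' : P (max m k) * P k = P k := hP.mul_of_ge (le_max_right _ _)
  refine ⟨F, n, ?_, ?_, e3, e4, ?_⟩
  · rw [← hm, mul_assoc, e1]
  · rw [← hm', ← mul_assoc, e2]
  · have f1 : K * F = K := by rw [← h2, ← hk, mul_assoc, mul_assoc, e1]
    have f2 : F * K = K := by rw [← h1, ← hk', ← mul_assoc, ← mul_assoc, e2]
    have : (A + K) * F - F * (A + K) = A * F - F * A := by
      rw [add_mul, mul_add, f1, f2]
      abel
    rwa [this]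

theorem mem_pAlgebra_of_quasiCommutes (hP : NestedProj P) {T : Y →L[ℂ] Y} (hT : QuasiCommutes P T) :
    T ∈ pAlgebra P := by
  have key : ∀ k, ∀ ε > 0, ∃ n₀, ∀ n ≥ n₀, ‖P k * T * (1 - P n)‖ ≤ ε ∧
      ‖(1 - P n) * T * P k‖ ≤ ε := by
    intro k ε hε
    obtain ⟨F, n₀, e1, e2, e3, e4, e5⟩ := hT k ε hε
    rw [norm_sub_rev] at e5
    refine ⟨n₀, fun n hn => ⟨?_, ?_⟩⟩
    · have hF : F * (1 - P n) = 0 := by rw [← e4, mul_assoc, hP.mul_compl hn, mul_zero]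
      have : P k * T * (1 - P n) = P k * (F * T - T * F) * (1 - P n) := by
        have e : P k * (F * T - T * F) * (1 - P n) =
            (P k * F) * T * (1 - P n) - P k * T * (F * (1 - P n)) := by noncomm_ring
        rw [e, e1, hF, mul_zero, sub_zero]
      rw [this]
      exact (norm_mul_le _ _).trans ((mul_le_of_le_one_right (norm_nonneg _)
        (hP.norm_compl_le n)).trans ((norm_mul_le _ _).trans
          ((mul_le_of_le_one_left (norm_nonneg _) (hP.norm_le k)).trans e5)))
    · have hF : (1 - P n) * F = 0 := by rw [← e3, ← mul_assoc, hP.compl_mul hn, zero_mul]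
      have : (1 - P n) * T * P k = -((1 - P n) * (F * T - T * F) * P k) := by
        rw [mul_sub, ← mul_assoc, hF, zero_mul, zero_sub, neg_mul, neg_neg, mul_assoc, mul_assoc,
          mul_assoc, e2]
      rw [this, norm_neg]
      exact (norm_mul_le _ _).trans ((mul_le_of_le_one_right (norm_nonneg _)
        (hP.norm_le k)).trans ((norm_mul_le _ _).trans
          ((mul_le_of_le_one_left (norm_nonneg _) (hP.norm_compl_le n)).trans e5)))
  have lim : ∀ {u : ℕ → Y →L[ℂ] Y}, (∀ ε > 0, ∃ n₀, ∀ n ≥ n₀, ‖u n‖ ≤ ε) →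
      Tendsto u atTop (𝓝 0) := fun {u} hu => by
    rw [Metric.tendsto_atTop]
    intro ε hε
    obtain ⟨n₀, hn₀⟩ := hu (ε / 2) (by positivity)
    refine ⟨n₀, fun n hn => ?_⟩
    rw [dist_zero_right]
    linarith [hn₀ n hn]
  refine hP.mem_pAlgebra_iff.2 fun k => ⟨lim fun ε hε => ?_, lim fun ε hε => ?_⟩
  · obtain ⟨n₀, h⟩ := key k ε hε
    exact ⟨n₀, fun n hn => (h n hn).1⟩
  · obtain ⟨n₀, h⟩ := key k ε hε
    exact ⟨n₀, fun n hn => (h n hn).2⟩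

theorem quasiCommutes_of_inverse {C T : Y →L[ℂ] Y} (hC : QuasiCommutes P C) (hCT : C * T = 1)
    (hTC : T * C = 1) : QuasiCommutes P T := by
  intro k ε hε
  have hd : 0 < ε / (1 + ‖T‖ * ‖T‖) := by positivity
  obtain ⟨F, n₀, e1, e2, e3, e4, e5⟩ := hC k _ hd
  refine ⟨F, n₀, e1, e2, e3, e4, ?_⟩
  have : F * T - T * F = T * (C * F - F * C) * T := by
    have e : T * (C * F - F * C) * T = (T * C) * (F * T) - (T * F) * (C * T) := by
      noncomm_ring
    rw [e, hTC, hCT, one_mul, mul_one]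
  rw [norm_sub_rev, this]
  calc ‖T * (C * F - F * C) * T‖ ≤ ‖T‖ * (ε / (1 + ‖T‖ * ‖T‖)) * ‖T‖ :=
        (norm_mul_le _ _).trans (by gcongr; exact (norm_mul_le _ _).trans (by gcongr))
    _ ≤ ε := by
      rw [mul_div_assoc', div_mul_eq_mul_div, div_le_iff₀ (by positivity)]
      nlinarith

theorem inverse_mem_pAlgebra (hP : NestedProj P)
    {C T : Y →L[ℂ] Y} (hC : QuasiCommutes P C) (hCT : C * T = 1)
    (hTC : T * C = 1) : T ∈ pAlgebra P :=
  hP.mem_pAlgebra_of_quasiCommutes (quasiCommutes_of_inverse hC hCT hTC)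

end NestedProj

end ProjectionSequences

section ProjectionSequences

variable {Y : Type*} [NormedAddCommGroup Y] [NormedSpace ℂ Y]

theorem one_sub_apply (T : Y →L[ℂ] Y) (x : Y) : (1 - T) x = x - T x := rfl

namespace NestedProj

variable {P : ℕ → Y →L[ℂ] Y}

theorem exists_unit_vector (hP : NestedProj P) {S : Y →L[ℂ] Y}
    (hS : ∀ n c, (∀ k, ‖S * (1 - P n) * P k‖ ≤ c) → ‖S * (1 - P n)‖ ≤ c)
    {c : ℝ} (hc0 : 0 ≤ c) {n : ℕ} (hc : c < ‖S * (1 - P n)‖) :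
    ∃ (x : Y) (k : ℕ), ‖x‖ = 1 ∧ P n x = 0 ∧ P k x = x ∧ c < ‖S x‖ := by
  obtain ⟨k, hk⟩ : ∃ k, c < ‖S * (1 - P n) * P k‖ := by
    by_contra! h
    exact absurd (hS n c h) (not_le.2 hc)
  obtain ⟨z, hz⟩ : ∃ z, c * ‖z‖ < ‖(S * (1 - P n) * P k) z‖ := by
    by_contra! h
    exact absurd (ContinuousLinearMap.opNorm_le_bound _ hc0 h) (not_le.2 hk)
  set w : Y := (1 - P n) (P k z) with hw
  have hSw : (S * (1 - P n) * P k) z = S w := rfl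
  rw [hSw] at hz
  have hwz : ‖w‖ ≤ ‖z‖ := (hP.norm_compl_apply_le _ _).trans (hP.norm_apply_le _ _)
  have hw0 : 0 < ‖w‖ := by
    rw [norm_pos_iff]
    intro h0
    rw [h0, map_zero, norm_zero] at hz
    exact absurd hz (not_lt.2 (by positivity))
  have hPn : P n w = 0 := by
    rw [hw, one_sub_apply, map_sub, hP.apply_of_le le_rfl, sub_self]
  have hPk : P k w = w := by
    have : P k (P n (P k z)) = P n (P k z) := by
      rcases le_total k n with h | h
      · rw [hP.apply_of_ge h, hP.apply_of_le le_rfl]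
      · exact hP.apply_of_ge h _
    rw [hw, one_sub_apply, map_sub, hP.apply_of_le le_rfl, this]
  refine ⟨(‖w‖⁻¹ : ℂ) • w, k, ?_, ?_, ?_, ?_⟩
  · rw [norm_smul, norm_inv, Complex.norm_real, norm_norm, inv_mul_cancel₀ hw0.ne']
  · rw [map_smul, hPn, smul_zero]
  · rw [map_smul, hPk]
  · rw [map_smul, norm_smul, norm_inv, Complex.norm_real, norm_norm, ← div_eq_inv_mul,
      lt_div_iff₀ hw0]
    exact (mul_le_mul_of_nonneg_left hwz hc0).trans_lt hz

/-- Adding a compact operator does not decrease the norm of `S` at infinity. -/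
theorem le_norm_add_compact (hP : NestedProj P)
    (hM : MonotoneNorm P) {S : Y →L[ℂ] Y} (hSP : S ∈ pAlgebra P)
    (hS : ∀ n c, (∀ k, ‖S * (1 - P n) * P k‖ ≤ c) → ‖S * (1 - P n)‖ ≤ c)
    {L : Y →L[ℂ] Y} (hL : IsCompactOperator L) {c : ℝ} (hc : ∀ n, c < ‖S * (1 - P n)‖) :
    c ≤ ‖S + L‖ := by
  rcases lt_or_ge c 0 with hneg | hc0
  · exact hneg.le.trans (norm_nonneg _)
  refine le_of_forall_pos_le_add fun ε' hε' => ?_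
  set ε := ε' / 4 with hε
  have hεpos : 0 < ε := by positivity
  choose x k hx1 hxn hxk hxS using fun n => hP.exists_unit_vector hS hc0 (hc n)
  have hl : ∀ n, ∃ l, k n ≤ l ∧ ‖(1 - P l) * S * P (k n)‖ ≤ ε := fun n =>
    ((eventually_ge_atTop (k n)).and (hP.eventually_norm_compl_mul_le hSP (k n) hεpos)).exists
  choose l hkl hl using hl
  have hg : ∀ n, ∃ g, max n (l n) ≤ g ∧ ‖P (l n) * S * (1 - P g)‖ ≤ ε := fun n =>
    ((eventually_ge_atTop _).and (hP.eventually_norm_mul_compl_le hSP (l n) hεpos)).exists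
  choose g hlg hg using hg
  let t : ℕ → ℕ := fun j => g^[j] 0
  have hsucc : ∀ j, t (j + 1) = g (t j) := fun j => Function.iterate_succ_apply' g j 0
  have ht : Monotone t := monotone_nat_of_le_succ fun j => by
    rw [hsucc]
    exact (le_max_left _ _).trans (hlg _)
  obtain ⟨i, j, hij, hLij⟩ : ∃ i j, i < j ∧ ‖L (x (t i)) - L (x (t j))‖ ≤ ε := by
    obtain ⟨Z, hZ, hZL⟩ := hL.image_closedBall_subset_compact (𝕜₁ := ℂ) (f := (L : Y →ₗ[ℂ] Y)) 1
    obtain ⟨w, -, ψ, hψ, hψw⟩ := hZ.tendsto_subseq (x := fun n => L (x (t n)))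
      fun n => hZL ⟨x (t n), by simpa using! (hx1 _).le, rfl⟩
    obtain ⟨N, hN⟩ := Metric.cauchySeq_iff.1 hψw.cauchySeq ε hεpos
    refine ⟨ψ N, ψ (N + 1), hψ N.lt_succ_self, ?_⟩
    rw [← dist_eq_norm]
    exact (hN N le_rfl (N + 1) N.le_succ).le
  set m := t i with hm
  set n := t j with hn
  have hgn : g m ≤ n := by
    rw [hm, hn, ← hsucc]
    exact ht hij
  have hln : l m ≤ n := (le_max_right _ _).trans ((hlg m).trans hgn)
  set u := P (l m) (S (x m)) with hu
  set v := (1 - P (l m)) (S (-x n)) with hv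
  have hxl : P (l m) (x m) = x m := by
    rw [← hxk m, hP.apply_of_ge (hkl m)]
  have hxl' : P (l m) (x n) = 0 := by
    rw [← hP.apply_of_le hln, hxn n, map_zero]
  have e1 : ‖S (x m) - u‖ ≤ ε := by
    have : S (x m) - u = ((1 - P (l m)) * S * P (k m)) (x m) := by
      change _ = (1 - P (l m)) (S (P (k m) (x m)))
      rw [hxk m]
      rfl
    rw [this]
    simpa [hx1] using ContinuousLinearMap.le_of_opNorm_le _ (hl m) (x m)
  have e2 : ‖S (-x n) - v‖ ≤ ε := by
    have hx' : (1 - P (g m)) (x n) = x n := by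
      rw [one_sub_apply, ← hP.apply_of_le hgn, hxn n, map_zero, sub_zero]
    have : S (-x n) - v = ((P (l m) * S * (1 - P (g m))) (-x n)) := by
      change _ = P (l m) (S ((1 - P (g m)) (-x n)))
      rw [map_neg (1 - P (g m)), hx', hv, one_sub_apply, sub_sub_cancel]
    rw [this]
    simpa [hx1] using ContinuousLinearMap.le_of_opNorm_le _ (hg m) (-x n)
  have e3 : c - ε ≤ ‖u‖ := by
    have := norm_sub_norm_le (S (x m)) u
    linarith [hxS m]
  have e4 : c - ε ≤ ‖v‖ := by
    have h1 := norm_sub_norm_le (S (-x n)) v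
    have h2 : ‖S (-x n)‖ = ‖S (x n)‖ := by rw [map_neg, norm_neg]
    linarith [hxS n]
  set d := max (c - ε) 0 with hd
  have hd0 : 0 ≤ d := le_max_right _ _
  have hdu : d ≤ ‖u‖ := max_le e3 (norm_nonneg _)
  have hdv : d ≤ ‖v‖ := max_le e4 (norm_nonneg _)
  set r := ‖x m - x n‖ with hr
  have hr1 : 1 ≤ r := by
    have := hP.norm_apply_le (l m) (x m - x n)
    rwa [map_sub, hxl, hxl', sub_zero, hx1] at this
  have hM' : d * r ≤ ‖u + v‖ := by
    have hdn : ‖(d : ℂ)‖ = d := by rw [Complex.norm_real, Real.norm_of_nonneg hd0]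
    have := hM (l m) (l m) ((d : ℂ) • x m) ((d : ℂ) • (-x n)) u v (by rw [map_smul, hxl])
      (by rw [map_smul, map_neg, hxl', neg_zero, smul_zero]) (hP.apply_of_le le_rfl _)
      (by rw [hv, one_sub_apply, map_sub, hP.apply_of_le le_rfl, sub_self])
      (by rw [norm_smul, hx1, mul_one, hdn]; exact hdu)
      (by rw [norm_smul, norm_neg, hx1, mul_one, hdn]; exact hdv)
    rwa [← smul_add, norm_smul, hdn, ← sub_eq_add_neg] at this
  have hfin : d * r - 3 * ε ≤ ‖S + L‖ * r := by
    refine le_trans ?_ ((S + L).le_opNorm (x m - x n))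
    have hsum : u + v = (S + L) (x m - x n) - (L (x m) - L (x n)) - (S (x m) - u)
        - (S (-x n) - v) := by
      simp only [add_apply, map_sub, map_neg]
      abel
    have h1 := norm_sub_le ((S + L) (x m - x n) - (L (x m) - L (x n)) - (S (x m) - u))
      (S (-x n) - v)
    have h2 := norm_sub_le ((S + L) (x m - x n) - (L (x m) - L (x n))) (S (x m) - u)
    have h3 := norm_sub_le ((S + L) (x m - x n)) (L (x m) - L (x n))
    rw [← hsum] at h1
    linarith
  have hdc : c - ε ≤ d := le_max_left _ _
  have h4 : d - 3 * ε ≤ ‖S + L‖ := by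
    by_contra! hcon
    nlinarith
  rw [hε] at *
  linarith

/-- Small changes of an inverse on the range of a projection `Pₙ` produce perturbations of the
original operator by `P`-compact operators. -/
theorem exists_perturbation (hP : NestedProj P) {A C T : Y →L[ℂ] Y} (hC : C ∈ pAlgebra P)
    (hCA : IsPCompact P (C - A)) (hCT : C * T = 1) (hTC : T * C = 1) {ρ : ℝ} {n : ℕ}
    (h : ‖T * (1 - P n)‖ < ρ) :
    ∃ K S : Y →L[ℂ] Y, IsPCompact P K ∧ (A + K) * S = 1 ∧ S * (A + K) = 1 ∧ ‖S‖ < ρ := by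
  set δ : ℝ := (ρ - ‖T * (1 - P n)‖) / (1 + ‖T‖) with hδ
  have hδ0 : 0 < δ := div_pos (sub_pos.2 h) (by positivity)
  have hδ1 : δ * ‖T‖ < ρ - ‖T * (1 - P n)‖ := by
    have : δ * (1 + ‖T‖) = ρ - ‖T * (1 - P n)‖ := div_mul_cancel₀ _ (by positivity)
    nlinarith
  have hδC : (δ : ℂ) ≠ 0 := by exact_mod_cast hδ0.ne'
  set D : Y →L[ℂ] Y := (1 - P n) + (δ : ℂ) • P n with hD
  set D' : Y →L[ℂ] Y := (1 - P n) + (δ : ℂ)⁻¹ • P n with hD'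
  have q1 := hP.compl_mul_compl (le_refl n)
  have q2 := hP.compl_mul (le_refl n)
  have q3 := hP.mul_compl (le_refl n)
  have q4 := hP.mul_of_le (le_refl n)
  have hDD : D * D' = 1 := by
    rw [hD, hD', add_mul, mul_add, mul_add, q1, mul_smul_comm, q2, smul_mul_assoc, q3,
      smul_mul_smul_comm, q4, mul_inv_cancel₀ hδC]
    simp
  have hDD' : D' * D = 1 := by
    rw [hD, hD', add_mul, mul_add, mul_add, q1, mul_smul_comm, q2, smul_mul_assoc, q3,
      smul_mul_smul_comm, q4, inv_mul_cancel₀ hδC]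
    simp
  have hAK : A + (C - A + ((δ : ℂ)⁻¹ - 1) • (P n * C)) = D' * C := by
    rw [hD', add_mul, sub_mul, one_mul, smul_mul_assoc, sub_smul, one_smul]
    abel
  refine ⟨C - A + ((δ : ℂ)⁻¹ - 1) • (P n * C), T * D,
    hCA.add ((hC _ (hP.isPCompact n)).2.smul _), ?_, ?_, ?_⟩
  · rw [hAK, mul_assoc, ← mul_assoc C T, hCT, one_mul, hDD']
  · rw [hAK, mul_assoc, ← mul_assoc D D', hDD, one_mul, hTC]
  · rw [hD, mul_add, mul_smul_comm]
    refine (norm_add_le _ _).trans_lt ?_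
    rw [norm_smul, Complex.norm_real, Real.norm_of_nonneg hδ0.le]
    have : ‖T * P n‖ ≤ ‖T‖ :=
      (norm_mul_le _ _).trans (mul_le_of_le_one_right (norm_nonneg _) (hP.norm_le n))
    nlinarith

/-- If `A` is bounded below by `c` at infinity, then its inverses up to `P`-compact operators have
norm at most `c⁻¹` at infinity. -/
theorem exists_norm_mul_compl_lt (hP : NestedProj P)
    {A C T : Y →L[ℂ] Y} (hCA : IsPCompact P (C - A))
    (hCT : C * T = 1) (hT : T ∈ pAlgebra P) {c : ℝ} (hc : 0 < c) {m : ℕ}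
    (h : ∀ x, c * ‖(1 - P m) x‖ ≤ ‖A ((1 - P m) x)‖) {ρ : ℝ} (hρ : c⁻¹ < ρ) :
    ∃ n, ‖T * (1 - P n)‖ < ρ := by
  have hlim : Tendsto (fun η : ℝ => (1 + ‖C‖ * η) / (c - η) + η) (𝓝 0) (𝓝 c⁻¹) := by
    have : ContinuousAt (fun η : ℝ => (1 + ‖C‖ * η) / (c - η) + η) 0 := by
      have : c - 0 ≠ 0 := by simpa using hc.ne'
      fun_prop (disch := assumption)
    simpa [ContinuousAt] using this
  obtain ⟨η, ⟨hη1, hη2⟩, hη0⟩ : ∃ η : ℝ, ((1 + ‖C‖ * η) / (c - η) + η < ρ ∧ η < c) ∧ 0 < η := by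
    have h1 := ((hlim.eventually_lt_const hρ).and
      (eventually_lt_nhds hc)).filter_mono
        (nhdsWithin_le_nhds (s := Set.Ioi (0 : ℝ)))
    exact (h1.and self_mem_nhdsWithin).exists
  have hev : ∀ᶠ M in atTop, ‖(C - A) * (1 - P M)‖ < η :=
    (tendsto_zero_iff_norm_tendsto_zero.1 (isPCompact_iff.1 hCA).2).eventually_lt_const hη0
  obtain ⟨M, hM1, hM2⟩ := (hev.and (eventually_ge_atTop m)).exists
  obtain ⟨n, hn⟩ := (hP.eventually_norm_mul_compl_le hT M hη0).exists
  refine ⟨n, lt_of_le_of_lt (ContinuousLinearMap.opNorm_le_bound _ ?_ fun y => ?_) hη1⟩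
  · have : 0 < c - η := by linarith
    positivity
  set x := T ((1 - P n) y) with hx
  set w := (1 - P M) x with hw
  have e1 : ‖P M x‖ ≤ η * ‖y‖ := ContinuousLinearMap.le_of_opNorm_le _ hn y
  have e2 : c * ‖w‖ ≤ ‖A w‖ := by
    have : (1 - P m) w = w :=
      congrArg (fun S : Y →L[ℂ] Y => S x) (hP.compl_mul_compl hM2)
    simpa only [this] using h w
  have e3 : ‖(C - A) w‖ ≤ η * ‖w‖ := by
    have : w = (1 - P M) w :=
      (congrArg (fun S : Y →L[ℂ] Y => S x) (hP.compl_mul_compl (le_refl M))).symm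
    conv_lhs => rw [this]
    exact ContinuousLinearMap.le_of_opNorm_le _ hM1.le w
  have e4 : C x = (1 - P n) y := congrArg (fun S : Y →L[ℂ] Y => S ((1 - P n) y)) hCT
  have e5 : ‖C w‖ ≤ ‖y‖ + ‖C‖ * (η * ‖y‖) := by
    have : C w = (1 - P n) y - C (P M x) := by
      rw [hw, one_sub_apply, map_sub, e4]
    rw [this]
    refine (norm_sub_le _ _).trans (add_le_add (hP.norm_compl_apply_le _ _) ?_)
    exact (C.le_opNorm _).trans (by gcongr)
  have e6 : ‖A w‖ ≤ ‖C w‖ + ‖(C - A) w‖ := by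
    have : A w = C w - (C - A) w := by simp
    rw [this]
    exact norm_sub_le _ _
  have e7 : ‖x‖ ≤ ‖P M x‖ + ‖w‖ := by
    have : x = P M x + w := by simp [hw]
    conv_lhs => rw [this]
    exact norm_add_le _ _
  have e8 : ‖w‖ ≤ (1 + ‖C‖ * η) / (c - η) * ‖y‖ := by
    rw [div_mul_eq_mul_div, le_div_iff₀ (by linarith)]
    nlinarith
  change ‖x‖ ≤ _
  nlinarith

theorem tendsto_muTilde (hP : NestedProj P) (A : Y →L[ℂ] Y) :
    Tendsto (fun m => lowerNorm (restrictTail P A m)) atTop (𝓝 (muTilde P A)) :=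
  EssLowerNorm.tendsto_muTilde P A hP.compl_ne fun m => hP.compl_mul_compl m.le_succ

theorem exists_of_lt_muTilde (hP : NestedProj P) {A : Y →L[ℂ] Y} {c : ℝ} (h : c < muTilde P A) :
    ∃ m, ∀ x, c * ‖(1 - P m) x‖ ≤ ‖A ((1 - P m) x)‖ := by
  obtain ⟨m, hm⟩ := ((hP.tendsto_muTilde A).eventually_const_lt h).exists
  refine ⟨m, fun x => ?_⟩
  have := lowerNorm_mul_norm_le (restrictTail P A m) ⟨(1 - P m) x, x, rfl⟩
  exact (mul_le_mul_of_nonneg_right hm.le (norm_nonneg _)).trans this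

theorem le_muTilde (hP : NestedProj P) {A : Y →L[ℂ] Y} {c : ℝ} {m : ℕ}
    (h : ∀ x, c * ‖(1 - P m) x‖ ≤ ‖A ((1 - P m) x)‖) : c ≤ muTilde P A := by
  refine ge_of_tendsto (hP.tendsto_muTilde A) ?_
  filter_upwards [eventually_ge_atTop m] with n hn
  have : Nontrivial (1 - P n : Y →L[ℂ] Y).range := by
    obtain ⟨y, hy⟩ : ∃ y, (1 - P n : Y →L[ℂ] Y) y ≠ 0 := by
      by_contra! h
      exact hP.compl_ne n (ContinuousLinearMap.ext h)
    exact ⟨⟨⟨_, y, rfl⟩, 0, fun h => hy (congrArg Subtype.val h)⟩⟩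
  refine le_lowerNorm ?_
  rintro ⟨_, x, rfl⟩
  have hx := h ((1 - P n) x)
  have : (1 - P m) ((1 - P n) x) = (1 - P n) x :=
    congrArg (fun S : Y →L[ℂ] Y => S x) (hP.compl_mul_compl hn)
  rw [this] at hx
  exact hx

theorem muTilde_nonneg (hP : NestedProj P) (A : Y →L[ℂ] Y) : 0 ≤ muTilde P A :=
  hP.le_muTilde (m := 0) fun x => by simp

theorem le_muTilde_of_isPCompact (hP : NestedProj P) {A K : Y →L[ℂ] Y} (hK : IsPCompact P K) {c : ℝ}
    (h : ∀ x, c * ‖x‖ ≤ ‖A x‖ + ‖K x‖) : c ≤ muTilde P A := by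
  refine le_of_forall_pos_le_add fun ε hε => ?_
  obtain ⟨m, hm⟩ := ((tendsto_zero_iff_norm_tendsto_zero.1
    (isPCompact_iff.1 hK).2).eventually_lt_const hε).exists
  rw [← sub_le_iff_le_add]
  refine hP.le_muTilde (m := m) fun x => ?_
  have e : ‖K ((1 - P m) x)‖ ≤ ε * ‖(1 - P m) x‖ := by
    have : (1 - P m) x = (1 - P m) ((1 - P m) x) :=
      (congrArg (fun S : Y →L[ℂ] Y => S x) (hP.compl_mul_compl (le_refl m))).symm
    conv_lhs => rw [this]
    exact ContinuousLinearMap.le_of_opNorm_le _ hm.le _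
  rw [sub_mul]
  linarith [h ((1 - P m) x)]

theorem lowerNorm_add_le_muTilde (hP : NestedProj P) {A K : Y →L[ℂ] Y} (hK : IsPCompact P K) :
    lowerNorm (A + K) ≤ muTilde P A :=
  hP.le_muTilde_of_isPCompact hK fun x =>
    (lowerNorm_mul_norm_le (A + K) x).trans (norm_add_le _ _)

theorem nontrivial (hP : NestedProj P) : Nontrivial Y := by
  by_contra h
  rw [not_nontrivial_iff_subsingleton] at h
  exact hP.compl_ne 0 (Subsingleton.elim _ _)

theorem iInf_norm_compl_eq (hP : NestedProj P) {T : Y →L[ℂ] Y} (hT : T ∈ pAlgebra P) :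
    ⨅ n, ‖(1 - P n) * T‖ = ⨅ n, ‖T * (1 - P n)‖ := by
  have bdd : ∀ f : ℕ → Y →L[ℂ] Y, BddBelow (Set.range fun n => ‖f n‖) :=
    fun f => ⟨0, by rintro _ ⟨n, rfl⟩; exact norm_nonneg _⟩
  have one_left : ∀ m n (S : Y →L[ℂ] Y), ‖(1 - P m) * S * (1 - P n)‖ ≤ ‖(1 - P m) * S‖ :=
    fun m n S => (norm_mul_le _ _).trans
      (mul_le_of_le_one_right (norm_nonneg _) (hP.norm_compl_le n))
  have one_right : ∀ m n (S : Y →L[ℂ] Y), ‖(1 - P m) * S * (1 - P n)‖ ≤ ‖S * (1 - P n)‖ :=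
    fun m n S => by
      rw [mul_assoc]
      exact (norm_mul_le _ _).trans (mul_le_of_le_one_left (norm_nonneg _) (hP.norm_compl_le m))
  apply le_antisymm
  · refine le_ciInf fun m => le_of_forall_pos_le_add fun ε hε => ?_
    obtain ⟨n, hn⟩ := (hP.eventually_norm_compl_mul_le hT m hε).exists
    refine (ciInf_le (bdd _) n).trans ?_
    have : (1 - P n) * T = (1 - P n) * T * (1 - P m) + (1 - P n) * T * P m := by noncomm_ring
    rw [this]
    exact (norm_add_le _ _).trans (add_le_add (one_right _ _ _) hn)
  · refine le_ciInf fun m => le_of_forall_pos_le_add fun ε hε => ?_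
    obtain ⟨n, hn⟩ := (hP.eventually_norm_mul_compl_le hT m hε).exists
    refine (ciInf_le (bdd _) n).trans ?_
    have : T * (1 - P n) = (1 - P m) * T * (1 - P n) + P m * T * (1 - P n) := by noncomm_ring
    rw [this]
    exact (norm_add_le _ _).trans (add_le_add (one_left _ _ _) hn)

/-- All essential lower norms of a `P`-compact perturbation `A` of an invertible operator `C` agree
with the reciprocal of the norm of `C⁻¹` at infinity. -/
theorem essential_lowerNorms_eq (hP : NestedProj P)
    [CompleteSpace Y] (hM : MonotoneNorm P) {A C T : Y →L[ℂ] Y}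
    (hC : C ∈ pAlgebra P) (hT : T ∈ pAlgebra P) (hCA : IsPCompact P (C - A)) (hCT : C * T = 1)
    (hTC : T * C = 1) (hS : ∀ n c, (∀ k, ‖T * (1 - P n) * P k‖ ≤ c) → ‖T * (1 - P n)‖ ≤ c) :
    0 < (⨅ n, ‖T * (1 - P n)‖)⁻¹ ∧ essLowerNorm A = (⨅ n, ‖T * (1 - P n)‖)⁻¹ ∧
      pEssLowerNorm P A = (⨅ n, ‖T * (1 - P n)‖)⁻¹ ∧
      muTilde P A = (⨅ n, ‖T * (1 - P n)‖)⁻¹ := by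
  have := hP.nontrivial
  set τ := ⨅ n, ‖T * (1 - P n)‖ with hτ
  have bdd : BddBelow (Set.range fun n => ‖T * (1 - P n)‖) :=
    ⟨0, by rintro _ ⟨n, rfl⟩; exact norm_nonneg _⟩
  have hτpos : 0 < τ := by
    have h1 : ∀ n, (1 + ‖C‖)⁻¹ ≤ ‖T * (1 - P n)‖ := fun n => by
      rw [inv_le_iff_one_le_mul₀ (by positivity)]
      calc 1 ≤ ‖1 - P n‖ := hP.one_le_norm_compl n
        _ = ‖C * (T * (1 - P n))‖ := by rw [← mul_assoc, hCT, one_mul]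
        _ ≤ ‖C‖ * ‖T * (1 - P n)‖ := norm_mul_le _ _
        _ ≤ ‖T * (1 - P n)‖ * (1 + ‖C‖) := by nlinarith [norm_nonneg (T * (1 - P n))]
    exact lt_of_lt_of_le (by positivity) (le_ciInf h1)
  have upper : ∀ K : Y →L[ℂ] Y, IsCompactOperator K → lowerNorm (A + K) ≤ τ⁻¹ := by
    intro K hK
    rcases (lowerNorm_nonneg (A + K)).eq_or_lt with h0 | hpos
    · rw [← h0]
      exact inv_nonneg.2 hτpos.le
    have hK' : IsCompactOperator (K - (C - A) : Y →L[ℂ] Y) :=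
      hK.sub (hP.isCompactOperator_of_isPCompact hCA)
    have hAK : A + K = C + (K - (C - A)) := by abel
    have hunit : IsUnit (A + K) := by
      rw [hAK]
      refine isUnit_of_injective_add_compact ⟨⟨C, T, hCT, hTC⟩, rfl⟩ hK' ?_
      rw [← hAK]
      exact injective_of_lowerNorm_pos hpos
    obtain ⟨U, hU⟩ := hunit
    set T' : Y →L[ℂ] Y := (↑U⁻¹ : Y →L[ℂ] Y) with hT'
    have h1 : (A + K) * T' = 1 := by rw [← hU, hT', Units.mul_inv]
    have h2 : T' * (A + K) = 1 := by rw [← hU, hT', Units.inv_mul]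
    have h3 : T' = T + (-(T' * (K - (C - A)) * T)) := by
      have : T' * (K - (C - A)) * T = T' * (A + K) * T - T' * (C * T) := by noncomm_ring
      rw [this, h2, hCT]
      simp
    have hcomp : IsCompactOperator (-(T' * (K - (C - A)) * T) : Y →L[ℂ] Y) :=
      ((hK'.clm_comp T').comp_clm T).neg
    have h4 := norm_mul_lowerNorm_le_one h1 hpos
    rw [le_inv_comm₀ hpos hτpos]
    refine le_trans (le_of_forall_lt fun c hc => ?_) h4
    obtain ⟨c', hc1, hc2⟩ := exists_between hc
    refine lt_of_lt_of_le hc1 ?_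
    rw [h3]
    exact hP.le_norm_add_compact hM hT hS hcomp fun n => hc2.trans_le (ciInf_le bdd n)
  have lower : ∀ c < τ⁻¹, ∃ K, IsPCompact P K ∧ c < lowerNorm (A + K) := by
    intro c hc
    rcases le_or_gt c 0 with hc0 | hc0
    · obtain ⟨K, S, hK, h1, h2, h3⟩ := hP.exists_perturbation hC hCA hCT hTC
        (n := 0) (lt_add_one _)
      refine ⟨K, hK, lt_of_le_of_lt hc0 (lt_of_lt_of_le ?_ (inv_norm_le_lowerNorm h2))⟩
      rw [inv_pos, norm_pos_iff]
      rintro rfl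
      simp at h2
    · have hlt : τ < c⁻¹ := (lt_inv_comm₀ hc0 hτpos).1 hc
      obtain ⟨n, hn⟩ := exists_lt_of_ciInf_lt hlt
      obtain ⟨K, S, hK, h1, h2, h3⟩ := hP.exists_perturbation hC hCA hCT hTC hn
      refine ⟨K, hK, lt_of_lt_of_le ?_ (inv_norm_le_lowerNorm h2)⟩
      have hS0 : 0 < ‖S‖ := by
        rw [norm_pos_iff]
        rintro rfl
        simp at h2
      exact (lt_inv_comm₀ hS0 hc0).1 h3
  have pc : ∀ K, IsPCompact P K → IsCompactOperator K :=
    fun K hK => hP.isCompactOperator_of_isPCompact hK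
  have b1 : BddAbove {r : ℝ | ∃ K : Y →L[ℂ] Y, IsCompactOperator K ∧ lowerNorm (A + K) = r} :=
    ⟨τ⁻¹, by rintro _ ⟨K, hK, rfl⟩; exact upper K hK⟩
  have b2 : BddAbove {r : ℝ | ∃ K : Y →L[ℂ] Y, IsPCompact P K ∧ lowerNorm (A + K) = r} :=
    ⟨τ⁻¹, by rintro _ ⟨K, hK, rfl⟩; exact upper K (pc K hK)⟩
  refine ⟨inv_pos.2 hτpos, le_antisymm ?_ ?_, le_antisymm ?_ ?_, le_antisymm ?_ ?_⟩
  · refine csSup_le ⟨_, 0, isCompactOperator_zero, rfl⟩ ?_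
    rintro _ ⟨K, hK, rfl⟩
    exact upper K hK
  · refine le_of_forall_lt fun c hc => ?_
    obtain ⟨K, hK, hlt⟩ := lower c hc
    exact hlt.trans_le (le_csSup b1 ⟨K, pc K hK, rfl⟩)
  · refine csSup_le ⟨_, 0, IsPCompact.zero P, rfl⟩ ?_
    rintro _ ⟨K, hK, rfl⟩
    exact upper K (pc K hK)
  · refine le_of_forall_lt fun c hc => ?_
    obtain ⟨K, hK, hlt⟩ := lower c hc
    exact hlt.trans_le (le_csSup b2 ⟨K, hK, rfl⟩)
  · refine le_of_forall_lt fun c hc => ?_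
    rcases lt_or_ge c 0 with hneg | hc0
    · exact hneg.trans (inv_pos.2 hτpos)
    obtain ⟨c₁, hc₁, hc₁'⟩ := exists_between hc
    have hc₁0 : 0 < c₁ := hc0.trans_lt hc₁
    obtain ⟨m, hm⟩ := hP.exists_of_lt_muTilde hc₁'
    refine lt_of_lt_of_le hc₁ ?_
    rw [le_inv_comm₀ hc₁0 hτpos]
    refine le_of_forall_gt fun ρ hρ => ?_
    obtain ⟨n, hn⟩ := hP.exists_norm_mul_compl_lt hCA hCT hT hc₁0 hm hρ
    exact (ciInf_le bdd n).trans_lt hn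
  · refine le_of_forall_lt fun c hc => ?_
    obtain ⟨K, hK, hlt⟩ := lower c hc
    exact hlt.trans_le (hP.lowerNorm_add_le_muTilde hK)

end NestedProj

end ProjectionSequences

section DualConstructions

variable {Y : Type*} [NormedAddCommGroup Y] [NormedSpace ℂ Y] {P : ℕ → Y →L[ℂ] Y}

theorem tendsto_zero_of_norm_le {Z : Type*} [NormedAddCommGroup Z] [NormedSpace ℂ Z]
    {u : ℕ → Y →L[ℂ] Y} {v : ℕ → Z →L[ℂ] Z} (h : Tendsto u atTop (𝓝 0))
    (hv : ∀ n, ‖v n‖ ≤ ‖u n‖) : Tendsto v atTop (𝓝 0) :=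
  squeeze_zero_norm hv (tendsto_zero_iff_norm_tendsto_zero.1 h)

theorem tendsto_dualOp {u : ℕ → Y →L[ℂ] Y} (h : Tendsto u atTop (𝓝 0)) :
    Tendsto (fun n => dualOp (u n)) atTop (𝓝 0)  :=
  tendsto_zero_of_norm_le h fun n => (norm_dualOp (u n)).le

theorem IsPCompact.dual {K : Y →L[ℂ] Y} (hK : IsPCompact P K) :
    IsPCompact (dualProj P) (dualOp K) := by
  obtain ⟨h1, h2⟩ := isPCompact_iff.1 hK
  refine isPCompact_iff.2 ⟨(tendsto_dualOp h2).congr fun n => ?_,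
    (tendsto_dualOp h1).congr fun n => ?_⟩
  · rw [one_sub_dualProj, dualOp_mul]
  · rw [one_sub_dualProj, dualOp_mul]

theorem exists_eq_finRankOp {T : Y →L[ℂ] Y} [FiniteDimensional ℂ T.range] :
    ∃ (n : ℕ) (φ : Fin n → StrongDual ℂ Y) (y : Fin n → Y), T = finRankOp φ y := by
  let π : Y →L[ℂ] T.range := T.codRestrict T.range fun x => ⟨x, rfl⟩
  let e := Module.finBasis ℂ T.range
  refine ⟨_, fun i => (LinearMap.toContinuousLinearMap (e.coord i)) ∘L π, fun i => (e i : Y), ?_⟩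
  ext x
  have h := congrArg Subtype.val (e.sum_repr (π x))
  rw [Submodule.coe_sum] at h
  rw [finRankOp_apply]
  exact h.symm

theorem isCompactOperator_of_finiteDimensional_range {T : Y →L[ℂ] Y}
    [FiniteDimensional ℂ T.range] : IsCompactOperator T := by
  obtain ⟨n, φ, y, hT⟩ := exists_eq_finRankOp (T := T)
  rw [hT]
  exact isCompactOperator_finRankOp _ _

theorem isCompactOperator_dualOp_of_finiteDimensional_range {T : Y →L[ℂ] Y}
    [FiniteDimensional ℂ T.range] : IsCompactOperator (dualOp T) := by
  obtain ⟨n, φ, y, hT⟩ := exists_eq_finRankOp (T := T)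
  rw [hT, dualOp_finRankOp]
  exact isCompactOperator_finRankOp _ _

theorem NestedProj.dual (hP : NestedProj P) (hfin : ∀ n, FiniteDimensional ℂ (P n).range) :
    NestedProj (dualProj P) where
  mul m n := by
    simp only [dualProj]
    rw [← dualOp_mul, hP.mul, min_comm]
  norm_le n := (norm_dualOp (P n)).trans_le (hP.norm_le n)
  norm_compl_le n := by
    rw [one_sub_dualProj, norm_dualOp]
    exact hP.norm_compl_le n
  compact n := by
    have := hfin n
    exact isCompactOperator_dualOp_of_finiteDimensional_range
  compl_ne n := by
    rw [one_sub_dualProj, ← norm_ne_zero_iff, norm_dualOp, norm_ne_zero_iff]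
    exact hP.compl_ne n

theorem NestedProj.dualOp_mem_pAlgebra (hP : NestedProj P)
    (hfin : ∀ n, FiniteDimensional ℂ (P n).range) {A : Y →L[ℂ] Y} (hA : A ∈ pAlgebra P) :
    dualOp A ∈ pAlgebra (dualProj P) := by
  refine (hP.dual hfin).mem_pAlgebra_iff.2 fun k => ?_
  obtain ⟨h1, h2⟩ := hP.mem_pAlgebra_iff.1 hA k
  refine ⟨(tendsto_dualOp h2).congr fun n => ?_, (tendsto_dualOp h1).congr fun n => ?_⟩
  · rw [one_sub_dualProj]
    rfl
  · rw [one_sub_dualProj]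
    rfl

theorem MonotoneNorm.dual (hP : NestedProj P) (hM : MonotoneNorm P) :
    MonotoneNorm (dualProj P) := by
  intro m n f₁ f₂ g₁ g₂ hf₁ hf₂ hg₁ hg₂ h₁ h₂
  have a1 : ∀ x, f₁ (P m x) = f₁ x := fun x => DFunLike.congr_fun hf₁ x
  have a2 : ∀ x, f₂ (P m x) = 0 := fun x => DFunLike.congr_fun hf₂ x
  have b1 : ∀ x, g₁ (P n x) = g₁ x := fun x => DFunLike.congr_fun hg₁ x
  have b2 : ∀ x, g₂ (P n x) = 0 := fun x => DFunLike.congr_fun hg₂ x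
  have norming : ∀ (g : StrongDual ℂ Y) (a : ℝ), 0 ≤ a → ∀ ε > 0,
      ∃ y : Y, ‖y‖ ≤ a ∧ ‖g‖ * a ≤ ‖g y‖ + ε ∧ g y = (‖g y‖ : ℂ) := by
    intro g a ha ε hε
    rcases ha.eq_or_lt with rfl | ha
    · exact ⟨0, by simp, by simpa using hε.le, by simp⟩
    have hlt : ‖g‖ - ε / a < ‖g‖ := by
      have : 0 < ε / a := by positivity
      linarith
    obtain ⟨z, hz1, hz2⟩ := g.exists_lt_apply_of_lt_opNorm hlt
    obtain ⟨c, hc1, hc2⟩ := RCLike.exists_norm_eq_mul_self (g z)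
    have hgy : g (((a : ℂ) * c) • z) = ((a * ‖g z‖ : ℝ) : ℂ) := by
      rw [map_smul, smul_eq_mul, mul_assoc, ← hc2, Complex.ofReal_mul]
      rfl
    have hgn : ‖g (((a : ℂ) * c) • z)‖ = a * ‖g z‖ := by
      rw [hgy, Complex.norm_real, Real.norm_of_nonneg (by positivity)]
    refine ⟨((a : ℂ) * c) • z, ?_, ?_, ?_⟩
    · rw [norm_smul, norm_mul, hc1, Complex.norm_real, Real.norm_of_nonneg ha.le, mul_one]
      exact mul_le_of_le_one_right ha.le hz1.le
    · rw [hgn]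
      have : (‖g‖ - ε / a) * a ≤ ‖g z‖ * a := mul_le_mul_of_nonneg_right hz2.le ha.le
      rw [sub_mul, div_mul_cancel₀ _ ha.ne'] at this
      linarith
    · rw [hgn, hgy]
  refine ContinuousLinearMap.opNorm_le_bound _ (norm_nonneg _) fun x => ?_
  refine le_of_forall_pos_le_add fun ε hε => ?_
  obtain ⟨y₁, hy₁, hy₁', hy₁''⟩ := norming g₁ ‖P m x‖ (norm_nonneg _) (ε / 2) (by positivity)
  obtain ⟨y₂, hy₂, hy₂', hy₂''⟩ := norming g₂ ‖(1 - P m) x‖ (norm_nonneg _) (ε / 2) (by positivity)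
  have hz : ‖P n y₁ + (1 - P n) y₂‖ ≤ ‖x‖ := by
    have := hM n m (P n y₁) ((1 - P n) y₂) (P m x) ((1 - P m) x) (hP.apply_of_le le_rfl _)
      (by rw [one_sub_apply, map_sub, hP.apply_of_le le_rfl, sub_self])
      (hP.apply_of_le le_rfl _)
      (by rw [one_sub_apply, map_sub, hP.apply_of_le le_rfl, sub_self])
      ((hP.norm_apply_le _ _).trans hy₁) ((hP.norm_compl_apply_le _ _).trans hy₂)
    simpa [one_sub_apply] using this
  have hval : (g₁ + g₂) (P n y₁ + (1 - P n) y₂) = ((‖g₁ y₁‖ + ‖g₂ y₂‖ : ℝ) : ℂ) := by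
    rw [Complex.ofReal_add, ← hy₁'', ← hy₂'']
    simp [b1, b2]
  have h3 : ‖g₁ y₁‖ + ‖g₂ y₂‖ ≤ ‖g₁ + g₂‖ * ‖x‖ := by
    have h4 := ((g₁ + g₂).le_opNorm (P n y₁ + (1 - P n) y₂)).trans
      (mul_le_mul_of_nonneg_left hz (norm_nonneg _))
    rwa [hval, Complex.norm_real, Real.norm_of_nonneg (by positivity)] at h4
  have h5 : (f₁ + f₂) x = f₁ (P m x) + f₂ ((1 - P m) x) := by
    simp [a1, a2]
  rw [h5]
  have h6 : ‖f₁ (P m x)‖ ≤ ‖g₁‖ * ‖P m x‖ := (f₁.le_opNorm _).trans (by gcongr)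
  have h7 : ‖f₂ ((1 - P m) x)‖ ≤ ‖g₂‖ * ‖(1 - P m) x‖ := (f₂.le_opNorm _).trans (by gcongr)
  linarith [norm_add_le (f₁ (P m x)) (f₂ ((1 - P m) x))]

end DualConstructions

section Symm

variable {Y : Type*} [NormedAddCommGroup Y] [NormedSpace ℂ Y] {P : ℕ → Y →L[ℂ] Y}

theorem symmOp_apply (A : Y →L[ℂ] Y) (z : SymmSpace Y) : symmOp A z = (A z.1, dualOp A z.2) := rfl

theorem prodMap_mul_prodMap (A B : Y →L[ℂ] Y) (D E : StrongDual ℂ Y →L[ℂ] StrongDual ℂ Y) :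
    A.prodMap D * B.prodMap E = (A * B).prodMap (D * E) := rfl

theorem NestedProj.symm (hP : NestedProj P) (hfin : ∀ n, FiniteDimensional ℂ (P n).range) :
    NestedProj (symmProj P) where
  mul m n := by
    have h := (hP.dual hfin).mul m n
    simp only [symmProj, symmOp, prodMap_mul_prodMap, hP.mul]
    simp only [dualProj] at h
    rw [h]
  norm_le n := (norm_symmOp_le _).trans (hP.norm_le n)
  norm_compl_le n := by
    rw [one_sub_symmProj]
    exact (norm_symmOp_le _).trans (hP.norm_compl_le n)
  compact n := by
    have h1 : IsCompactOperator (ContinuousLinearMap.inl ℂ Y (StrongDual ℂ Y) ∘ (P n) ∘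
        ContinuousLinearMap.fst ℂ Y (StrongDual ℂ Y)) := ((hP.compact n).comp_clm _).clm_comp _
    have h2 : IsCompactOperator (ContinuousLinearMap.inr ℂ Y (StrongDual ℂ Y) ∘
        (dualProj P n) ∘ ContinuousLinearMap.snd ℂ Y (StrongDual ℂ Y)) :=
      (((hP.dual hfin).compact n).comp_clm _).clm_comp _
    have h3 := h1.add h2
    refine (congrArg IsCompactOperator (funext fun z => ?_)).mp h3
    change (P n z.1, 0) + (0, dualProj P n z.2) = symmProj P n z
    rw [Prod.mk_add_mk, add_zero, zero_add]
    rfl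
  compl_ne n h := by
    rw [one_sub_symmProj] at h
    refine hP.compl_ne n (ContinuousLinearMap.ext fun x => ?_)
    exact congrArg (fun T : SymmSpace Y →L[ℂ] SymmSpace Y => (T (x, 0)).1) h

theorem QuasiCommutes.symm {A : Y →L[ℂ] Y} (hA : QuasiCommutes P A) :
    QuasiCommutes (symmProj P) (symmOp A) := by
  intro m ε hε
  obtain ⟨F, n, e1, e2, e3, e4, e5⟩ := hA m ε hε
  refine ⟨symmOp F, n, ?_, ?_, ?_, ?_, ?_⟩
  · simp only [symmProj, symmOp, prodMap_mul_prodMap, ← dualOp_mul, e1, e2]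
  · simp only [symmProj, symmOp, prodMap_mul_prodMap, ← dualOp_mul, e1, e2]
  · simp only [symmProj, symmOp, prodMap_mul_prodMap, ← dualOp_mul, e3, e4]
  · simp only [symmProj, symmOp, prodMap_mul_prodMap, ← dualOp_mul, e3, e4]
  · have : symmOp A * symmOp F - symmOp F * symmOp A =
        (A * F - F * A).prodMap (dualOp (F * A - A * F)) := by
      ext z <;> simp [symmOp_apply]
    rw [this]
    refine norm_prodMap_le _ _ e5 ?_
    rw [norm_dualOp, norm_sub_rev]
    exact e5

/-- The upper left corner of an operator on `Y ⊕ Y*`. -/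
def corner (T : SymmSpace Y →L[ℂ] SymmSpace Y) : Y →L[ℂ] Y :=
  .fst ℂ Y (StrongDual ℂ Y) ∘L T ∘L .inl ℂ Y (StrongDual ℂ Y)

theorem corner_apply (T : SymmSpace Y →L[ℂ] SymmSpace Y) (x : Y) : corner T x = (T (x, 0)).1 := rfl

@[simp] theorem corner_one : corner (1 : SymmSpace Y →L[ℂ] SymmSpace Y) = 1 := rfl

theorem corner_sub (S T : SymmSpace Y →L[ℂ] SymmSpace Y) :
    corner (S - T) = corner S - corner T := rfl

theorem symmOp_mul_corner (A : Y →L[ℂ] Y) (T : SymmSpace Y →L[ℂ] SymmSpace Y) :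
    corner (symmOp A * T) = A * corner T := rfl

theorem corner_mul_symmOp (A : Y →L[ℂ] Y) (T : SymmSpace Y →L[ℂ] SymmSpace Y) :
    corner (T * symmOp A) = corner T * A := by
  ext x
  simp [corner_apply, symmOp_apply]

theorem norm_corner_le (T : SymmSpace Y →L[ℂ] SymmSpace Y) : ‖corner T‖ ≤ ‖T‖ := by
  refine ContinuousLinearMap.opNorm_le_bound _ (norm_nonneg T) fun x => ?_
  rw [corner_apply]
  refine (norm_fst_le _).trans ((T.le_opNorm _).trans_eq ?_)
  simp [Prod.norm_def]

theorem tendsto_corner {u : ℕ → SymmSpace Y →L[ℂ] SymmSpace Y} (h : Tendsto u atTop (𝓝 0)) :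
    Tendsto (fun n => corner (u n)) atTop (𝓝 0) :=
  tendsto_zero_of_norm_le (Y := SymmSpace Y) h fun n => norm_corner_le (u n)

theorem isCompactOperator_corner {T : SymmSpace Y →L[ℂ] SymmSpace Y} (h : IsCompactOperator T) :
    IsCompactOperator (corner T) :=
  (h.comp_clm (ContinuousLinearMap.inl ℂ Y (StrongDual ℂ Y))).clm_comp
    (ContinuousLinearMap.fst ℂ Y (StrongDual ℂ Y))

theorem IsPCompact.corner {K : SymmSpace Y →L[ℂ] SymmSpace Y} (hK : IsPCompact (symmProj P) K) :
    IsPCompact P (corner K) := by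
  obtain ⟨h1, h2⟩ := isPCompact_iff.1 hK
  refine isPCompact_iff.2 ⟨(tendsto_corner h1).congr fun n => ?_,
    (tendsto_corner h2).congr fun n => ?_⟩
  · rw [one_sub_symmProj, symmOp_mul_corner]
  · rw [one_sub_symmProj, corner_mul_symmOp]

theorem NestedProj.corner_mem_pAlgebra (hP : NestedProj P)
    (hfin : ∀ n, FiniteDimensional ℂ (P n).range) {T : SymmSpace Y →L[ℂ] SymmSpace Y}
    (hT : T ∈ pAlgebra (symmProj P)) : corner T ∈ pAlgebra P := by
  refine hP.mem_pAlgebra_iff.2 fun k => ?_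
  obtain ⟨h1, h2⟩ := (hP.symm hfin).mem_pAlgebra_iff.1 hT k
  refine ⟨(tendsto_corner h1).congr fun n => ?_, (tendsto_corner h2).congr fun n => ?_⟩
  · rw [one_sub_symmProj, corner_mul_symmOp, symmProj, symmOp_mul_corner]
  · rw [one_sub_symmProj, symmProj, corner_mul_symmOp, symmOp_mul_corner]

end Symm

namespace FredholmData

variable {Y : Type*} [NormedAddCommGroup Y] [NormedSpace ℂ Y] {A : Y →L[ℂ] Y}

theorem mul_eq_one {a : ℕ} (D : FredholmData A a a) :
    (A + finRankOp D.φ D.y) * (D.R + finRankOp D.f D.x) = 1 := by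
  ext u
  simp [D.map_R, D.φ_R, D.φ_x, D.map_x]

theorem mul_eq_one' {a : ℕ} (D : FredholmData A a a) :
    (D.R + finRankOp D.f D.x) * (A + finRankOp D.φ D.y) = 1 := by
  ext u
  simp [D.R_map, D.R_y, D.f_y, D.f_map]

variable {a b : ℕ}

/-- The off-diagonal finite rank operator on `Y ⊕ Y*` that makes `A ⊕ A*` invertible. -/
def offDiag (y : Fin b → Y) (φ : Fin a → StrongDual ℂ Y) : SymmSpace Y →L[ℂ] SymmSpace Y :=
  ((∑ j, (NormedSpace.inclusionInDoubleDual ℂ Y (y j)).smulRight (y j)) ∘L .snd ℂ _ _).prod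
    ((∑ i, (φ i).smulRight (φ i)) ∘L .fst ℂ _ _)

theorem offDiag_apply (y : Fin b → Y) (φ : Fin a → StrongDual ℂ Y) (z : SymmSpace Y) :
    offDiag y φ z = (∑ j, z.2 (y j) • y j, ∑ i, φ i z.1 • φ i) := by
  ext <;> simp [offDiag]

theorem symmOp_add_offDiag_apply (y : Fin b → Y) (φ : Fin a → StrongDual ℂ Y) (z : SymmSpace Y) :
    (symmOp A + offDiag y φ) z =
      (A z.1 + ∑ j, z.2 (y j) • y j, dualOp A z.2 + ∑ i, φ i z.1 • φ i) := by
  rw [add_apply, symmOp_apply, offDiag_apply, Prod.mk_add_mk]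

theorem symmOp_add_offDiag_mul (D : FredholmData A a b) :
    (symmOp A + offDiag D.y D.φ) * (symmOp D.R + offDiag D.x D.f) = 1 := by
  refine ContinuousLinearMap.ext fun z => ?_
  change (symmOp A + offDiag D.y D.φ) ((symmOp D.R + offDiag D.x D.f) z) = z
  rw [symmOp_add_offDiag_apply, symmOp_add_offDiag_apply]
  refine Prod.ext ?_ (ContinuousLinearMap.ext fun u => ?_)
  · simp [D.map_R, D.map_x, D.R_y, D.f_y]
  · simp [D.R_map, D.φ_R, D.φ_x, D.f_map, mul_comm]

theorem mul_symmOp_add_offDiag (D : FredholmData A a b) :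
    (symmOp D.R + offDiag D.x D.f) * (symmOp A + offDiag D.y D.φ) = 1 := by
  refine ContinuousLinearMap.ext fun z => ?_
  change (symmOp D.R + offDiag D.x D.f) ((symmOp A + offDiag D.y D.φ) z) = z
  rw [symmOp_add_offDiag_apply, symmOp_add_offDiag_apply]
  refine Prod.ext ?_ (ContinuousLinearMap.ext fun u => ?_)
  · simp [D.R_map, D.R_y, D.map_x, D.φ_x]
  · simp [D.map_R, D.f_map, D.f_y, D.φ_R, mul_comm]

end FredholmData

section Semifredholm

variable {Y : Type*} [NormedAddCommGroup Y] [NormedSpace ℂ Y] [CompleteSpace Y]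

theorem isFredholm_of_bounded_below {W W' : Type*} [NormedAddCommGroup W] [NormedSpace ℂ W]
    [NormedAddCommGroup W'] [NormedSpace ℂ W'] {A : Y →L[ℂ] Y} {K : Y →L[ℂ] W}
    {L : StrongDual ℂ Y →L[ℂ] W'} (hK : IsCompactOperator K) (hL : IsCompactOperator L) {c : ℝ}
    (hc : 0 < c) (h : ∀ x, c * ‖x‖ ≤ ‖A x‖ + ‖K x‖) (h' : ∀ f, c * ‖f‖ ≤ ‖dualOp A f‖ + ‖L f‖) :
    A.IsFredholm := by
  have hr := isClosed_range_of_compact hK hc h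
  have : FiniteDimensional ℂ (dualOp A).ker := finiteDimensional_ker_of_compact hL hc h'
  exact isFredholm_of_finiteDimensional (finiteDimensional_ker_of_compact hK hc h) hr
    (finiteDimensional_coker_of_ker_dualOp hr)

theorem fredholm_index_zero_of_essLowerNorm_pos {A : Y →L[ℂ] Y} (h : 0 < essLowerNorm A)
    (h' : 0 < essLowerNorm (dualOp A)) : A.IsFredholm ∧ fredholmIndex A = 0 := by
  obtain ⟨_, ⟨K, hK, rfl⟩, hpos⟩ := exists_lt_of_lt_csSup (⟨_, 0, isCompactOperator_zero, rfl⟩ :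
    {r : ℝ | ∃ K : Y →L[ℂ] Y, IsCompactOperator K ∧ lowerNorm (A + K) = r}.Nonempty) h
  obtain ⟨_, ⟨L, hL, rfl⟩, hpos'⟩ := exists_lt_of_lt_csSup (⟨_, 0, isCompactOperator_zero, rfl⟩ :
    {r : ℝ | ∃ K : StrongDual ℂ Y →L[ℂ] StrongDual ℂ Y,
      IsCompactOperator K ∧ lowerNorm (dualOp A + K) = r}.Nonempty) h'
  have hA : A.IsFredholm := by
    refine isFredholm_of_bounded_below hK hL (lt_min hpos hpos') (fun x => ?_) fun f => ?_
    · exact (mul_le_mul_of_nonneg_right (min_le_left _ _) (norm_nonneg _)).trans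
        ((lowerNorm_mul_norm_le (A + K) x).trans (norm_add_le _ _))
    · exact (mul_le_mul_of_nonneg_right (min_le_right _ _) (norm_nonneg _)).trans
        ((lowerNorm_mul_norm_le (dualOp A + L) f).trans (norm_add_le _ _))
  refine ⟨hA, ?_⟩
  obtain ⟨D, -, -⟩ := exists_fredholmData hA ⊤
    (fun x _ hx => SeparatingDual.eq_zero_of_forall_dual_eq_zero (R := ℂ) fun φ => hx φ trivial) ⊤
    (fun f _ hf => ContinuousLinearMap.ext fun w => hf w trivial)
  have h1 := D.le_of_injective_add_compact hK (injective_of_lowerNorm_pos hpos)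
  have h2 := D.dual.le_of_injective_add_compact hL (injective_of_lowerNorm_pos hpos')
  rw [fredholmIndex, le_antisymm h1 h2, sub_self]

theorem exists_inverse_of_lowerNorm_pos {S K K₀ T₀ : Y →L[ℂ] Y} (hK₀ : IsCompactOperator K₀)
    (h1 : (S + K₀) * T₀ = 1) (h2 : T₀ * (S + K₀) = 1) (hK : IsCompactOperator K)
    (hpos : 0 < lowerNorm (S + K)) : ∃ U : Y →L[ℂ] Y, (S + K) * U = 1 ∧ U * (S + K) = 1 := by
  have hunit : IsUnit (S + K) := by
    have e : S + K = (S + K₀) + (K - K₀) := by abel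
    rw [e]
    refine isUnit_of_injective_add_compact ⟨⟨_, T₀, h1, h2⟩, rfl⟩ (hK.sub hK₀) ?_
    rw [← e]
    exact injective_of_lowerNorm_pos hpos
  obtain ⟨U, hU⟩ := hunit
  rw [← hU]
  exact ⟨↑U⁻¹, U.mul_inv, U.inv_mul⟩

end Semifredholm

section Algebra

variable {Y : Type*} [NormedAddCommGroup Y] [NormedSpace ℂ Y] {P : ℕ → Y →L[ℂ] Y}

theorem mul_sub_one_eq_neg {S K T : Y →L[ℂ] Y} (h : (S + K) * T = 1) : S * T - 1 = -(K * T) := by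
  rw [← h, add_mul, sub_add_cancel_left]

theorem mul_sub_one_eq_neg' {S K T : Y →L[ℂ] Y} (h : T * (S + K) = 1) : T * S - 1 = -(T * K) := by
  rw [← h, mul_add, sub_add_cancel_left]

theorem IsPCompact.neg {K : Y →L[ℂ] Y} (hK : IsPCompact P K) : IsPCompact P (-K) := by
  simpa using hK.smul (-1)

theorem IsPCompact.add_sub_self {A K : Y →L[ℂ] Y} (hK : IsPCompact P K) :
    IsPCompact P (A + K - A) := by
  rwa [add_sub_cancel_left]

theorem isCompactOperator_smul {T : Y →L[ℂ] Y} (c : ℂ) (hT : IsCompactOperator T) :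
    IsCompactOperator (c • T : Y →L[ℂ] Y) :=
  hT.smul c

theorem norm_le_of_bounded_below_compl {A Q : Y →L[ℂ] Y} {c : ℝ} (hc : 0 ≤ c)
    (h : ∀ x, c * ‖(1 - Q) x‖ ≤ ‖A ((1 - Q) x)‖) (x : Y) :
    c * ‖x‖ ≤ ‖A x‖ + ‖(((c + ‖A‖ : ℝ) : ℂ) • Q) x‖ := by
  have h1 : ‖x‖ ≤ ‖(1 - Q) x‖ + ‖Q x‖ := by
    have := norm_add_le ((1 - Q) x) (Q x)
    rwa [one_sub_apply, sub_add_cancel] at this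
  have h2 : ‖A ((1 - Q) x)‖ ≤ ‖A x‖ + ‖A‖ * ‖Q x‖ := by
    rw [one_sub_apply, map_sub]
    exact (norm_sub_le _ _).trans (add_le_add_right (A.le_opNorm _) _)
  rw [smul_apply, norm_smul, Complex.norm_real, Real.norm_of_nonneg (by positivity)]
  nlinarith [mul_le_mul_of_nonneg_left h1 hc, h x]

end Algebra

section Main

variable {Y : Type*} [NormedAddCommGroup Y] [NormedSpace ℂ Y] {P : ℕ → Y →L[ℂ] Y}

/-- The properties of the cube projections on `l^p(ℤ^N, X)`, `X` finite-dimensional. -/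
structure IsLpLike (P : ℕ → Y →L[ℂ] Y) : Prop where
  nested : NestedProj P
  finite : ∀ n, FiniteDimensional ℂ (P n).range
  monotone : MonotoneNorm P
  norming : ∀ x c, (∀ k, ‖P k x‖ ≤ c) → ‖x‖ ≤ c
  regular : ∀ A ∈ pAlgebra P, A.IsFredholm → ∀ f : StrongDual ℂ Y, (∀ x, f (A x) = 0) →
    (∀ n x, f (P n x) = 0) → f = 0

namespace IsLpLike

theorem norm_mul_compl_le (hP : IsLpLike P) {T : Y →L[ℂ] Y} (hT : T ∈ pAlgebra P) (n : ℕ) (c : ℝ)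
    (h : ∀ k, ‖T * (1 - P n) * P k‖ ≤ c) : ‖T * (1 - P n)‖ ≤ c := by
  have hc : 0 ≤ c := (norm_nonneg _).trans (h 0)
  refine ContinuousLinearMap.opNorm_le_bound _ hc fun x => hP.norming _ _ fun k => ?_
  refine le_of_forall_pos_le_add fun ε hε => ?_
  have hd : 0 < ε / (1 + ‖x‖) := by positivity
  obtain ⟨l, hl, hnl⟩ := ((hP.nested.eventually_norm_mul_compl_le hT k hd).and
    (eventually_ge_atTop n)).exists
  have e1 : P k ((T * (1 - P n)) x) =
      P k ((T * (1 - P n) * P l) x) + (P k * T * (1 - P l)) x := by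
    have : P k * (T * (1 - P n)) = P k * (T * (1 - P n) * P l) + P k * T * (1 - P l) := by
      conv_rhs => rw [← hP.nested.compl_mul_compl hnl]
      noncomm_ring
    exact congrArg (fun S : Y →L[ℂ] Y => S x) this
  rw [e1]
  refine (norm_add_le _ _).trans (add_le_add ?_ ?_)
  · exact (hP.nested.norm_apply_le _ _).trans (ContinuousLinearMap.le_of_opNorm_le _ (h l) x)
  · refine (ContinuousLinearMap.le_of_opNorm_le _ hl x).trans ?_
    rw [div_mul_eq_mul_div, div_le_iff₀ (by positivity)]
    nlinarith [norm_nonneg x]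

theorem norm_dualOp_mul_compl_le (hP : IsLpLike P) (T : Y →L[ℂ] Y) (n : ℕ) (c : ℝ)
    (h : ∀ k, ‖dualOp T * (1 - dualProj P n) * dualProj P k‖ ≤ c) :
    ‖dualOp T * (1 - dualProj P n)‖ ≤ c := by
  have h1 : ∀ k, ‖P k * ((1 - P n) * T)‖ ≤ c := fun k => by
    rw [← norm_dualOp]
    have := h k
    rw [one_sub_dualProj] at this
    exact this
  rw [one_sub_dualProj, ← dualOp_mul, norm_dualOp]
  refine ContinuousLinearMap.opNorm_le_bound _ ((norm_nonneg _).trans (h1 0)) fun x =>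
    hP.norming _ _ fun k => ?_
  exact ContinuousLinearMap.le_of_opNorm_le _ (h1 k) x

theorem one_le_norm_one_add (hP : IsLpLike P) {K : Y →L[ℂ] Y} (hK : IsCompactOperator K) :
    1 ≤ ‖1 + K‖ := by
  refine le_of_forall_lt fun c hc => ?_
  obtain ⟨c', h1, h2⟩ := exists_between hc
  refine h1.trans_le (hP.nested.le_norm_add_compact hP.monotone (one_mem _)
    (hP.norm_mul_compl_le (one_mem _)) hK fun n => ?_)
  rw [one_mul]
  exact h2.trans_le (hP.nested.one_le_norm_compl n)

theorem exists_fredholmData [CompleteSpace Y] (hP : IsLpLike P) {A : Y →L[ℂ] Y}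
    (hA : A ∈ pAlgebra P) (hF : A.IsFredholm) :
    ∃ (D : FredholmData A (Module.finrank ℂ A.ker) (Module.finrank ℂ (Y ⧸ A.range))) (k : ℕ),
      (∀ i x, D.φ i (P k x) = D.φ i x) ∧ ∀ j, P k (D.y j) = D.y j := by
  have hN := hP.nested
  let V : Submodule ℂ (StrongDual ℂ Y) :=
    { carrier := {φ | ∃ k, ∀ l ≥ k, ∀ x, φ (P l x) = φ x}
      add_mem' := by
        rintro φ ψ ⟨k, hk⟩ ⟨l, hl⟩
        refine ⟨max k l, fun n hn x => ?_⟩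
        simp [hk n (le_of_max_le_left hn), hl n (le_of_max_le_right hn)]
      zero_mem' := ⟨0, fun _ _ _ => rfl⟩
      smul_mem' := by
        rintro c φ ⟨k, hk⟩
        exact ⟨k, fun l hl x => by simp [hk l hl]⟩ }
  let W : Submodule ℂ Y :=
    { carrier := {y | ∃ k, ∀ l ≥ k, P l y = y}
      add_mem' := by
        rintro y z ⟨k, hk⟩ ⟨l, hl⟩
        refine ⟨max k l, fun n hn => ?_⟩
        rw [map_add, hk n (le_of_max_le_left hn), hl n (le_of_max_le_right hn)]
      zero_mem' := ⟨0, fun _ _ => map_zero _⟩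
      smul_mem' := by
        rintro c y ⟨k, hk⟩
        exact ⟨k, fun l hl => by rw [map_smul, hk l hl]⟩ }
  obtain ⟨D, hV, hW⟩ := EssLowerNorm.exists_fredholmData hF V (fun x _ hx => by
      refine norm_le_zero_iff.1 (hP.norming x 0 fun k => (norm_le_zero_iff.2 ?_))
      refine SeparatingDual.eq_zero_of_forall_dual_eq_zero (R := ℂ) fun g => ?_
      refine hx (g ∘L P k) ⟨k, fun l hl y => ?_⟩
      simp [hN.apply_of_le hl]) W (fun f hf hfW => by
      refine hP.regular A hA hF f hf fun n x => hfW _ ⟨n, fun l hl => ?_⟩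
      exact hN.apply_of_ge hl x)
  choose s hs using hV
  choose t ht using hW
  refine ⟨D, max (Finset.univ.sup s) (Finset.univ.sup t), fun i x => hs i _ ?_ x,
    fun j => ht j _ ?_⟩
  · exact (Finset.le_sup (Finset.mem_univ i)).trans (le_max_left _ _)
  · exact (Finset.le_sup (Finset.mem_univ j)).trans (le_max_right _ _)

theorem index_zero [CompleteSpace Y] (hP : IsLpLike P) {A : Y →L[ℂ] Y} (hA : A ∈ pAlgebra P)
    (hF : A.IsFredholm) (h0 : fredholmIndex A = 0) :
    ∃ τ : ℝ, 0 < τ ∧ essLowerNorm A = τ ∧ essLowerNorm (dualOp A) = τ ∧ pEssLowerNorm P A = τ ∧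
      pEssLowerNorm (dualProj P) (dualOp A) = τ ∧ muTilde P A = τ ∧
      muTilde (dualProj P) (dualOp A) = τ := by
  have hN := hP.nested
  obtain ⟨D, k, hφ, hy⟩ := hP.exists_fredholmData hA hF
  have hab : Module.finrank ℂ (Y ⧸ A.range) = Module.finrank ℂ A.ker := by
    rw [fredholmIndex] at h0
    omega
  revert D
  rw [hab]
  intro D hφ hy
  set K := finRankOp D.φ D.y with hK
  set T := D.R + finRankOp D.f D.x with hT
  have hCT : (A + K) * T = 1 := D.mul_eq_one
  have hTC : T * (A + K) = 1 := D.mul_eq_one'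
  have k1 : P k * K = K := by
    ext x
    simp [hK, hy]
  have k2 : K * P k = K := by
    ext x
    simp [hK, hφ]
  have hKP : IsPCompact P K := hN.isPCompact_of_mul k1 k2
  have hC : A + K ∈ pAlgebra P := add_mem hA hKP.mem_pAlgebra
  have hTP : T ∈ pAlgebra P := hN.inverse_mem_pAlgebra
    (hN.quasiCommutes_add (hN.quasiCommutes hP.monotone hA) k1 k2) hCT hTC
  have hCA : IsPCompact P (A + K - A) := by rwa [add_sub_cancel_left]
  obtain ⟨p0, p1, p2, p3⟩ := hN.essential_lowerNorms_eq hP.monotone hC hTP hCA hCT hTC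
    (hP.norm_mul_compl_le hTP)
  obtain ⟨q0, q1, q2, q3⟩ := (hN.dual hP.finite).essential_lowerNorms_eq
    (hP.monotone.dual hN) (hN.dualOp_mem_pAlgebra hP.finite hC)
    (hN.dualOp_mem_pAlgebra hP.finite hTP) (A := dualOp A)
    (by rw [← dualOp_sub]; exact hCA.dual)
    (by rw [← dualOp_mul, hTC, dualOp_one]) (by rw [← dualOp_mul, hCT, dualOp_one])
    (hP.norm_dualOp_mul_compl_le T)
  have hτ : ⨅ n, ‖dualOp T * (1 - dualProj P n)‖ = ⨅ n, ‖T * (1 - P n)‖ := by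
    rw [← hN.iInf_norm_compl_eq hTP]
    exact iInf_congr fun n => by rw [one_sub_dualProj, ← dualOp_mul, norm_dualOp]
  rw [hτ] at q1 q2 q3
  exact ⟨_, p0, p1, q1, p2, q2, p3, q3⟩

theorem mul_corner_sub_one {A : Y →L[ℂ] Y} {K T : SymmSpace Y →L[ℂ] SymmSpace Y}
    (h : (symmOp A + K) * T = 1) : A * corner T - 1 = corner (-(K * T)) := by
  rw [← symmOp_mul_corner, ← corner_one, ← corner_sub, mul_sub_one_eq_neg (Y := SymmSpace Y) h]

theorem corner_mul_sub_one {A : Y →L[ℂ] Y} {K T : SymmSpace Y →L[ℂ] SymmSpace Y}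
    (h : T * (symmOp A + K) = 1) : corner T * A - 1 = corner (-(T * K)) := by
  rw [← corner_mul_symmOp, ← corner_one, ← corner_sub, mul_sub_one_eq_neg' (Y := SymmSpace Y) h]

theorem isCompactOperator_mul_sub_one {A : Y →L[ℂ] Y} {K T : SymmSpace Y →L[ℂ] SymmSpace Y}
    (hK : IsCompactOperator K) (h1 : (symmOp A + K) * T = 1) (h2 : T * (symmOp A + K) = 1) :
    IsCompactOperator (A * corner T - 1 : Y →L[ℂ] Y) ∧
      IsCompactOperator (corner T * A - 1 : Y →L[ℂ] Y) := by
  rw [mul_corner_sub_one h1, corner_mul_sub_one h2]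
  exact ⟨isCompactOperator_corner (hK.comp_clm T).neg,
    isCompactOperator_corner (hK.clm_comp T).neg⟩

theorem isPCompact_mul_sub_one {A : Y →L[ℂ] Y} {K T : SymmSpace Y →L[ℂ] SymmSpace Y}
    (hK : IsPCompact (symmProj P) K) (hT : T ∈ pAlgebra (symmProj P))
    (h1 : (symmOp A + K) * T = 1) (h2 : T * (symmOp A + K) = 1) :
    IsPCompact P (A * corner T - 1) ∧ IsPCompact P (corner T * A - 1) := by
  rw [mul_corner_sub_one h1, corner_mul_sub_one h2]
  exact ⟨(IsPCompact.neg (Y := SymmSpace Y) (hT _ hK).2).corner,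
    (IsPCompact.neg (Y := SymmSpace Y) (hT _ hK).1).corner⟩

/-- If `A` is Fredholm then `A ⊕ A*` has an invertible `P ⊕ P*`-compact perturbation, whose inverse
belongs to the algebra of `P ⊕ P*`. -/
theorem exists_invertible_symm [CompleteSpace Y] (hP : IsLpLike P) {A : Y →L[ℂ] Y}
    (hA : A ∈ pAlgebra P) (hF : A.IsFredholm) :
    ∃ K T : SymmSpace Y →L[ℂ] SymmSpace Y, IsPCompact (symmProj P) K ∧ T ∈ pAlgebra (symmProj P) ∧
      symmOp A + K ∈ pAlgebra (symmProj P) ∧ (symmOp A + K) * T = 1 ∧ T * (symmOp A + K) = 1 := by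
  have hN := hP.nested
  have hS := hN.symm hP.finite
  obtain ⟨D, k, hφ, hy⟩ := hP.exists_fredholmData hA hF
  have k1 : symmProj P k * FredholmData.offDiag D.y D.φ = FredholmData.offDiag D.y D.φ := by
    refine ContinuousLinearMap.ext fun z => ?_
    change symmOp (P k) (FredholmData.offDiag D.y D.φ z) = _
    rw [FredholmData.offDiag_apply, symmOp_apply]
    refine Prod.ext ?_ (ContinuousLinearMap.ext fun u => ?_)
    · simp [hy]
    · simp [hφ]
  have k2 : FredholmData.offDiag D.y D.φ * symmProj P k = FredholmData.offDiag D.y D.φ := by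
    refine ContinuousLinearMap.ext fun z => ?_
    change FredholmData.offDiag D.y D.φ (symmOp (P k) z) = _
    rw [FredholmData.offDiag_apply, FredholmData.offDiag_apply, symmOp_apply]
    simp [hy, hφ]
  have hqc : QuasiCommutes (symmProj P) (symmOp A + FredholmData.offDiag D.y D.φ) :=
    hS.quasiCommutes_add (hN.quasiCommutes hP.monotone hA).symm k1 k2
  exact ⟨_, _, hS.isPCompact_of_mul k1 k2,
    hS.inverse_mem_pAlgebra hqc D.symmOp_add_offDiag_mul D.mul_symmOp_add_offDiag,
    hS.mem_pAlgebra_of_quasiCommutes hqc,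
    D.symmOp_add_offDiag_mul, D.mul_symmOp_add_offDiag⟩

theorem isFredholm_of_lowerNorm_symmOp_pos [CompleteSpace Y] {A : Y →L[ℂ] Y}
    {K : SymmSpace Y →L[ℂ] SymmSpace Y} (hK : IsCompactOperator K)
    (hpos : 0 < lowerNorm (symmOp A + K)) : A.IsFredholm := by
  have hbd : ∀ z, lowerNorm (symmOp A + K) * ‖z‖ ≤ ‖symmOp A z‖ + ‖K z‖ := fun z =>
    (lowerNorm_mul_norm_le _ z).trans (norm_add_le _ _)
  refine isFredholm_of_bounded_below (K := K ∘L .inl ℂ Y (StrongDual ℂ Y))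
    (L := K ∘L .inr ℂ Y (StrongDual ℂ Y)) (hK.comp_clm _) (hK.comp_clm _) hpos
    (fun x => ?_) fun f => ?_
  · have h := hbd (x, 0)
    have e : ‖symmOp A (x, 0)‖ = ‖A x‖ := by
      rw [symmOp_apply, map_zero]
      exact max_eq_left ((norm_zero (E := StrongDual ℂ Y)).trans_le (norm_nonneg _))
    have e' : ‖((x, 0) : SymmSpace Y)‖ = ‖x‖ :=
      max_eq_left ((norm_zero (E := StrongDual ℂ Y)).trans_le (norm_nonneg _))
    rwa [e, e'] at h
  · have h := hbd (0, f)
    have e : ‖symmOp A (0, f)‖ = ‖dualOp A f‖ := by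
      rw [symmOp_apply, map_zero]
      exact max_eq_right ((norm_zero (E := Y)).trans_le (norm_nonneg _))
    have e' : ‖((0, f) : SymmSpace Y)‖ = ‖f‖ :=
      max_eq_right ((norm_zero (E := Y)).trans_le (norm_nonneg _))
    rwa [e, e'] at h

theorem inv_norm_corner_le_essInvNormInv (hP : IsLpLike P) {A : Y →L[ℂ] Y}
    {K T : SymmSpace Y →L[ℂ] SymmSpace Y} (hK : IsCompactOperator K)
    (h1 : (symmOp A + K) * T = 1) (h2 : T * (symmOp A + K) = 1) :
    0 < ‖corner T‖ ∧ ‖corner T‖⁻¹ ≤ essInvNormInv A := by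
  obtain ⟨c1, c2⟩ := isCompactOperator_mul_sub_one hK h1 h2
  refine ⟨?_, inv_norm_le_cosetInvNormInv (compactIdeal Y) one_pos
    (fun i hi => hP.one_le_norm_one_add hi) c1 c2⟩
  rw [norm_pos_iff]
  intro h0
  rw [h0, mul_zero, zero_sub] at c1
  have := hP.one_le_norm_one_add c1
  simp at this
  linarith

theorem lowerNorm_le_essInvNormInv [CompleteSpace Y] (hP : IsLpLike P) {A : Y →L[ℂ] Y}
    (hA : A ∈ pAlgebra P) {K : SymmSpace Y →L[ℂ] SymmSpace Y} (hK : IsCompactOperator K) :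
    lowerNorm (symmOp A + K) ≤ essInvNormInv A := by
  rcases (lowerNorm_nonneg (Y := SymmSpace Y) (symmOp A + K)).eq_or_lt with h0 | hpos
  · exact h0.symm.trans_le (cosetInvNormInv_nonneg (compactIdeal Y) A)
  obtain ⟨K₀, T₀, hK₀, -, -, h1, h2⟩ :=
    hP.exists_invertible_symm hA (isFredholm_of_lowerNorm_symmOp_pos hK hpos)
  have hK₀' : IsCompactOperator K₀ :=
    (hP.nested.symm hP.finite).isCompactOperator_of_isPCompact hK₀
  obtain ⟨U, e1, e2⟩ := exists_inverse_of_lowerNorm_pos (Y := SymmSpace Y) hK₀' h1 h2 hK hpos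
  obtain ⟨hpos', hR⟩ := hP.inv_norm_corner_le_essInvNormInv hK e1 e2
  have hle := (norm_corner_le U).trans
    (norm_mul_lowerNorm_le_one (Y := SymmSpace Y) e1 hpos)
  exact ((le_inv_comm₀ hpos' hpos).1 hle).trans hR

theorem essInvNormInv_le_pEssInvNormInv [CompleteSpace Y] (hP : IsLpLike P) {A : Y →L[ℂ] Y}
    (hA : A ∈ pAlgebra P) : essInvNormInv A ≤ pEssInvNormInv P ⟨A, hA⟩ := by
  have hN := hP.nested
  have hS := hN.symm hP.finite
  refine le_of_forall_lt fun c hc => ?_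
  rcases lt_or_ge c 0 with hneg | hc0
  · exact hneg.trans_le (cosetInvNormInv_nonneg _ _)
  obtain ⟨c', hcc', hc'⟩ := exists_between hc
  have hc'0 := hc0.trans_lt hcc'
  obtain ⟨R, hAR, hRA, hR⟩ := exists_of_lt_cosetInvNormInv (compactIdeal Y) hc'0 hc'
  have hF : A.IsFredholm :=
    isFredholm_of_parametrix hRA hAR (add_sub_cancel _ _).symm (add_sub_cancel _ _).symm
  obtain ⟨K₀, T₀, hK₀, hT₀, -, h1, h2⟩ := hP.exists_invertible_symm hA hF
  obtain ⟨d1, d2⟩ := isPCompact_mul_sub_one hK₀ hT₀ h1 h2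
  set R₀ := corner T₀ with hR₀
  have hR₀P : R₀ ∈ pAlgebra P := hN.corner_mem_pAlgebra hP.finite hT₀
  have hdiff : IsCompactOperator (R - R₀ : Y →L[ℂ] Y) := by
    have : R - R₀ = (R * A - 1) * R₀ - R * (A * R₀ - 1) := by noncomm_ring
    rw [this]
    have d1' := hN.isCompactOperator_of_isPCompact d1
    have hRA' : IsCompactOperator (R * A - 1 : Y →L[ℂ] Y) := hRA
    exact (hRA'.comp_clm R₀).sub (d1'.clm_comp R)
  obtain ⟨n, hn⟩ : ∃ n, ‖R₀ * (1 - P n)‖ < c'⁻¹ := by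
    by_contra! hcon
    obtain ⟨ρ, hρ1, hρ2⟩ := exists_between hR
    have := hN.le_norm_add_compact hP.monotone hR₀P (hP.norm_mul_compl_le hR₀P) hdiff
      (fun n => hρ2.trans_le (hcon n))
    rw [add_sub_cancel] at this
    linarith
  have hPn : P n ∈ pAlgebra P := (hN.isPCompact n).mem_pAlgebra
  have hSP : R₀ * (1 - P n) ∈ pAlgebra P := mul_mem hR₀P (sub_mem (one_mem _) hPn)
  have m1 : IsPCompact P (A * (R₀ * (1 - P n)) - 1) := by
    have : A * (R₀ * (1 - P n)) - 1 = (A * R₀ - 1) + (-1 : ℂ) • (A * R₀ * P n) := by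
      rw [neg_one_smul]
      noncomm_ring
    rw [this]
    exact d1.add (((mul_mem hA hR₀P) _ (hN.isPCompact n)).1.smul _)
  have m2 : IsPCompact P (R₀ * (1 - P n) * A - 1) := by
    have : R₀ * (1 - P n) * A - 1 = (R₀ * A - 1) + (-1 : ℂ) • (R₀ * (P n * A)) := by
      rw [neg_one_smul]
      noncomm_ring
    rw [this]
    exact d2.add ((hR₀P _ (hA _ (hN.isPCompact n)).2).1.smul _)
  have hI : ∀ i ∈ pCompactIdeal P, 1 ≤ ‖1 + i‖ := fun i hi =>
    hP.one_le_norm_one_add (hN.isCompactOperator_of_isPCompact hi)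
  have hle := inv_norm_le_cosetInvNormInv (R := pAlgebra P) (pCompactIdeal P) one_pos hI
    (a := ⟨A, hA⟩) (r := ⟨R₀ * (1 - P n), hSP⟩) m1 m2
  refine hcc'.trans_le (le_trans ?_ hle)
  have hpos : 0 < ‖R₀ * (1 - P n)‖ := by
    rw [norm_pos_iff]
    intro h0
    rw [h0, mul_zero, zero_sub] at m1
    have := hP.one_le_norm_one_add (hN.isCompactOperator_of_isPCompact m1)
    simp at this
    linarith
  exact (le_inv_comm₀ hpos hc'0).1 hn.le

theorem pEssInvNormInv_le_mu (hP : IsLpLike P) {A : Y →L[ℂ] Y} (hA : A ∈ pAlgebra P) :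
    pEssInvNormInv P ⟨A, hA⟩ ≤ mu P A := by
  have hN := hP.nested
  have hD := hN.dual hP.finite
  refine le_of_forall_lt fun c hc => ?_
  rcases lt_or_ge c 0 with hneg | hc0
  · exact hneg.trans_le (le_min (hN.muTilde_nonneg _) (hD.muTilde_nonneg _))
  obtain ⟨c', hcc', hc'⟩ := exists_between hc
  have hc'0 := hc0.trans_lt hcc'
  obtain ⟨⟨R, hRP⟩, hAR, hRA, hR⟩ :=
    exists_of_lt_cosetInvNormInv (R := pAlgebra P) (pCompactIdeal P) hc'0 hc'
  have hAR' : IsPCompact P (A * R - 1) := hAR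
  have hRA' : IsPCompact P (R * A - 1) := hRA
  have hR' : ‖R‖ < c'⁻¹ := hR
  have bound : ∀ {Z : Type _} [NormedAddCommGroup Z] [NormedSpace ℂ Z] (B S : Z →L[ℂ] Z),
      ‖S‖ < c'⁻¹ → ∀ x, c' * ‖x‖ ≤ ‖B x‖ + ‖((c' : ℂ) • (S * B - 1)) x‖ := by
    intro Z _ _ B S hS x
    have e1 : x = S (B x) - (S * B - 1) x := by simp
    have e2 : ‖x‖ ≤ ‖S‖ * ‖B x‖ + ‖(S * B - 1) x‖ := by
      conv_lhs => rw [e1]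
      exact (norm_sub_le _ _).trans (add_le_add_left (S.le_opNorm _) _)
    rw [smul_apply, norm_smul, Complex.norm_real, Real.norm_of_nonneg hc'0.le]
    have e3 : c' * ‖S‖ ≤ 1 := by
      rw [← mul_inv_cancel₀ hc'0.ne']
      exact mul_le_mul_of_nonneg_left hS.le hc'0.le
    nlinarith [mul_le_mul_of_nonneg_left e2 hc'0.le,
      mul_le_mul_of_nonneg_right e3 (norm_nonneg (B x))]
  refine hcc'.trans_le (le_min ?_ ?_)
  · exact hN.le_muTilde_of_isPCompact (hRA'.smul _) (bound A R hR')
  · have h := bound (dualOp A) (dualOp R) (by rwa [norm_dualOp])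
    refine hD.le_muTilde_of_isPCompact (IsPCompact.smul _ ?_) h
    rw [← dualOp_mul, ← dualOp_one, ← dualOp_sub]
    exact hAR'.dual

theorem mu_le_pEssLowerNorm [CompleteSpace Y] (hP : IsLpLike P) {A : Y →L[ℂ] Y}
    (hA : A ∈ pAlgebra P)
    (hb : BddAbove {r : ℝ | ∃ K : SymmSpace Y →L[ℂ] SymmSpace Y,
      IsPCompact (symmProj P) K ∧ lowerNorm (symmOp A + K) = r}) :
    mu P A ≤ pEssLowerNorm (Y := SymmSpace Y) (symmProj P) (symmOp A) := by
  have hN := hP.nested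
  have hD := hN.dual hP.finite
  have hS := hN.symm hP.finite
  have := hS.nontrivial
  refine le_of_forall_lt fun c hc => ?_
  rcases lt_or_ge c 0 with hneg | hc0
  · refine hneg.trans_le ((lowerNorm_nonneg _).trans (le_csSup hb ⟨0, IsPCompact.zero _, rfl⟩))
  obtain ⟨c', hcc', hc'⟩ := exists_between hc
  have hc'0 := hc0.trans_lt hcc'
  obtain ⟨m₁, hm₁⟩ := hN.exists_of_lt_muTilde (hc'.trans_le (min_le_left _ _))
  obtain ⟨m₂, hm₂⟩ := hD.exists_of_lt_muTilde (hc'.trans_le (min_le_right _ _))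
  have hF : A.IsFredholm := by
    refine isFredholm_of_bounded_below (K := ((c' + ‖A‖ : ℝ) : ℂ) • P m₁)
      (L := ((c' + ‖dualOp A‖ : ℝ) : ℂ) • dualProj P m₂) (isCompactOperator_smul _ (hN.compact m₁))
      (isCompactOperator_smul _ (hD.compact m₂)) hc'0 (norm_le_of_bounded_below_compl hc'0.le hm₁)
      (norm_le_of_bounded_below_compl hc'0.le hm₂)
  obtain ⟨K₀, T₀, hK₀, hT₀, hC, h1, h2⟩ := hP.exists_invertible_symm hA hF
  have hCA : IsPCompact (symmProj P) (symmOp A + K₀ - symmOp A) :=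
    IsPCompact.add_sub_self (Y := SymmSpace Y) hK₀
  have hm : ∀ z, c' * ‖(1 - symmProj P (max m₁ m₂)) z‖ ≤
      ‖symmOp A ((1 - symmProj P (max m₁ m₂)) z)‖ := by
    intro z
    rw [one_sub_symmProj, symmOp_apply, symmOp_apply, Prod.norm_def, Prod.norm_def,
      mul_max_of_nonneg _ _ hc'0.le, ← one_sub_dualProj]
    refine max_le_max ?_ ?_
    · have := hm₁ ((1 - P (max m₁ m₂)) z.1)
      rwa [hN.compl_apply_compl (le_max_left _ _)] at this
    · have := hm₂ ((1 - dualProj P (max m₁ m₂)) z.2)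
      rwa [hD.compl_apply_compl (le_max_right _ _)] at this
  obtain ⟨c'', hc1, hc2⟩ := exists_between hcc'
  have hc''0 := hc0.trans_lt hc1
  obtain ⟨n, hn⟩ := hS.exists_norm_mul_compl_lt hCA h1 hT₀ hc'0 hm
    ((inv_lt_inv₀ hc'0 hc''0).2 hc2)
  obtain ⟨K, S, hK, k1, k2, k3⟩ := hS.exists_perturbation hC hCA h1 h2 hn
  refine lt_of_lt_of_le ?_ ((inv_norm_le_lowerNorm k2).trans (le_csSup hb ⟨K, hK, rfl⟩))
  refine hc1.trans_le ((le_inv_comm₀ (norm_pos_iff.2 fun h0 => ?_) hc''0).1 k3.le)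
  rw [h0] at k1
  obtain ⟨z, hz⟩ := exists_ne (0 : SymmSpace Y)
  refine hz ?_
  have := congrArg (fun T : SymmSpace Y →L[ℂ] SymmSpace Y => T z) k1
  change (symmOp A + K) 0 = z at this
  rw [← this, map_zero]

theorem essential_lowerNorms_symmOp_eq [CompleteSpace Y] (hP : IsLpLike P) {A : Y →L[ℂ] Y}
    (hA : A ∈ pAlgebra P) :
    essLowerNorm (Y := SymmSpace Y) (symmOp A) =
        pEssLowerNorm (Y := SymmSpace Y) (symmProj P) (symmOp A) ∧
      pEssLowerNorm (Y := SymmSpace Y) (symmProj P) (symmOp A) = mu P A ∧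
      mu P A = pEssInvNormInv P ⟨A, hA⟩ ∧ pEssInvNormInv P ⟨A, hA⟩ = essInvNormInv A := by
  have hS := hP.nested.symm hP.finite
  have hb : BddAbove {r : ℝ | ∃ K : SymmSpace Y →L[ℂ] SymmSpace Y,
      IsCompactOperator K ∧ lowerNorm (symmOp A + K) = r} := by
    refine ⟨essInvNormInv A, ?_⟩
    rintro _ ⟨K, hK, rfl⟩
    exact hP.lowerNorm_le_essInvNormInv hA hK
  have hsub : {r : ℝ | ∃ K : SymmSpace Y →L[ℂ] SymmSpace Y,
      IsPCompact (symmProj P) K ∧ lowerNorm (symmOp A + K) = r} ⊆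
      {r : ℝ | ∃ K : SymmSpace Y →L[ℂ] SymmSpace Y,
        IsCompactOperator K ∧ lowerNorm (symmOp A + K) = r} := by
    rintro _ ⟨K, hK, rfl⟩
    exact ⟨K, hS.isCompactOperator_of_isPCompact hK, rfl⟩
  have h1 : pEssLowerNorm (Y := SymmSpace Y) (symmProj P) (symmOp A) ≤
      essLowerNorm (Y := SymmSpace Y) (symmOp A) :=
    csSup_le_csSup hb ⟨_, 0, IsPCompact.zero _, rfl⟩ hsub
  have h2 : essLowerNorm (Y := SymmSpace Y) (symmOp A) ≤ essInvNormInv A := by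
    refine csSup_le ⟨_, 0, isCompactOperator_zero, rfl⟩ ?_
    rintro _ ⟨K, hK, rfl⟩
    exact hP.lowerNorm_le_essInvNormInv hA hK
  have h3 := hP.essInvNormInv_le_pEssInvNormInv hA
  have h4 := hP.pEssInvNormInv_le_mu hA
  have h5 := hP.mu_le_pEssLowerNorm hA (hb.mono hsub)
  exact ⟨le_antisymm (h2.trans (h3.trans (h4.trans h5))) h1,
    le_antisymm (h1.trans (h2.trans (h3.trans h4))) h5,
    le_antisymm (h5.trans (h1.trans (h2.trans h3))) h4,
    le_antisymm (h4.trans (h5.trans (h1.trans h2))) h3⟩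

end IsLpLike

end Main

section Regularity

theorem exists_tendsto_of_norm_le {E : Type*} [NormedAddCommGroup E] [ProperSpace E]
    (U : Ultrafilter ℕ) {u : ℕ → E} {C : ℝ} (h : ∀ n, ‖u n‖ ≤ C) :
    ∃ a, ‖a‖ ≤ C ∧ Tendsto u U (𝓝 a) := by
  obtain ⟨a, ha, hlim⟩ := (isCompact_closedBall (0 : E) C).ultrafilter_le_nhds (U.map u) (by
    rw [le_principal_iff]
    exact Filter.univ_mem' (f := (U : Filter ℕ)) fun n => mem_closedBall_zero_iff.2 (h n))
  exact ⟨a, mem_closedBall_zero_iff.1 ha, hlim⟩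

variable {Y : Type*} [NormedAddCommGroup Y] [NormedSpace ℂ Y] {P : ℕ → Y →L[ℂ] Y}

theorem NestedProj.tendsto_apply_of_tendsto {hP : NestedProj P} {A : Y →L[ℂ] Y}
    (hA : A ∈ pAlgebra P) {U : Filter ℕ} {z : ℕ → Y} {C : ℝ} (hz : ∀ n, ‖z n‖ ≤ C)
    {x : Y} (hx : ∀ r, Tendsto (fun n => P r (z n)) U (𝓝 (P r x))) (l : ℕ) :
    Tendsto (fun n => P l (A (z n))) U (𝓝 (P l (A x))) := by
  rw [Metric.tendsto_nhds]
  intro ε hε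
  have hC : 0 ≤ C := (norm_nonneg _).trans (hz 0)
  have hd : 0 < ε / (2 * (C + ‖x‖ + 1)) := by positivity
  obtain ⟨r, hr⟩ := (hP.eventually_norm_mul_compl_le hA l hd).exists
  have h1 : Tendsto (fun n => P l (A (P r (z n)))) U (𝓝 (P l (A (P r x)))) :=
    (((P l).continuous.comp A.continuous).tendsto _).comp (hx r)
  filter_upwards [Metric.tendsto_nhds.1 h1 (ε / 2) (by positivity)] with n hn
  rw [dist_eq_norm] at hn ⊢
  have e : P l (A (z n)) - P l (A x) = (P l (A (P r (z n))) - P l (A (P r x))) +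
      (P l * A * (1 - P r)) (z n - x) := by
    change _ = _ + P l (A (z n - x - P r (z n - x)))
    simp only [map_sub]
    abel
  rw [e]
  have h2 : ‖(P l * A * (1 - P r)) (z n - x)‖ ≤ ε / 2 := by
    refine (ContinuousLinearMap.le_of_opNorm_le _ hr _).trans ?_
    have h3 : ‖z n - x‖ ≤ C + ‖x‖ + 1 :=
      (norm_sub_le _ _).trans (by linarith [hz n])
    calc ε / (2 * (C + ‖x‖ + 1)) * ‖z n - x‖
        ≤ ε / (2 * (C + ‖x‖ + 1)) * (C + ‖x‖ + 1) := mul_le_mul_of_nonneg_left h3 hd.le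
      _ = ε / 2 := by field_simp
  exact (norm_add_le _ _).trans_lt (by linarith)

/-- If bounded sequences have limit points in the sense of coordinates, then a functional that
annihilates the range of a Fredholm operator and all `P`-finite vectors vanishes. -/
theorem NestedProj.eq_zero_of_coordinatewise_compact [CompleteSpace Y] (hP : NestedProj P)
    (h0 : ∀ x, (∀ k, P k x = 0) → x = 0)
    (hcpt : ∀ (z : ℕ → Y) (C : ℝ), (∀ n, ‖z n‖ ≤ C) →
      ∃ x, ∀ r, Tendsto (fun n => P r (z n)) (hyperfilter ℕ) (𝓝 (P r x)))
    {A : Y →L[ℂ] Y} (hA : A ∈ pAlgebra P) (hF : A.IsFredholm) {f : StrongDual ℂ Y}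
    (hf : ∀ x, f (A x) = 0) (hfP : ∀ n x, f (P n x) = 0) : f = 0 := by
  obtain ⟨D, -, -⟩ := exists_fredholmData hF ⊤
    (fun x _ hx => SeparatingDual.eq_zero_of_forall_dual_eq_zero (R := ℂ) fun φ => hx φ trivial) ⊤
    (fun f _ hf => ContinuousLinearMap.ext fun w => hf w trivial)
  ext y
  have hR : ∀ n, ‖D.R (P n y)‖ ≤ ‖D.R‖ * ‖y‖ := fun n =>
    (D.R.le_opNorm _).trans (mul_le_mul_of_nonneg_left (hP.norm_apply_le n y) (norm_nonneg _))
  obtain ⟨x, hx⟩ := hcpt _ _ hR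
  have hc : ∀ j, ∃ c, Tendsto (fun n => D.f j (P n y)) (hyperfilter ℕ) (𝓝 c) := fun j => by
    obtain ⟨c, -, hc⟩ := exists_tendsto_of_norm_le (hyperfilter ℕ) fun n =>
      ((D.f j).le_opNorm (P n y)).trans
        (mul_le_mul_of_nonneg_left (hP.norm_apply_le n y) (norm_nonneg _))
    exact ⟨c, hc⟩
  choose c hc using hc
  have hy : y = A x + ∑ j, c j • D.y j := by
    rw [← sub_eq_zero]
    refine h0 _ fun l => ?_
    rw [map_sub, sub_eq_zero, map_add]
    have h1 := NestedProj.tendsto_apply_of_tendsto (hP := hP) hA hR hx l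
    have h2 : Tendsto (fun n => ∑ j, D.f j (P n y) • D.y j) (hyperfilter ℕ)
        (𝓝 (∑ j, c j • D.y j)) :=
      tendsto_finsetSum _ fun j _ => (hc j).smul_const _
    have h3 := h1.add (((P l).continuous.tendsto _).comp h2)
    refine tendsto_nhds_unique_of_eventuallyEq tendsto_const_nhds h3 ?_
    have h4 : ∀ᶠ n in (hyperfilter ℕ : Filter ℕ), l ≤ n :=
      Nat.hyperfilter_le_atTop (eventually_ge_atTop l)
    filter_upwards [h4] with n hn
    rw [D.map_R, Function.comp_apply, ← map_add, sub_add_cancel, hP.apply_of_le hn]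
  have h5 : Tendsto (fun n => ∑ j, D.f j (P n y) • f (D.y j)) (hyperfilter ℕ)
      (𝓝 (∑ j, c j • f (D.y j))) :=
    tendsto_finsetSum _ fun j _ => (hc j).smul_const _
  have h6 : ∀ n, ∑ j, D.f j (P n y) • f (D.y j) = 0 := fun n => by
    have h := congrArg f (D.map_R (P n y))
    rw [hf, map_sub, hfP, zero_sub, map_sum] at h
    simpa using h.symm
  simp only [h6] at h5
  rw [hy, map_add, hf, zero_add, map_sum]
  simp only [map_smul]
  exact tendsto_nhds_unique h5 tendsto_const_nhds |>.symm ▸ rfl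

end Regularity

section LpSpaces

variable {ι X : Type*} [NormedAddCommGroup X] {q : ℝ≥0∞}

theorem lp_norm_le_of_forall_le (hq : q = ∞) {x : lp (fun _ : ι => X) q} {c : ℝ} (hc : 0 ≤ c)
    (h : ∀ i, ‖x i‖ ≤ c) : ‖x‖ ≤ c := by
  subst hq
  exact lp.norm_le_of_forall_le hc h

theorem lp_norm_rpow_add (hq : 0 < q.toReal) {u v : lp (fun _ : ι => X) q}
    (huv : ∀ i, u i = 0 ∨ v i = 0) :
    ‖u + v‖ ^ q.toReal = ‖u‖ ^ q.toReal + ‖v‖ ^ q.toReal := by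
  refine (lp.hasSum_norm hq (u + v)).unique ?_
  convert (lp.hasSum_norm hq u).add (lp.hasSum_norm hq v) using 2 with i
  rcases huv i with h | h <;> simp [h, Real.zero_rpow hq.ne']

theorem lp_norm_add_le_norm_add [Fact (1 ≤ q)] {u v x y : lp (fun _ : ι => X) q}
    (huv : ∀ i, u i = 0 ∨ v i = 0) (hxy : ∀ i, x i = 0 ∨ y i = 0) (hux : ‖u‖ ≤ ‖x‖)
    (hvy : ‖v‖ ≤ ‖y‖) : ‖u + v‖ ≤ ‖x + y‖ := by
  have hq0 : q ≠ 0 := (zero_lt_one.trans_le (Fact.out : 1 ≤ q)).ne'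
  by_cases hq : q = ∞
  · have hx : ‖x‖ ≤ ‖x + y‖ := lp.norm_mono hq0 fun i => by
      rcases hxy i with h | h <;> simp [h]
    have hy : ‖y‖ ≤ ‖x + y‖ := lp.norm_mono hq0 fun i => by
      rcases hxy i with h | h <;> simp [h]
    refine lp_norm_le_of_forall_le hq (norm_nonneg _) fun i => ?_
    rcases huv i with h | h
    · simpa [h] using (lp.norm_apply_le_norm hq0 v i).trans (hvy.trans hy)
    · simpa [h] using (lp.norm_apply_le_norm hq0 u i).trans (hux.trans hx)
  · have hq' : 0 < q.toReal := ENNReal.toReal_pos hq0 hq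
    rw [← Real.rpow_le_rpow_iff (norm_nonneg _) (norm_nonneg _) hq', lp_norm_rpow_add hq' huv,
      lp_norm_rpow_add hq' hxy]
    exact add_le_add (Real.rpow_le_rpow (norm_nonneg _) hux hq'.le)
      (Real.rpow_le_rpow (norm_nonneg _) hvy hq'.le)

/-- The norm of a sequence is the supremum of the norms of its restrictions to an exhausting family
of sets. -/
theorem lp_norm_le_of_forall_eq_on [Fact (1 ≤ q)] {x : lp (fun _ : ι => X) q} {c : ℝ} (hc : 0 ≤ c)
    (h : ∀ s : Finset ι, ∃ y : lp (fun _ : ι => X) q, (∀ i ∈ s, y i = x i) ∧ ‖y‖ ≤ c) :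
    ‖x‖ ≤ c := by
  have hq0 : q ≠ 0 := (zero_lt_one.trans_le (Fact.out : 1 ≤ q)).ne'
  by_cases hq : q = ∞
  · refine lp_norm_le_of_forall_le hq hc fun i => ?_
    obtain ⟨y, hy, hyc⟩ := h {i}
    rw [← hy i (Finset.mem_singleton_self i)]
    exact (lp.norm_apply_le_norm hq0 y i).trans hyc
  · have hq' : 0 < q.toReal := ENNReal.toReal_pos hq0 hq
    refine lp.norm_le_of_forall_sum_le hq' hc fun s => ?_
    obtain ⟨y, hy, hyc⟩ := h s
    calc ∑ i ∈ s, ‖x i‖ ^ q.toReal = ∑ i ∈ s, ‖y i‖ ^ q.toReal :=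
          Finset.sum_congr rfl fun i hi => by rw [hy i hi]
      _ ≤ ‖y‖ ^ q.toReal := lp.sum_rpow_le_norm_rpow hq' y s
      _ ≤ c ^ q.toReal := Real.rpow_le_rpow (norm_nonneg _) hyc hq'.le

end LpSpaces

section Box

variable {N : ℕ}

theorem box_inter_box (m n : ℕ) : box N m ∩ box N n = box N (min m n) := by
  ext i
  simp only [box, Set.mem_inter_iff, Set.mem_Icc, Pi.le_def]
  constructor
  · rintro ⟨⟨h1, h2⟩, h3, h4⟩
    exact ⟨fun j => by have := h1 j; have := h3 j; omega,
      fun j => by have := h2 j; have := h4 j; omega⟩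
  · rintro ⟨h1, h2⟩
    exact ⟨⟨fun j => by have := h1 j; omega, fun j => by have := h2 j; omega⟩,
      fun j => by have := h1 j; omega, fun j => by have := h2 j; omega⟩

theorem exists_subset_box (s : Set (Fin N → ℤ)) (hs : s.Finite) : ∃ n, s ⊆ box N n := by
  obtain ⟨n, hn⟩ : ∃ n : ℕ, ∀ i ∈ hs.toFinset, ∀ j, (i j).natAbs ≤ n :=
    ⟨hs.toFinset.sup fun i => Finset.univ.sup fun j => (i j).natAbs, fun i hi j =>
      (Finset.le_sup (f := fun j => (i j).natAbs) (Finset.mem_univ j)).trans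
        (Finset.le_sup (f := fun i : Fin N → ℤ => Finset.univ.sup fun j => (i j).natAbs) hi)⟩
  refine ⟨n, fun i hi => ⟨fun j => ?_, fun j => ?_⟩⟩
  · change -(n : ℤ) ≤ i j
    have := hn i (hs.mem_toFinset.2 hi) j
    omega
  · change i j ≤ (n : ℤ)
    have := hn i (hs.mem_toFinset.2 hi) j
    omega

theorem exists_notMem_box (hN : 1 ≤ N) (n : ℕ) : ∃ i, i ∉ box N n := by
  refine ⟨fun _ => n + 1, fun h => ?_⟩
  have := h.2 ⟨0, hN⟩
  simp at this

variable {p : SeqExponent} {X : Type*} [NormedAddCommGroup X] [NormedSpace ℂ X]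

theorem ambient_ne_zero (p : SeqExponent) : p.ambient ≠ 0 :=
  (zero_lt_one.trans_le (Fact.out : 1 ≤ p.ambient)).ne'

theorem boxProj_apply_of_mem {n : ℕ} (x : SeqSpace N p X) {i : Fin N → ℤ} (hi : i ∈ box N n) :
    (boxProj N p X n x : AmbientSpace N p X) i = (x : AmbientSpace N p X) i :=
  Set.indicator_of_mem hi _

theorem boxProj_apply_of_notMem {n : ℕ} (x : SeqSpace N p X) {i : Fin N → ℤ} (hi : i ∉ box N n) :
    (boxProj N p X n x : AmbientSpace N p X) i = 0 :=
  Set.indicator_of_notMem hi _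

theorem seqSpace_ext {x y : SeqSpace N p X}
    (h : ∀ i, (x : AmbientSpace N p X) i = (y : AmbientSpace N p X) i) : x = y :=
  Subtype.ext (lp.ext (funext h))

theorem boxProj_eq_self {n : ℕ} {x : SeqSpace N p X}
    (h : ∀ i ∉ box N n, (x : AmbientSpace N p X) i = 0) : boxProj N p X n x = x :=
  seqSpace_ext fun i => by
    by_cases hi : i ∈ box N n
    · exact boxProj_apply_of_mem x hi
    · rw [boxProj_apply_of_notMem x hi, h i hi]

theorem finiteDimensional_range_boxProj [FiniteDimensional ℂ X] (n : ℕ) :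
    FiniteDimensional ℂ (boxProj N p X n).range := by
  have : Finite (box N n) := (Set.finite_Icc _ _ : (box N n).Finite).to_subtype
  let e : (boxProj N p X n).range →ₗ[ℂ] (box N n → X) :=
    { toFun := fun x i => ((x : SeqSpace N p X) : AmbientSpace N p X) i
      map_add' := fun _ _ => rfl
      map_smul' := fun _ _ => rfl }
  refine FiniteDimensional.of_injective (V₂ := box N n → X) e ?_
  rintro ⟨x, u, rfl⟩ ⟨y, v, rfl⟩ h
  refine Subtype.ext (seqSpace_ext fun i => ?_)
  by_cases hi : i ∈ box N n
  · exact congrFun h ⟨i, hi⟩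
  · exact (boxProj_apply_of_notMem u hi).trans (boxProj_apply_of_notMem v hi).symm

instance completeSpace_seqSpace [CompleteSpace X] : CompleteSpace (SeqSpace N p X) := by
  have : IsClosed (seqSubspace N X p : Set (AmbientSpace N p X)) := by
    cases p with
    | zero => exact Submodule.isClosed_topologicalClosure _
    | ofENNReal p hp => exact isClosed_univ
  exact this.completeSpace_coe

theorem nestedProj_boxProj [FiniteDimensional ℂ X] [Nontrivial X] (hN : 1 ≤ N) :
    NestedProj (boxProj N p X) where
  mul m n := ContinuousLinearMap.ext fun x => seqSpace_ext fun i => by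
    change (box N m).indicator ((box N n).indicator (x : AmbientSpace N p X)) i = _
    rw [Set.indicator_indicator, box_inter_box]
    rfl
  norm_le n := LinearMap.mkContinuous_norm_le _ zero_le_one _
  norm_compl_le n := ContinuousLinearMap.opNorm_le_bound _ zero_le_one fun x => by
    rw [one_mul]
    refine lp.norm_mono (ambient_ne_zero p) fun i => ?_
    change ‖(x : AmbientSpace N p X) i - (boxProj N p X n x : AmbientSpace N p X) i‖ ≤ _
    by_cases hi : i ∈ box N n
    · simp [boxProj_apply_of_mem x hi]
    · simp [boxProj_apply_of_notMem x hi]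
  compact n := by
    have := finiteDimensional_range_boxProj (N := N) (p := p) (X := X) n
    exact isCompactOperator_of_finiteDimensional_range
  compl_ne n h := by
    obtain ⟨i, hi⟩ := exists_notMem_box hN n
    obtain ⟨a, ha⟩ := exists_ne (0 : X)
    let x : SeqSpace N p X := ⟨lp.single p.ambient i a, finSupported_le N p X
      ((Set.finite_singleton i).subset fun j hj => by
        by_contra hne
        exact hj (lp.single_apply_ne (E := fun _ => X) p.ambient i a hne))⟩
    have h1 := congrArg (fun T : SeqSpace N p X →L[ℂ] SeqSpace N p X =>
      (T x : AmbientSpace N p X) i) h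
    change (lp.single p.ambient i a : AmbientSpace N p X) i -
      (boxProj N p X n x : AmbientSpace N p X) i = 0 at h1
    rw [boxProj_apply_of_notMem x hi, sub_zero, lp.single_apply_self] at h1
    exact ha h1

theorem eq_zero_or_eq_zero_of_boxProj {n : ℕ} {u v : SeqSpace N p X} (hu : boxProj N p X n u = u)
    (hv : boxProj N p X n v = 0) (i : Fin N → ℤ) :
    (u : AmbientSpace N p X) i = 0 ∨ (v : AmbientSpace N p X) i = 0 := by
  by_cases hi : i ∈ box N n
  · right
    rw [← boxProj_apply_of_mem v hi, hv]
    rfl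
  · left
    rw [← hu]
    exact boxProj_apply_of_notMem u hi

theorem monotoneNorm_boxProj : MonotoneNorm (boxProj N p X) :=
  fun _ _ _ _ _ _ hu hv hx hy hux hvy =>
    lp_norm_add_le_norm_add (eq_zero_or_eq_zero_of_boxProj hu hv)
      (eq_zero_or_eq_zero_of_boxProj hx hy) hux hvy

theorem norm_le_of_boxProj {x : SeqSpace N p X} {c : ℝ} (h : ∀ k, ‖boxProj N p X k x‖ ≤ c) :
    ‖x‖ ≤ c := by
  refine lp_norm_le_of_forall_eq_on ((norm_nonneg _).trans (h 0)) fun s => ?_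
  obtain ⟨k, hk⟩ := exists_subset_box (s : Set (Fin N → ℤ)) s.finite_toSet
  exact ⟨boxProj N p X k x, fun i hi => boxProj_apply_of_mem x (hk hi), h k⟩

theorem exists_coordinatewise_limit [FiniteDimensional ℂ X] (hp : p.ambient = ∞)
    (htop : seqSubspace N X p = ⊤) (z : ℕ → SeqSpace N p X) (C : ℝ) (hz : ∀ n, ‖z n‖ ≤ C) :
    ∃ x : SeqSpace N p X, ∀ r, Tendsto (fun n => boxProj N p X r (z n)) (hyperfilter ℕ)
      (𝓝 (boxProj N p X r x)) := by
  have : ProperSpace X := FiniteDimensional.proper ℂ X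
  have hzi : ∀ n i, ‖(z n : AmbientSpace N p X) i‖ ≤ C := fun n i =>
    (lp.norm_apply_le_norm (ambient_ne_zero p) _ i).trans (hz n)
  have hlim := fun i => exists_tendsto_of_norm_le (hyperfilter ℕ) fun n => hzi n i
  choose a ha hlim using hlim
  have hmem : Memℓp a p.ambient := by
    rw [hp, memℓp_infty_iff]
    exact ⟨C, by rintro _ ⟨i, rfl⟩; exact ha i⟩
  refine ⟨⟨⟨a, hmem⟩, htop ▸ Submodule.mem_top⟩, fun r => ?_⟩
  have hfin : (box N r).Finite := Set.finite_Icc _ _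
  rw [tendsto_iff_norm_sub_tendsto_zero]
  have hsum : Tendsto (fun n => ∑ i ∈ hfin.toFinset, ‖(z n : AmbientSpace N p X) i - a i‖)
      (hyperfilter ℕ) (𝓝 0) := by
    rw [← Finset.sum_const_zero (s := hfin.toFinset)]
    exact tendsto_finsetSum _ fun i _ => tendsto_iff_norm_sub_tendsto_zero.1 (hlim i)
  refine squeeze_zero (fun _ => norm_nonneg _) (fun n => ?_) hsum
  rw [← map_sub]
  refine lp_norm_le_of_forall_le hp (Finset.sum_nonneg fun _ _ => norm_nonneg _) fun i => ?_
  by_cases hi : i ∈ box N r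
  · refine (congrArg norm (boxProj_apply_of_mem _ hi)).trans_le ?_
    exact Finset.single_le_sum (f := fun i => ‖(z n : AmbientSpace N p X) i - a i‖)
      (fun _ _ => norm_nonneg _) (hfin.mem_toFinset.2 hi)
  · refine (congrArg norm (boxProj_apply_of_notMem _ hi)).trans_le ?_
    rw [norm_zero]
    exact Finset.sum_nonneg fun _ _ => norm_nonneg _

theorem dense_boxProj_fixed (hp : p.ambient = ∞ → p = .zero) :
    Dense {x : SeqSpace N p X | ∃ n, boxProj N p X n x = x} := by
  have key : ∀ x : AmbientSpace N p X, x ∈ finSupported N p X →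
      ∃ y ∈ {x : SeqSpace N p X | ∃ n, boxProj N p X n x = x}, (y : AmbientSpace N p X) = x := by
    intro x hx
    obtain ⟨n, hn⟩ := exists_subset_box _ hx
    refine ⟨⟨x, finSupported_le N p X hx⟩, ⟨n, boxProj_eq_self fun i hi => ?_⟩, rfl⟩
    by_contra h
    exact hi (hn h)
  intro x
  rw [Topology.IsInducing.subtypeVal.closure_eq_preimage_closure_image]
  have hx : (x : AmbientSpace N p X) ∈ closure (finSupported N p X : Set (AmbientSpace N p X)) := by
    by_cases hq : p.ambient = ∞
    · obtain rfl := hp hq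
      exact x.2
    · refine mem_closure_of_tendsto (lp.hasSum_single hq (x : AmbientSpace N p X))
        (Filter.Eventually.of_forall fun s => ?_)
      refine Submodule.sum_mem _ fun i _ => (Set.finite_singleton i).subset fun j hj => ?_
      by_contra hne
      exact hj (lp.single_apply_ne (E := fun _ => X) p.ambient i _ hne)
  exact closure_mono (fun y hy => key y hy) hx

theorem isLpLike_boxProj [FiniteDimensional ℂ X] [Nontrivial X] (hN : 1 ≤ N) (p : SeqExponent) :
    IsLpLike (boxProj N p X) where
  nested := nestedProj_boxProj hN
  finite := finiteDimensional_range_boxProj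
  monotone := monotoneNorm_boxProj
  norming _ _ := norm_le_of_boxProj
  regular A hA hF f hf hfP := by
    have : CompleteSpace X := FiniteDimensional.complete ℂ X
    by_cases hp : p.ambient = ∞ → p = .zero
    · refine ContinuousLinearMap.ext fun x => ?_
      have hcl : IsClosed {x | f x = 0} := isClosed_eq f.continuous continuous_const
      refine hcl.closure_subset_iff.2 ?_ (dense_boxProj_fixed hp x)
      rintro y ⟨n, hn⟩
      rw [← hn]
      exact hfP n y
    · obtain ⟨hp1, hp2⟩ := Classical.not_imp.1 hp
      have htop : seqSubspace N X p = ⊤ := by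
        cases p with
        | zero => exact absurd rfl hp2
        | ofENNReal p hp => rfl
      exact (nestedProj_boxProj hN).eq_zero_of_coordinatewise_compact
        (fun x hx => norm_le_zero_iff.1 (norm_le_of_boxProj fun k => by rw [hx k, norm_zero]))
        (exists_coordinatewise_limit hp1 htop) hA hF hf hfP

end Box

end EssLowerNorm

end

open EssLowerNorm
theorem theorem5 {X : Type*} [NormedAddCommGroup X] [NormedSpace ℂ X]
    [FiniteDimensional ℂ X] [Nontrivial X] (N : ℕ) (hN : 1 ≤ N) (p : SeqExponent)
    (A : SeqSpace N p X →L[ℂ] SeqSpace N p X) (hA : A ∈ pAlgebra (boxProj N p X)) :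
    (essLowerNorm (Y := SymmSpace (SeqSpace N p X)) (symmOp A) =
        pEssLowerNorm (Y := SymmSpace (SeqSpace N p X))
          (symmProj (boxProj N p X)) (symmOp A) ∧
      pEssLowerNorm (Y := SymmSpace (SeqSpace N p X))
          (symmProj (boxProj N p X)) (symmOp A) = mu (boxProj N p X) A ∧
      mu (boxProj N p X) A = pEssInvNormInv (boxProj N p X) ⟨A, hA⟩ ∧
      pEssInvNormInv (boxProj N p X) ⟨A, hA⟩ = essInvNormInv A) ∧
    (A.IsFredholm ∧ fredholmIndex A = 0 →
      essLowerNorm A = essLowerNorm (dualOp A) ∧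
      essLowerNorm (dualOp A) = pEssLowerNorm (boxProj N p X) A ∧
      pEssLowerNorm (boxProj N p X) A =
        pEssLowerNorm (dualProj (boxProj N p X)) (dualOp A) ∧
      pEssLowerNorm (dualProj (boxProj N p X)) (dualOp A) = mu (boxProj N p X) A ∧
      mu (boxProj N p X) A = muTilde (boxProj N p X) A ∧
      muTilde (boxProj N p X) A = muTilde (dualProj (boxProj N p X)) (dualOp A) ∧
      0 < muTilde (dualProj (boxProj N p X)) (dualOp A)) ∧
    (0 < essLowerNorm A ∧ 0 < essLowerNorm (dualOp A) →
      A.IsFredholm ∧ fredholmIndex A = 0) := by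
  have : CompleteSpace X := FiniteDimensional.complete ℂ X
  have hP := isLpLike_boxProj (X := X) hN p
  refine ⟨hP.essential_lowerNorms_symmOp_eq hA, fun ⟨hF, h0⟩ => ?_, fun ⟨h1, h2⟩ =>
    fredholm_index_zero_of_essLowerNorm_pos h1 h2⟩
  obtain ⟨τ, hτ, e1, e2, e3, e4, e5, e6⟩ := hP.index_zero hA hF h0
  have e7 : mu (boxProj N p X) A = τ := by rw [mu, e5, e6, min_self]
  rw [e1, e2, e3, e4, e5, e6, e7]
  exact ⟨rfl, rfl, rfl, rfl, rfl, rfl, hτ⟩
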